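/- Let $A$ be the mod 2 Steenrod algebra, $A_1\subset A_2\subset A$ the subalgebras generated by $\mathrm{Sq}^1,\mathrm{Sq}^2$ and by $\mathrm{Sq}^1,\mathrm{Sq}^2,\mathrm{Sq}^4$, and $\mathbf Z_2=\mathbf Z/2$ the trivial module in degree $0$. For a $\mathbf Z$-graded left module $M$ over $B=A_1$ or $A_2$ let $(\Sigma^kM)_n=M_{n-k}$ and $\mathrm{Ext}_B^{s,t}(M,\mathbf Z_2)=\mathrm{Ext}^s_B(M,\Sigma^t\mathbf Z_2)$, where Ext is taken in the category of graded left $B$-modules and degree-preserving maps. Put $\mathbf{bo}^{s,t}=\mathrm{Ext}_{A_1}^{s,t}(\mathbf Z_2,\mathbf Z_2)$ and $\mathbf{bo}[v_2]^{s,t}=\bigoplus_{i\ge0}\mathbf{bo}^{s-i,t-7i}$ (so $v_2$ has bidegree $(s,t)=(1,7)$), and for a bigraded group $E$ let $(\Sigma^kE)^{s,t}=E^{s,t-k}$. Let $\mathbf C^\infty_{-\infty}=H^*(CP^\infty_{-\infty};\mathbf Z_2)=\mathbf Z_2[x,x^{-1}]$ with $x$ in degree $2$ and $\mathrm{Sq}^{2i}x^k=\binom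 ki x^{k+i}$, $\mathrm{Sq}^{2i+1}x^k=0$ for all $k\in\mathbf Z$, $i\ge0$. Then there is an additive isomorphism of bigraded groups $$\mathrm{Ext}_{A_2}^{*,*}(\mathbf C^\infty_{-\infty},\mathbf Z_2)\cong\bigoplus_{p\in\mathbf Z}\Sigma^{8p-2}\,\mathbf{bo}[v_2].$$ Moreover, let $M_{10}$ be the cyclic graded $A_2$-module $A_2/A_2(\mathrm{Sq}^1,\mathrm{Sq}^2,\mathrm{Sq}^1\mathrm{Sq}^2\mathrm{Sq}^4)$. Then $M_{10}$ has the $\mathbf Z_2$-basis $1,\mathrm{Sq}^4,\mathrm{Sq}^2\mathrm{Sq}^4,\mathrm{Sq}^4\mathrm{Sq}^2\mathrm{Sq}^4$; there is an additive isomorphism of bigraded groups $\mathrm{Ext}_{A_2}^{*,*}(M_{10},\mathbf Z_2)\cong\mathbf{bo}[v_2]$; and $\mathbf C^\infty_{-\infty}$ has an increasing filtration by graded $A_2$-submodules $F_p$, $p\in\mathbf Z$, with $\bigcup_pF_p=\mathbf C^\infty_{-\infty}$, $\bigcap_pF_p=0$ and $F_p/F_{p-1}\cong\Sigma^{8p-2}M_{10}$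 as graded $A_2$-modules for every $p\in\mathbf Z$. -/

import Mathlib

open CategoryTheory CategoryTheory.Limits CategoryTheory.Abelian DirectSum

noncomputable section

namespace SteenrodExt

/-! ### Binomial coefficients mod 2 and the Adem identity for them -/

theorem choose_add_two_pow_mul (k : ℤ) (m q i : ℕ) (hi : i < 2 ^ m) :
    ((Ring.choose (k + 2 ^ m * q) i : ℤ) : ZMod 2) = ((Ring.choose k i : ℤ) : ZMod 2) := by
  induction q with
  | zero => simp
  | succ q ih =>
    rw [← ih]
    have : k + 2 ^ m * ((q + 1 : ℕ) : ℤ) = (k + 2 ^ m * q) + ((2 ^ m : ℕ) : ℤ) := by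
      push_cast; ring
    rw [this, Ring.add_choose_eq i (Commute.all _ _), Int.cast_sum,
      Finset.sum_eq_single (i, 0)]
    · simp
    · rintro ⟨u, v⟩ huv hne
      have huv : u + v = i := by simpa using huv
      have hv : v ≠ 0 := by
        rintro rfl; apply hne; simp at huv; simp [huv]
      have hd : (2 : ℕ) ∣ (2 ^ m).choose v :=
        Nat.prime_two.dvd_choose_pow hv (by omega)
      have hz : (((2 ^ m).choose v : ℕ) : ZMod 2) = 0 := by
        rw [ZMod.natCast_eq_zero_iff]; exact hd
      rw [Ring.choose_natCast]
      push_cast at hz ⊢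
      rw [hz, mul_zero]
    · intro h; simp at h

theorem coeff_total (R : Type) [CommRing R] (u v : R) (k n : ℕ) :
    (((1 + Polynomial.C u * Polynomial.X) *
      (1 + Polynomial.C v * Polynomial.X * (1 + Polynomial.C u * Polynomial.X))) ^ k).coeff n
    = ∑ b ∈ Finset.range (n + 1), (k.choose b : R) * ((k + b).choose (n - b) : R) *
        (u ^ (n - b) * v ^ b) := by
  have hpow : ∀ r d : ℕ, ((1 + Polynomial.C u * Polynomial.X) ^ r).coeff d
      = (r.choose d : R) * u ^ d := by
    intro r d
    have : (1 + Polynomial.C u * Polynomial.X) ^ r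
        = ((1 + Polynomial.X : Polynomial R) ^ r).comp (Polynomial.C u * Polynomial.X) := by
      simp
    rw [this, Polynomial.comp_C_mul_X_coeff, Polynomial.coeff_one_add_X_pow]
  have hexp : ((1 + Polynomial.C u * Polynomial.X) *
      (1 + Polynomial.C v * Polynomial.X * (1 + Polynomial.C u * Polynomial.X))) ^ k
      = ∑ b ∈ Finset.range (k + 1), Polynomial.C ((k.choose b : R) * v ^ b) *
        ((1 + Polynomial.C u * Polynomial.X) ^ (k + b) * Polynomial.X ^ b) := by
    rw [mul_pow, add_comm (1 : Polynomial R) (Polynomial.C v * _ * _),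
      add_pow (Polynomial.C v * _ * _), Finset.mul_sum]
    refine Finset.sum_congr rfl fun b _ => ?_
    rw [mul_pow, mul_pow (Polynomial.C v)]
    simp only [one_pow, mul_one, map_mul, map_pow, map_natCast]
    ring
  rw [hexp, Polynomial.finsetSum_coeff]
  simp only [Polynomial.coeff_C_mul, Polynomial.coeff_mul_X_pow', hpow]
  have key : ∀ N, k + 1 ≤ N → n + 1 ≤ N →
      ∑ b ∈ Finset.range (k + 1), (k.choose b : R) * v ^ b *
        (if b ≤ n then ((k + b).choose (n - b) : R) * u ^ (n - b) else 0)
      = ∑ b ∈ Finset.range (n + 1), (k.choose b : R) * ((k + b).choose (n - b) : R) *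
        (u ^ (n - b) * v ^ b) := by
    intro N h1 h2
    trans ∑ b ∈ Finset.range N, (k.choose b : R) * v ^ b *
        (if b ≤ n then ((k + b).choose (n - b) : R) * u ^ (n - b) else 0)
    · refine Finset.sum_subset (by simpa using h1) fun b _ hb => ?_
      rw [Nat.choose_eq_zero_of_lt (by simpa using hb)]; simp
    · symm
      trans ∑ b ∈ Finset.range (n + 1), (k.choose b : R) * v ^ b *
        (if b ≤ n then ((k + b).choose (n - b) : R) * u ^ (n - b) else 0)
      · refine Finset.sum_congr rfl fun b hb => ?_
        rw [if_pos (by simp at hb; omega)]; ring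
      · refine Finset.sum_subset (by simpa using h2) fun b _ hb => ?_
        rw [if_neg (by simpa using hb)]; simp
  exact key (max (k+1) (n+1)) (le_max_left _ _) (le_max_right _ _)

theorem total_aux (S : Type) [CommRing S] (h2 : (2 : S) = 0) (x y : S) :
    (1 + (x ^ 2 + x) * y) * (1 + 1 * y * (1 + (x ^ 2 + x) * y))
    = (1 + (1 + x) * y) * (1 + x ^ 2 * y * (1 + (1 + x) * y)) := by
  linear_combination ((x ^ 2 + x) * y ^ 2 - (1 + x) * x ^ 2 * y ^ 2) * h2

theorem total_symm (k n : ℕ) :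
    ∑ b ∈ Finset.range (n + 1), (k.choose b : Polynomial (ZMod 2)) * ((k + b).choose (n - b) : Polynomial (ZMod 2)) *
        ((Polynomial.X ^ 2 + Polynomial.X) ^ (n - b) * 1 ^ b)
    = ∑ b ∈ Finset.range (n + 1), (k.choose b : Polynomial (ZMod 2)) * ((k + b).choose (n - b) : Polynomial (ZMod 2)) *
        ((1 + Polynomial.X) ^ (n - b) * (Polynomial.X ^ 2) ^ b) := by
  have h2 : (2 : Polynomial (Polynomial (ZMod 2))) = 0 := by
    have : ((2 : ℕ) : Polynomial (Polynomial (ZMod 2))) = 0 := CharP.cast_eq_zero _ 2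
    exact_mod_cast this
  have e := total_aux _ h2 (Polynomial.C Polynomial.X) Polynomial.X
  rw [← coeff_total, ← coeff_total]
  simp only [map_add, map_one, map_pow, e]

theorem choose_add_two_pow_nat (r m i : ℕ) (hi : i < 2 ^ m) :
    (((r + 2 ^ m).choose i : ℕ) : ZMod 2) = ((r.choose i : ℕ) : ZMod 2) := by
  have h := choose_add_two_pow_mul (r : ℤ) m 1 i hi
  have e : (r : ℤ) + 2 ^ m * ((1 : ℕ) : ℤ) = ((r + 2 ^ m : ℕ) : ℤ) := by push_cast; ring
  rw [e, Ring.choose_natCast, Ring.choose_natCast] at h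
  exact_mod_cast h

theorem choose_compl (m d r : ℕ) (hd : d ≠ 0) (hr : r + d + 1 = 2 ^ m) (hdm : d < 2 ^ m) :
    ((r.choose d : ℕ) : ZMod 2) = 0 := by
  have h := choose_add_two_pow_mul (-((d + 1 : ℕ) : ℤ)) m 1 d hdm
  have e : -((d + 1 : ℕ) : ℤ) + 2 ^ m * ((1 : ℕ) : ℤ) = (r : ℤ) := by
    have : ((2 ^ m : ℕ) : ℤ) = ((r + d + 1 : ℕ) : ℤ) := by rw [hr]
    push_cast at this ⊢; linarith
  have e2 : ((d + 1 : ℕ) : ℤ) + d - 1 = ((2 * d : ℕ) : ℤ) := by push_cast; ring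
  rw [e, Ring.choose_natCast, Ring.choose_neg, e2, Ring.choose_natCast] at h
  have hc : (((2 * d).choose d : ℕ) : ZMod 2) = 0 := by
    rw [ZMod.natCast_eq_zero_iff]
    exact Nat.two_dvd_centralBinom_of_one_le (Nat.one_le_iff_ne_zero.2 hd)
  have : ((r.choose d : ℕ) : ZMod 2) = (((r.choose d : ℕ) : ℤ) : ZMod 2) := by push_cast; rfl
  rw [this, h]
  rw [Units.smul_def, smul_eq_mul, Int.cast_mul, Int.cast_natCast, hc, mul_zero]

open Polynomial in
theorem adem_choose_nat (k a b : ℕ) (hab : a < 2 * b) :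
    ((k.choose b : ℕ) : ZMod 2) * ((k + b).choose a : ℕ)
    = ∑ j ∈ Finset.range (a / 2 + 1), ((b - 1 - j).choose (a - 2 * j) : ZMod 2) *
        (((k.choose j : ℕ) : ZMod 2) * ((k + j).choose (a + b - j) : ℕ)) := by
  obtain ⟨m, hm⟩ : ∃ m : ℕ, a + 1 < 2 ^ m := ⟨a + 1, Nat.lt_two_pow_self⟩
  set N := 2 ^ m with hN
  have h := congrArg (fun p : (ZMod 2)[X] => (p * (1 + X) ^ (N - a - 1)).coeff a)
    (total_symm k (a + b))
  simp only [Finset.sum_mul, finsetSum_coeff, one_pow, mul_one] at h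
  have hL : ∀ e : ℕ, ((((X : (ZMod 2)[X]) ^ 2 + X) ^ e) * (1 + X) ^ (N - a - 1)).coeff a
      = if e = a then 1 else 0 := by
    intro e
    have : (((X : (ZMod 2)[X]) ^ 2 + X) ^ e) * (1 + X) ^ (N - a - 1)
        = (1 + X) ^ (e + (N - a - 1)) * X ^ e := by
      rw [pow_add, show (X : (ZMod 2)[X]) ^ 2 + X = (1 + X) * X by ring, mul_pow]; ring
    rw [this, coeff_mul_X_pow', coeff_one_add_X_pow]
    split_ifs with h1 h2 h2
    · subst h2; simp
    · exact choose_compl m (a - e) _ (by omega) (by omega) (by omega)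
    · omega
    · rfl
  have hR : ∀ j : ℕ, j ≤ a + b →
      (((1 + X : (ZMod 2)[X]) ^ (a + b - j) * (X ^ 2) ^ j) * (1 + X) ^ (N - a - 1)).coeff a
      = if 2 * j ≤ a then ((b - 1 - j).choose (a - 2 * j) : ZMod 2) else 0 := by
    intro j hj
    have : ((1 + X : (ZMod 2)[X]) ^ (a + b - j) * (X ^ 2) ^ j) * (1 + X) ^ (N - a - 1)
        = (1 + X) ^ ((a + b - j) + (N - a - 1)) * X ^ (2 * j) := by
      rw [pow_add, pow_mul]; ring
    rw [this, coeff_mul_X_pow', coeff_one_add_X_pow]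
    split_ifs with h1
    · rw [show a + b - j + (N - a - 1) = (b - 1 - j) + 2 ^ m by omega]
      exact choose_add_two_pow_nat _ _ _ (by omega)
    · rfl
  have hc : ∀ (x y : ℕ) (p q : (ZMod 2)[X]),
      ((x : (ZMod 2)[X]) * (y : (ZMod 2)[X]) * p * q).coeff a
        = (x : ZMod 2) * (y : ZMod 2) * (p * q).coeff a := by
    intro x y p q
    rw [show (x : (ZMod 2)[X]) * (y : (ZMod 2)[X]) * p * q
      = C ((x : ZMod 2) * (y : ZMod 2)) * (p * q) by simp; ring, coeff_C_mul]
  simp only [hc, hL] at h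
  rw [Finset.sum_eq_single b] at h
  · rw [show a + b - b = a by omega, if_pos rfl, mul_one] at h
    rw [h]
    symm
    trans ∑ j ∈ Finset.range (a + b + 1), (if 2 * j ≤ a then
      ((b - 1 - j).choose (a - 2 * j) : ZMod 2) else 0) *
        (((k.choose j : ℕ) : ZMod 2) * ((k + j).choose (a + b - j) : ℕ))
    · trans ∑ j ∈ Finset.range (a / 2 + 1), (if 2 * j ≤ a then
        ((b - 1 - j).choose (a - 2 * j) : ZMod 2) else 0) *
        (((k.choose j : ℕ) : ZMod 2) * ((k + j).choose (a + b - j) : ℕ))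
      · refine Finset.sum_congr rfl fun j hj => ?_
        rw [if_pos (by simp at hj; omega)]
      · refine Finset.sum_subset (fun x hx => by simp at hx ⊢; omega) fun j _ hj => ?_
        rw [if_neg (by simp at hj; omega), zero_mul]
    · refine Finset.sum_congr rfl fun j hj => ?_
      rw [hR j (by simp at hj; omega), mul_comm]
  · intro j hj hne
    rw [if_neg (by simp at hj; omega), mul_zero]
  · intro hb; simp at hb

/-- Binomial coefficient mod 2. -/
def binom2 (k : ℤ) (i : ℕ) : ZMod 2 := ((Ring.choose k i : ℤ) : ZMod 2)

theorem adem_choose (k : ℤ) (a b : ℕ) (hab : a < 2 * b) :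
    binom2 k b * binom2 (k + b) a
    = ∑ j ∈ Finset.range (a / 2 + 1), ((b - 1 - j).choose (a - 2 * j) : ZMod 2) *
        (binom2 k j * binom2 (k + j) (a + b - j)) := by
  obtain ⟨m, hm⟩ : ∃ m : ℕ, a + b < 2 ^ m := ⟨a + b, Nat.lt_two_pow_self⟩
  obtain ⟨K, hK⟩ : ∃ K : ℕ, k + 2 ^ m * (k.natAbs : ℤ) = K := by
    apply Int.eq_ofNat_of_zero_le
    have h1 : (1 : ℤ) ≤ 2 ^ m := one_le_pow₀ (by norm_num)
    have h2 : (0 : ℤ) ≤ k.natAbs := by positivity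
    have h3 : -k ≤ (k.natAbs : ℤ) := by omega
    nlinarith
  have red : ∀ (j i : ℕ), i ≤ a + b → binom2 (k + j) i = (((K + j).choose i : ℕ) : ZMod 2) := by
    intro j i hi
    unfold binom2
    rw [← choose_add_two_pow_mul (k + j) m k.natAbs i (by omega)]
    rw [show k + j + 2 ^ m * (k.natAbs : ℤ) = ((K + j : ℕ) : ℤ) by
      rw [Nat.cast_add, ← hK]; ring,
      Ring.choose_natCast]
    simp
  have red0 : ∀ i : ℕ, i ≤ a + b → binom2 k i = ((K.choose i : ℕ) : ZMod 2) := by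
    intro i hi
    simpa using red 0 i hi
  rw [red0 b (by omega), red b a (by omega), adem_choose_nat K a b hab]
  refine Finset.sum_congr rfl fun j hj => ?_
  have : j < a / 2 + 1 := by simpa using hj
  rw [red0 j (by omega), red j _ (by omega)]

/-! ### The mod 2 Steenrod algebra -/

/-- The defining relations of the mod 2 Steenrod algebra on symbols `Sq^n`, `n ≥ 0`:
`Sq^0 = 1` and the Adem relations
`Sq^a Sq^b = ∑_j binom(b-1-j, a-2j) Sq^{a+b-j} Sq^j` for `0 < a < 2b`. -/
inductive AdemRel : FreeAlgebra (ZMod 2) ℕ → FreeAlgebra (ZMod 2) ℕ → Prop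
  | sq_zero : AdemRel (FreeAlgebra.ι (ZMod 2) 0) 1
  | adem (a b : ℕ) (ha : 0 < a) (hab : a < 2 * b) :
      AdemRel (FreeAlgebra.ι (ZMod 2) a * FreeAlgebra.ι (ZMod 2) b)
        (∑ j ∈ Finset.range (a / 2 + 1), ((b - 1 - j).choose (a - 2 * j) : ZMod 2) •
          (FreeAlgebra.ι (ZMod 2) (a + b - j) * FreeAlgebra.ι (ZMod 2) j))

/-- The mod 2 Steenrod algebra `A`. -/
def Steenrod : Type := RingQuot AdemRel

instance : Ring Steenrod := inferInstanceAs (Ring (RingQuot AdemRel))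

instance : Algebra (ZMod 2) Steenrod := inferInstanceAs (Algebra (ZMod 2) (RingQuot AdemRel))

/-- The projection of the free algebra on the symbols `Sq^n` onto the Steenrod algebra. -/
def Steenrod.proj : FreeAlgebra (ZMod 2) ℕ →ₐ[ZMod 2] Steenrod :=
  RingQuot.mkAlgHom (ZMod 2) AdemRel

/-- The universal property of the Steenrod algebra. -/
def Steenrod.lift {S : Type} [Ring S] [Algebra (ZMod 2) S] (f : ℕ → S)
    (h : ∀ ⦃x y⦄, AdemRel x y → FreeAlgebra.lift (ZMod 2) f x = FreeAlgebra.lift (ZMod 2) f y) :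
    Steenrod →ₐ[ZMod 2] S :=
  RingQuot.liftAlgHom (ZMod 2) ⟨FreeAlgebra.lift (ZMod 2) f, h⟩

/-- The Steenrod square `Sq^n ∈ A`. -/
def Sq (n : ℕ) : Steenrod := Steenrod.proj (FreeAlgebra.ι (ZMod 2) n)

theorem Steenrod.lift_Sq {S : Type} [Ring S] [Algebra (ZMod 2) S] (f : ℕ → S)
    (h : ∀ ⦃x y⦄, AdemRel x y → FreeAlgebra.lift (ZMod 2) f x = FreeAlgebra.lift (ZMod 2) f y)
    (n : ℕ) : Steenrod.lift f h (Sq n) = f n := by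
  have := RingQuot.liftAlgHom_mkAlgHom_apply (ZMod 2) (FreeAlgebra.lift (ZMod 2) f) h
    (FreeAlgebra.ι (ZMod 2) n)
  rw [FreeAlgebra.lift_ι_apply] at this
  exact this

/-- The homogeneous part `A^d` of degree `d`: the span of the monomials
`Sq^{i_1} ⋯ Sq^{i_r}` with `i_1 + ⋯ + i_r = d`. It is `0` for `d < 0`. -/
def homog (d : ℤ) : Submodule (ZMod 2) Steenrod :=
  Submodule.span (ZMod 2) {x | ∃ w : List ℕ, (w.sum : ℤ) = d ∧ x = (w.map Sq).prod}

theorem one_mem_homog : (1 : Steenrod) ∈ homog 0 :=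
  Submodule.subset_span ⟨[], by simp, by simp⟩

theorem mul_mem_homog {c d : ℤ} {x y : Steenrod} (hx : x ∈ homog c) (hy : y ∈ homog d) :
    x * y ∈ homog (c + d) := by
  have h : homog c * homog d ≤ homog (c + d) := by
    unfold homog
    rw [Submodule.span_mul_span]
    apply Submodule.span_mono
    rintro _ ⟨_, ⟨w, hw, rfl⟩, _, ⟨w', hw', rfl⟩, rfl⟩
    exact ⟨w ++ w', by simp [hw, hw'], by simp⟩
  exact h (Submodule.mul_mem_mul hx hy)

/-- The subalgebra `A_1` of `A` generated by `Sq^1, Sq^2`. -/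
def A1 : Subalgebra (ZMod 2) Steenrod := Algebra.adjoin (ZMod 2) {Sq 1, Sq 2}

/-- The subalgebra `A_2` of `A` generated by `Sq^1, Sq^2, Sq^4`. -/
def A2 : Subalgebra (ZMod 2) Steenrod := Algebra.adjoin (ZMod 2) {Sq 1, Sq 2, Sq 4}

/-! ### Graded modules over a subalgebra of the Steenrod algebra -/

/-- The preadditive category with object set `ℤ` in which the morphisms `i ⟶ j` are the elements
of `B` of degree `j - i`, composed by multiplication in `B`. -/
@[ext]
structure DegreeCat (B : Subalgebra (ZMod 2) Steenrod) : Type where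
  /-- the degree -/
  deg : ℤ

variable {B : Subalgebra (ZMod 2) Steenrod}

instance : Category.{0} (DegreeCat B) where
  Hom i j := ↥(Subalgebra.toSubmodule B ⊓ homog (j.deg - i.deg))
  id i := ⟨1, B.one_mem, by simpa using one_mem_homog⟩
  comp {i j k} a b := ⟨b.1 * a.1, B.mul_mem b.2.1 a.2.1, by
    have h := mul_mem_homog b.2.2 a.2.2
    rwa [show k.deg - j.deg + (j.deg - i.deg) = k.deg - i.deg by ring] at h⟩
  id_comp a := Subtype.ext (mul_one _)
  comp_id a := Subtype.ext (one_mul _)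
  assoc a b c := Subtype.ext (mul_assoc _ _ _).symm

instance : Preadditive (DegreeCat B) where
  homGroup i j := inferInstanceAs
    (AddCommGroup ↥(Subalgebra.toSubmodule B ⊓ homog (j.deg - i.deg)))
  add_comp _ _ _ a a' b := Subtype.ext (mul_add b.1 a.1 a'.1)
  comp_add _ _ _ a b b' := Subtype.ext (add_mul b.1 b'.1 a.1)

/-- The element of `B` underlying a morphism. -/
def DegreeCat.elt {i j : DegreeCat B} (f : i ⟶ j) : B := ⟨f.1, f.2.1⟩

theorem DegreeCat.elt_homog {i j : DegreeCat B} (f : i ⟶ j) :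
    (DegreeCat.elt f : Steenrod) ∈ homog (j.deg - i.deg) := f.2.2

/-- The category of `ℤ`-graded left `B`-modules and degree-preserving `B`-linear maps. A graded
module `M` is an additive functor: it consists of the `𝔽₂`-vector spaces `M_i` (`i ∈ ℤ`) and, for
`b ∈ B` of degree `j - i`, of the action `b : M_i → M_j`, which is additive in `b`, unital and
associative. -/
abbrev GrMod (B : Subalgebra (ZMod 2) Steenrod) : Type 1 :=
  DegreeCat B ⥤+ ModuleCat.{0} (ZMod 2)

instance : (additiveFunctor (DegreeCat B) (ModuleCat.{0} (ZMod 2))).IsClosedUnderSubobjects where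
  prop_of_mono {F G} f _ hG := by
    have : G.Additive := hG
    constructor
    intro i j a b
    rw [← cancel_mono (f.app j)]
    simp [Functor.map_add]

instance : (additiveFunctor (DegreeCat B) (ModuleCat.{0} (ZMod 2))).IsClosedUnderQuotients where
  prop_of_epi {F G} f _ hF := by
    have : F.Additive := hF
    constructor
    intro i j a b
    rw [← cancel_epi (f.app i)]
    simp [← NatTrans.naturality, Functor.map_add]

instance : (additiveFunctor (DegreeCat B) (ModuleCat.{0} (ZMod 2))).ContainsZero where
  exists_zero :=
    ⟨(Functor.const _).obj (ModuleCat.of (ZMod 2) PUnit),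
      Functor.isZero _ fun _ =>
        ModuleCat.isZero_of_subsingleton (ModuleCat.of (ZMod 2) PUnit),
      ⟨fun {_ _ _ _} =>
        (ModuleCat.isZero_of_subsingleton (ModuleCat.of (ZMod 2) PUnit)).eq_of_tgt _ _⟩⟩

instance : (additiveFunctor (DegreeCat B)
    (ModuleCat.{0} (ZMod 2))).IsClosedUnderBinaryProducts where
  limitsOfShape_le := by
    rintro G ⟨h⟩
    constructor
    intro i j a b
    let hl := isLimitOfPreserves ((evaluation _ _).obj j) h.isLimit
    refine hl.hom_ext fun p => ?_
    have := h.prop_diag_obj p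
    have : (h.diag.obj p).Additive := this
    simp [Functor.map_add]

instance : (additiveFunctor (DegreeCat B)
    (ModuleCat.{0} (ZMod 2))).IsClosedUnderFiniteProducts :=
  ObjectProperty.IsClosedUnderFiniteProducts.mk'

instance : HasExt.{1} (GrMod B) := HasExt.standard _

/-- The graded `B`-module `⨁ 𝓥_n` given by a `B`-module `V` (through its structure map `ρ`) and
subspaces `𝓥_n ⊆ V`, `n ∈ ℤ`, with `b 𝓥_n ⊆ 𝓥_{n+d}` for `b ∈ B` of degree `d`. -/
def GrMod.ofInternal {V : Type} [AddCommGroup V] [Module (ZMod 2) V]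
    (ρ : B →ₐ[ZMod 2] Module.End (ZMod 2) V) (𝓥 : ℤ → Submodule (ZMod 2) V)
    (h : ∀ (d n : ℤ) (b : B), (b : Steenrod) ∈ homog d → ∀ v ∈ 𝓥 n, ρ b v ∈ 𝓥 (n + d)) :
    GrMod B where
  obj :=
    { obj i := ModuleCat.of (ZMod 2) (𝓥 i.deg)
      map {i j} f := ModuleCat.ofHom ((ρ (DegreeCat.elt f)).restrict (fun v hv => by
        have := h _ i.deg _ (DegreeCat.elt_homog f) v hv
        rwa [add_sub_cancel] at this))
      map_id i := by
        ext v
        exact congrArg (fun g : Module.End (ZMod 2) V => g v) (map_one ρ)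
      map_comp f g := by
        ext v
        exact congrArg (fun e : Module.End (ZMod 2) V => e v)
          (map_mul ρ (DegreeCat.elt g) (DegreeCat.elt f)) }
  property := by
    constructor
    intro i j f g
    ext v
    exact congrArg (fun e : Module.End (ZMod 2) V => e v)
      (map_add ρ (DegreeCat.elt f) (DegreeCat.elt g))

/-- Translation of degrees by `-k`. -/
def DegreeCat.translate (B : Subalgebra (ZMod 2) Steenrod) (k : ℤ) :
    DegreeCat B ⥤ DegreeCat B where
  obj i := ⟨i.deg - k⟩
  map f := ⟨f.1, f.2.1, by simpa using f.2.2⟩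

instance (k : ℤ) : (DegreeCat.translate B k).Additive where

/-- The suspension `Σ^k M` of a graded module: `(Σ^k M)_n = M_{n-k}`, with the same action. -/
def susp (k : ℤ) (M : GrMod B) : GrMod B :=
  AdditiveFunctor.of (DegreeCat.translate B k ⋙ M.obj)

/-! ### The modules of the theorem -/

/-- The augmentation `A → 𝔽₂`, which sends `Sq^n` to `0` for `n > 0`. -/
def augmentation : Steenrod →ₐ[ZMod 2] ZMod 2 :=
  Steenrod.lift (fun n : ℕ => if n = 0 then 1 else 0) (by
      rintro _ _ (_ | ⟨a, b, ha, hab⟩)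
      · simp
      · simp only [map_mul, map_sum, map_smul, FreeAlgebra.lift_ι_apply]
        rw [if_neg ha.ne', zero_mul, eq_comm]
        refine Finset.sum_eq_zero fun j hj => ?_
        have : j < a / 2 + 1 := by simpa using hj
        rw [if_neg (by omega), zero_mul, smul_zero])

theorem augmentation_Sq (n : ℕ) : augmentation (Sq n) = if n = 0 then 1 else 0 := by
  unfold augmentation
  rw [Steenrod.lift_Sq]

theorem augmentation_homog {d : ℤ} (hd : d ≠ 0) {x : Steenrod} (hx : x ∈ homog d) :
    augmentation x = 0 := by
  have : homog d ≤ LinearMap.ker augmentation.toLinearMap := by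
    refine Submodule.span_le.2 ?_
    rintro _ ⟨w, hw, rfl⟩
    have hw0 : w.sum ≠ 0 := by rintro h; apply hd; rw [← hw, h]; rfl
    obtain ⟨n, hn, hn0⟩ : ∃ n ∈ w, n ≠ 0 := by
      by_contra! hcon
      exact hw0 (List.sum_eq_zero hcon)
    simp only [SetLike.mem_coe, LinearMap.mem_ker, AlgHom.toLinearMap_apply, map_list_prod,
      List.map_map]
    refine List.prod_eq_zero (List.mem_map.2 ⟨n, hn, ?_⟩)
    simp [augmentation_Sq, hn0]
  exact this hx

/-- The trivial graded `B`-module `ℤ₂`, concentrated in degree `0`. -/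
def trivialMod (B : Subalgebra (ZMod 2) Steenrod) : GrMod B :=
  GrMod.ofInternal (V := ZMod 2)
    ((Algebra.lmul (ZMod 2) (ZMod 2)).comp (augmentation.comp B.val))
    (fun n => if n = 0 then ⊤ else ⊥) (by
      intro d n b hb v hv
      by_cases hd : d = 0
      · subst hd
        rw [add_zero]
        exact Submodule.smul_mem _ (augmentation b) hv
      · have : ((Algebra.lmul (ZMod 2) (ZMod 2)).comp (augmentation.comp B.val)) b v = 0 := by
          simp [augmentation_homog hd hb]
        rw [this]
        exact zero_mem _)

/-- The action of `Sq^n` on `H^*(CP^∞_{-∞}; ℤ₂) = 𝔽₂[x, x⁻¹]`, `|x| = 2`, where the basis vector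
`Finsupp.single k 1` of `ℤ →₀ 𝔽₂` stands for `x^k`:
`Sq^{2i} x^k = binom(k, i) x^{k+i}` and `Sq^{2i+1} x^k = 0`, for all integers `k`. -/
def sqCP (n : ℕ) : Module.End (ZMod 2) (ℤ →₀ ZMod 2) :=
  Finsupp.linearCombination (ZMod 2) (fun k : ℤ =>
    if Even n then Finsupp.single (k + (n / 2 : ℕ)) (binom2 k (n / 2)) else 0)

theorem sqCP_single (n : ℕ) (k : ℤ) (c : ZMod 2) :
    sqCP n (Finsupp.single k c) =
      if Even n then Finsupp.single (k + (n / 2 : ℕ)) (c * binom2 k (n / 2)) else 0 := by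
  unfold sqCP
  rw [Finsupp.linearCombination_single]
  split_ifs <;> simp

theorem sqCP_zero : sqCP 0 = 1 := by
  refine Finsupp.lhom_ext fun k c => ?_
  rw [sqCP_single]
  simp [binom2]

theorem choose_even_odd (r i : ℕ) : (((2 * r).choose (2 * i + 1) : ℕ) : ZMod 2) = 0 := by
  have : Fact (Nat.Prime 2) := ⟨Nat.prime_two⟩
  have h := Choose.choose_modEq_choose_mod_mul_choose_div_nat (p := 2) (n := 2 * r) (k := 2 * i + 1)
  rw [(ZMod.natCast_eq_natCast_iff _ _ 2).2 h, show 2 * r % 2 = 0 by omega,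
    show (2 * i + 1) % 2 = 1 by omega]
  simp

theorem choose_odd_even (r i : ℕ) :
    (((2 * r + 1).choose (2 * i) : ℕ) : ZMod 2) = ((r.choose i : ℕ) : ZMod 2) := by
  have : Fact (Nat.Prime 2) := ⟨Nat.prime_two⟩
  have h := Choose.choose_modEq_choose_mod_mul_choose_div_nat (p := 2) (n := 2 * r + 1) (k := 2 * i)
  rw [(ZMod.natCast_eq_natCast_iff _ _ 2).2 h, show (2 * r + 1) % 2 = 1 by omega,
    show 2 * i % 2 = 0 by omega, show (2 * r + 1) / 2 = r by omega, show 2 * i / 2 = i by omega]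
  simp

theorem sqCP_adem (a b : ℕ) (hab : a < 2 * b) :
    sqCP a * sqCP b = ∑ j ∈ Finset.range (a / 2 + 1),
      ((b - 1 - j).choose (a - 2 * j) : ZMod 2) • (sqCP (a + b - j) * sqCP j) := by
  refine Finsupp.lhom_ext fun k c => ?_
  simp only [LinearMap.sum_apply, LinearMap.smul_apply, Module.End.mul_apply]
  rcases Nat.even_or_odd' a with ⟨a', rfl | rfl⟩ <;> rcases Nat.even_or_odd' b with ⟨b', rfl | rfl⟩
  · have hab' : a' < 2 * b' := by omega
    have hL : sqCP (2 * a') (sqCP (2 * b') (Finsupp.single k c))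
        = Finsupp.single (k + b' + a') (c * (binom2 k b' * binom2 (k + b') a')) := by
      rw [sqCP_single _ k, if_pos (by simp), sqCP_single, if_pos (by simp)]
      simp [mul_assoc]
    rw [hL, adem_choose k a' b' hab', Finset.mul_sum, Finsupp.single_finsetSum]
    symm
    refine Finset.sum_of_injOn (s := Finset.range (a' / 2 + 1)) (fun i => 2 * i)
      (fun x _ y _ h => by simpa using h) ?_ ?_ ?_ |>.symm
    · intro i hi
      simp at hi ⊢
      omega
    · intro j hj hni
      rcases Nat.even_or_odd' j with ⟨i, rfl | rfl⟩
      · exact absurd ⟨i, by simp at hj ⊢; omega, rfl⟩ hni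
      · rw [sqCP_single _ k, if_neg (by simp), map_zero, smul_zero]
    · intro i hi
      have hi : i < a' / 2 + 1 := by simpa using hi
      have e1 : 2 * a' + 2 * b' - 2 * i = 2 * (a' + b' - i) := by omega
      simp only [e1]
      rw [sqCP_single _ k, if_pos (by simp), sqCP_single, if_pos (by simp),
        show 2 * b' - 1 - 2 * i = 2 * (b' - 1 - i) + 1 by omega,
        show 2 * a' - 2 * (2 * i) = 2 * (a' - 2 * i) by omega, choose_odd_even,
        Finsupp.smul_single, smul_eq_mul]
      congr 1
      · have : (((a' + b' - i : ℕ)) : ℤ) = a' + b' - i := by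
          rw [Nat.cast_sub (by omega)]; push_cast; rfl
        simp [this]; ring
      · simp; ring
  · have h1 : ¬ Even (2 * b' + 1) := by simp
    rw [sqCP_single _ k, if_neg h1, map_zero, eq_comm]
    refine Finset.sum_eq_zero fun j hj => ?_
    have hj : j < 2 * a' / 2 + 1 := by simpa using hj
    rw [sqCP_single _ k]
    split_ifs with he
    · rw [sqCP_single, if_neg (by grind), smul_zero]
    · simp
  · have h1 : ¬ Even (2 * a' + 1) := by simp
    rw [sqCP_single _ k, if_pos (by simp), sqCP_single, if_neg h1, eq_comm]
    refine Finset.sum_eq_zero fun j hj => ?_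
    have hj : j < (2 * a' + 1) / 2 + 1 := by simpa using hj
    rw [sqCP_single _ k]
    split_ifs with he
    · rw [sqCP_single, if_neg (by grind), smul_zero]
    · simp
  · have h1 : ¬ Even (2 * b' + 1) := by simp
    rw [sqCP_single _ k, if_neg h1, map_zero, eq_comm]
    refine Finset.sum_eq_zero fun j hj => ?_
    have hj : j < (2 * a' + 1) / 2 + 1 := by simpa using hj
    rcases Nat.even_or_odd' j with ⟨i, rfl | rfl⟩
    · have hz : (((2 * b' + 1 - 1 - 2 * i).choose (2 * a' + 1 - 2 * (2 * i)) : ℕ) : ZMod 2)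
          = 0 := by
        rw [show 2 * b' + 1 - 1 - 2 * i = 2 * (b' - i) by omega,
          show 2 * a' + 1 - 2 * (2 * i) = 2 * (a' - 2 * i) + 1 by omega]
        exact choose_even_odd _ _
      rw [hz, zero_smul]
    · rw [sqCP_single _ k, if_neg (by simp), map_zero, smul_zero]

/-- The action of the Steenrod algebra on `𝔽₂[x, x⁻¹]`. -/
def actCP : Steenrod →ₐ[ZMod 2] Module.End (ZMod 2) (ℤ →₀ ZMod 2) :=
  Steenrod.lift sqCP (by
      rintro _ _ (_ | ⟨a, b, ha, hab⟩)
      · simpa using sqCP_zero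
      · simpa [map_sum] using sqCP_adem a b hab)

theorem actCP_Sq (n : ℕ) : actCP (Sq n) = sqCP n := by
  unfold actCP
  rw [Steenrod.lift_Sq]

/-- The degree `n` part of `𝔽₂[x, x⁻¹]`: the span of the `x^k` with `2k = n`. -/
def gradeCP (n : ℤ) : Submodule (ZMod 2) (ℤ →₀ ZMod 2) :=
  Submodule.span (ZMod 2) {v | ∃ k : ℤ, 2 * k = n ∧ v = Finsupp.single k 1}

theorem sqCP_mem {n : ℤ} {v : ℤ →₀ ZMod 2} (i : ℕ) (hv : v ∈ gradeCP n) :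
    sqCP i v ∈ gradeCP (n + i) := by
  have : gradeCP n ≤ (gradeCP (n + i)).comap (sqCP i) := by
    refine Submodule.span_le.2 ?_
    rintro _ ⟨k, hk, rfl⟩
    simp only [Submodule.comap_coe, Set.mem_preimage, SetLike.mem_coe, sqCP_single]
    split_ifs with he
    · obtain ⟨r, rfl⟩ := he
      rw [show (r + r) / 2 = r by omega, one_mul, ← mul_one (binom2 k r), ← smul_eq_mul,
        ← Finsupp.smul_single]
      exact Submodule.smul_mem _ _ (Submodule.subset_span ⟨_, by push_cast; linarith, rfl⟩)
    · exact zero_mem _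
  exact this hv

theorem actCP_mem (d n : ℤ) (x : Steenrod) (hx : x ∈ homog d) (v : ℤ →₀ ZMod 2)
    (hv : v ∈ gradeCP n) : actCP x v ∈ gradeCP (n + d) := by
  have : homog d ≤ (gradeCP (n + d)).comap ((LinearMap.applyₗ v).comp actCP.toLinearMap) := by
    refine Submodule.span_le.2 ?_
    rintro _ ⟨w, rfl, rfl⟩
    clear hx
    change actCP (w.map Sq).prod v ∈ gradeCP (n + (w.sum : ℕ))
    induction w with
    | nil => simpa using hv
    | cons i w ih =>
      rw [List.map_cons, List.prod_cons, map_mul, Module.End.mul_apply, actCP_Sq]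
      have := sqCP_mem i ih
      rwa [List.sum_cons, show n + ((i + w.sum : ℕ) : ℤ) = n + (w.sum : ℕ) + i by push_cast; ring]
  exact this hx

/-- The graded module `H^*(CP^∞_{-∞}; ℤ₂) = 𝔽₂[x, x⁻¹]` over `B`. -/
def cohomCP (B : Subalgebra (ZMod 2) Steenrod) : GrMod B :=
  GrMod.ofInternal (actCP.comp B.val) gradeCP (fun d n b hb v hv => actCP_mem d n b hb v hv)

/-- `Sq^1` as an element of `A_2`. -/
def sq1 : A2 := ⟨Sq 1, Algebra.subset_adjoin (by simp)⟩

/-- `Sq^2` as an element of `A_2`. -/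
def sq2 : A2 := ⟨Sq 2, Algebra.subset_adjoin (by simp)⟩

/-- `Sq^4` as an element of `A_2`. -/
def sq4 : A2 := ⟨Sq 4, Algebra.subset_adjoin (by simp)⟩

/-- The cyclic left `A_2`-module `A_2 / A_2(Sq^1, Sq^2, Sq^1 Sq^2 Sq^4)`. -/
abbrev M10Carrier : Type :=
  A2 ⧸ (Submodule.span A2 {sq1, sq2, sq1 * sq2 * sq4} : Submodule A2 A2)

/-- The class of an element of `A_2`. -/
def M10.mk (a : A2) : M10Carrier := Submodule.Quotient.mk a

/-- The four elements `1, Sq^4, Sq^2 Sq^4, Sq^4 Sq^2 Sq^4`. -/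
def M10.basisVec : Fin 4 → M10Carrier :=
  ![M10.mk 1, M10.mk sq4, M10.mk (sq2 * sq4), M10.mk (sq4 * sq2 * sq4)]

/-- The graded `A_2`-module `M_10 = ⟨1, Sq^4, Sq^2 Sq^4, Sq^4 Sq^2 Sq^4⟩`: the cyclic module
above, graded by the images of the homogeneous parts of `A_2`. In degrees `0, 4, 6, 10` it is
spanned by one of the four elements, and the other degrees vanish. -/
def M10 : GrMod A2 :=
  GrMod.ofInternal (Algebra.lsmul (ZMod 2) (ZMod 2) M10Carrier)
    (fun n => Submodule.span (ZMod 2) {v | ∃ a : A2, (a : Steenrod) ∈ homog n ∧ v = M10.mk a})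
    (by
      intro d n b hb v hv
      induction hv using Submodule.span_induction with
      | mem v hv =>
        obtain ⟨a, ha, rfl⟩ := hv
        refine Submodule.subset_span ⟨b * a, ?_, rfl⟩
        rw [add_comm]
        exact mul_mem_homog hb ha
      | zero => simp
      | add v w _ _ hv hw => rw [map_add]; exact add_mem hv hw
      | smul c v _ hv => rw [map_smul]; exact Submodule.smul_mem _ _ hv)

/-- The underlying subspace of `M_n` of a graded submodule `F ⊆ M`, in degree `n`. -/
def degreePart {M : GrMod B} (F : Subobject M) (n : ℤ) : Submodule (ZMod 2) (M.obj.obj ⟨n⟩) :=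
  LinearMap.range (F.arrow.hom.app ⟨n⟩).hom

/-! ### Bigraded Ext groups -/

/-- `Ext_B^{s,t}(M, ℤ₂) = Ext^s(M, Σ^t ℤ₂)` in the category of graded `B`-modules. -/
abbrev ExtB (M : GrMod B) (s : ℕ) (t : ℤ) : Type 1 := Ext.{1} M (susp t (trivialMod B)) s

/-- `bo^{s,t} = Ext_{A_1}^{s,t}(ℤ₂, ℤ₂)`. -/
abbrev bo (s : ℕ) (t : ℤ) : Type 1 := ExtB (trivialMod A1) s t

/-- The bidegree `(s,t)` part of `bo[v_2]` with `v_2` in bidegree `(1,7)`: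
`⨁_{i ≥ 0} bo^{s-i,t-7i} v_2^i`, where only `i ≤ s` contribute. -/
abbrev boV2 (s : ℕ) (t : ℤ) : Type 1 := ⨁ i : Fin (s + 1), bo (s - i) (t - 7 * (i : ℕ))

end SteenrodExt

end

open SteenrodExt

noncomputable section
namespace SteenrodExt
variable {B : Subalgebra (ZMod 2) Steenrod}

/-! ### Exactness of graded modules, degree by degree -/

/-- The degree `n` part, as a functor. -/
abbrev GrMod.eval (n : DegreeCat B) : GrMod B ⥤ ModuleCat.{0} (ZMod 2) :=
  AdditiveFunctor.forget _ _ ⋙ (evaluation _ _).obj n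

instance : (AdditiveFunctor.forget (DegreeCat B) (ModuleCat.{0} (ZMod 2))).PreservesHomology where
  preservesKernels _ _ f := ObjectProperty.preservesKernels_ι _ f
  preservesCokernels _ _ f := ObjectProperty.preservesCokernels_ι _ f

instance : PreservesFiniteLimits (AdditiveFunctor.forget (DegreeCat B) (ModuleCat.{0} (ZMod 2))) :=
  Functor.preservesFiniteLimits_of_preservesHomology _

instance : PreservesFiniteColimits
    (AdditiveFunctor.forget (DegreeCat B) (ModuleCat.{0} (ZMod 2))) :=
  Functor.preservesFiniteColimits_of_preservesHomology _

instance (n : DegreeCat B) : PreservesFiniteLimits (GrMod.eval n) :=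
  comp_preservesFiniteLimits _ _

instance (n : DegreeCat B) : PreservesFiniteColimits (GrMod.eval n) :=
  comp_preservesFiniteColimits _ _

instance (n : DegreeCat B) : (GrMod.eval n).Additive where

/-- The action of a morphism of `DegreeCat B` on a graded module. -/
abbrev GrMod.act (M : GrMod B) {i j : DegreeCat B} (f : i ⟶ j) :
    M.obj.obj i →ₗ[ZMod 2] M.obj.obj j := (M.obj.map f).hom

/-- The degree `n` part of a morphism. -/
abbrev GrMod.app {M N : GrMod B} (f : M ⟶ N) (n : DegreeCat B) :
    M.obj.obj n →ₗ[ZMod 2] N.obj.obj n := (f.hom.app n).hom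

theorem GrMod.act_id (M : GrMod B) (i : DegreeCat B) (x : M.obj.obj i) :
    M.act (𝟙 i) x = x := by
  simp [GrMod.act]

theorem GrMod.act_comp (M : GrMod B) {i j k : DegreeCat B} (f : i ⟶ j) (g : j ⟶ k)
    (x : M.obj.obj i) : M.act (f ≫ g) x = M.act g (M.act f x) := by
  simp [GrMod.act]

theorem GrMod.act_add (M : GrMod B) {i j : DegreeCat B} (f g : i ⟶ j) (x : M.obj.obj i) :
    M.act (f + g) x = M.act f x + M.act g x := by
  simp [GrMod.act, Functor.map_add]

theorem GrMod.act_zero (M : GrMod B) {i j : DegreeCat B} (x : M.obj.obj i) :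
    M.act (0 : i ⟶ j) x = 0 := by
  simp [GrMod.act]

theorem GrMod.app_act {M N : GrMod B} (φ : M ⟶ N) {i j : DegreeCat B} (f : i ⟶ j)
    (x : M.obj.obj i) : GrMod.app φ j (M.act f x) = N.act f (GrMod.app φ i x) :=
  congrArg (fun h : M.obj.obj i ⟶ N.obj.obj j => h.hom x) (φ.hom.naturality f)

theorem GrMod.comp_app {M N P : GrMod B} (φ : M ⟶ N) (ψ : N ⟶ P) (n : DegreeCat B)
    (x : M.obj.obj n) : GrMod.app (φ ≫ ψ) n x = GrMod.app ψ n (GrMod.app φ n x) := rfl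

theorem GrMod.zero_app {M N : GrMod B} (n : DegreeCat B)
    (x : M.obj.obj n) : GrMod.app (0 : M ⟶ N) n x = 0 := rfl

theorem GrMod.add_app {M N : GrMod B} (φ ψ : M ⟶ N) (n : DegreeCat B)
    (x : M.obj.obj n) : GrMod.app (φ + ψ) n x = GrMod.app φ n x + GrMod.app ψ n x := rfl

theorem GrMod.hom_ext {M N : GrMod B} {φ ψ : M ⟶ N}
    (h : ∀ n x, GrMod.app φ n x = GrMod.app ψ n x) : φ = ψ := by
  apply ObjectProperty.hom_ext
  ext n x
  exact h n x

/-- A morphism of graded modules from its degree parts. -/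
def GrMod.mkHom {M N : GrMod B} (φ : ∀ n, M.obj.obj n →ₗ[ZMod 2] N.obj.obj n)
    (h : ∀ {i j : DegreeCat B} (f : i ⟶ j) (x : M.obj.obj i),
      φ j (M.act f x) = N.act f (φ i x)) : M ⟶ N :=
  ObjectProperty.homMk
    { app n := ModuleCat.ofHom (φ n)
      naturality i j f := by
        ext x
        exact h f x }

@[simp]
theorem GrMod.mkHom_app {M N : GrMod B} (φ : ∀ n, M.obj.obj n →ₗ[ZMod 2] N.obj.obj n)
    (h : ∀ {i j : DegreeCat B} (f : i ⟶ j) (x : M.obj.obj i),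
      φ j (M.act f x) = N.act f (φ i x)) (n : DegreeCat B) :
    GrMod.app (GrMod.mkHom φ h) n = φ n := rfl

/-- A graded module from its degree parts and the action. -/
def GrMod.mk' (V : DegreeCat B → ModuleCat.{0} (ZMod 2))
    (ρ : ∀ {i j : DegreeCat B}, (i ⟶ j) → (V i →ₗ[ZMod 2] V j))
    (h1 : ∀ i x, ρ (𝟙 i) x = x)
    (hc : ∀ {i j k : DegreeCat B} (f : i ⟶ j) (g : j ⟶ k) (x : V i), ρ (f ≫ g) x = ρ g (ρ f x))
    (ha : ∀ {i j : DegreeCat B} (f g : i ⟶ j) (x : V i), ρ (f + g) x = ρ f x + ρ g x) :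
    GrMod B where
  obj :=
    { obj := V
      map f := ModuleCat.ofHom (ρ f)
      map_id i := by ext x; exact h1 i x
      map_comp f g := by ext x; exact hc f g x }
  property := by
    constructor
    intro i j f g
    ext x
    exact ha f g x

theorem GrMod.injective_app_of_mono {M N : GrMod B} (f : M ⟶ N) [Mono f] (n : DegreeCat B) :
    Function.Injective (GrMod.app f n) :=
  (ModuleCat.mono_iff_injective _).1 (inferInstanceAs (Mono ((GrMod.eval n).map f)))

theorem GrMod.surjective_app_of_epi {M N : GrMod B} (f : M ⟶ N) [Epi f] (n : DegreeCat B) :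
    Function.Surjective (GrMod.app f n) :=
  (ModuleCat.epi_iff_surjective _).1 (inferInstanceAs (Epi ((GrMod.eval n).map f)))

theorem GrMod.mono_of_injective {M N : GrMod B} (f : M ⟶ N)
    (h : ∀ n, Function.Injective (GrMod.app f n)) : Mono f where
  right_cancellation g g' e := GrMod.hom_ext fun n x => h n <| by
    rw [← GrMod.comp_app, e, GrMod.comp_app]

theorem GrMod.epi_of_surjective {M N : GrMod B} (f : M ⟶ N)
    (h : ∀ n, Function.Surjective (GrMod.app f n)) : Epi f where
  left_cancellation g g' e := GrMod.hom_ext fun n y => by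
    obtain ⟨x, rfl⟩ := h n y
    rw [← GrMod.comp_app, e, GrMod.comp_app]

theorem GrMod.isIso_of_bijective {M N : GrMod B} (f : M ⟶ N)
    (h : ∀ n, Function.Bijective (GrMod.app f n)) : IsIso f := by
  have := GrMod.mono_of_injective f fun n => (h n).1
  have := GrMod.epi_of_surjective f fun n => (h n).2
  exact isIso_of_mono_of_epi f

theorem GrMod.isZero_of_subsingleton (M : GrMod B) (h : ∀ n, Subsingleton (M.obj.obj n)) :
    IsZero M := by
  rw [IsZero.iff_id_eq_zero]
  exact GrMod.hom_ext fun n x => (h n).elim _ _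

theorem GrMod.exact_of_eval (S : ShortComplex (GrMod B))
    (h : ∀ n (y : S.X₂.obj.obj n), GrMod.app S.g n y = 0 → ∃ x, GrMod.app S.f n x = y) :
    S.Exact := by
  rw [ShortComplex.exact_iff_isZero_homology]
  refine GrMod.isZero_of_subsingleton _ fun n => ?_
  have e : (S.map (GrMod.eval n)).Exact := by
    rw [ShortComplex.moduleCat_exact_iff]
    exact h n
  exact ModuleCat.subsingleton_of_isZero
    (IsZero.of_iso ((ShortComplex.exact_iff_isZero_homology _).1 e)
      (S.mapHomologyIso (GrMod.eval n)).symm)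

theorem GrMod.exact_eval {S : ShortComplex (GrMod B)} (hS : S.Exact) (n : DegreeCat B)
    (y : S.X₂.obj.obj n) (hy : GrMod.app S.g n y = 0) : ∃ x, GrMod.app S.f n x = y := by
  have := hS.map (GrMod.eval n)
  rw [ShortComplex.moduleCat_exact_iff] at this
  exact this y hy

theorem GrMod.shortExact_of_eval (S : ShortComplex (GrMod B))
    (hf : ∀ n, Function.Injective (GrMod.app S.f n))
    (hg : ∀ n, Function.Surjective (GrMod.app S.g n))
    (h : ∀ n (y : S.X₂.obj.obj n), GrMod.app S.g n y = 0 → ∃ x, GrMod.app S.f n x = y) :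
    S.ShortExact where
  exact := GrMod.exact_of_eval S h
  mono_f := GrMod.mono_of_injective _ hf
  epi_g := GrMod.epi_of_surjective _ hg

theorem GrMod.exact_functor {B' : Subalgebra (ZMod 2) Steenrod} (R : GrMod B ⥤ GrMod B')
    [R.Additive] (h : ∀ S : ShortComplex (GrMod B), S.ShortExact → (S.map R).ShortExact) :
    PreservesFiniteLimits R ∧ PreservesFiniteColimits R :=
  ((Functor.exact_tfae R).out 0 3).1 h

end SteenrodExt
end

noncomputable section
namespace SteenrodExt

/-! ### Change of rings for Ext -/

section ChangeOfRings

universe w w' v v' u u'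

variable {C : Type u} [Category.{v} C] [Abelian C] [HasExt.{w} C]
variable {D : Type u'} [Category.{v'} D] [Abelian D] [HasExt.{w'} D]

/-- The map `Ext(X, Z) → Ext(X', R Z)` induced by an exact functor `R` and `η : X' → R X`. -/
def extChange (R : C ⥤ D) [R.Additive] [PreservesFiniteLimits R] [PreservesFiniteColimits R]
    {X : C} {X' : D} (η : X' ⟶ R.obj X) (Z : C) (n : ℕ) : Ext X Z n →+ Ext X' (R.obj Z) n :=
  ((Ext.mk₀ η).precomp _ (zero_add n)).comp (R.mapExtAddHom X Z n)

theorem extChange_apply (R : C ⥤ D) [R.Additive] [PreservesFiniteLimits R]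
    [PreservesFiniteColimits R] {X : C} {X' : D} (η : X' ⟶ R.obj X) (Z : C) (n : ℕ)
    (e : Ext X Z n) :
    extChange R η Z n e = (Ext.mk₀ η).comp (e.mapExactFunctor R) (zero_add n) := rfl

attribute [local instance] Ext.subsingleton_of_injective in
theorem extChange_bijective (R : C ⥤ D) [R.Additive] [PreservesFiniteLimits R]
    [PreservesFiniteColimits R] {X : C} {X' : D} (η : X' ⟶ R.obj X)
    (hη : ∀ Z : C, Function.Bijective fun f : X ⟶ Z => η ≫ R.map f)
    (hI : ∀ Z : C, ∃ (I : C) (j : Z ⟶ I), Mono j ∧ Injective I ∧ Injective (R.obj I))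
    (Z : C) (n : ℕ) : Function.Bijective (extChange R η Z n) := by
  induction n generalizing Z with
  | zero =>
    rw [← Function.Bijective.of_comp_iff _ (Ext.mk₀_bijective X Z)]
    have e : (extChange R η Z 0 : Ext X Z 0 → Ext X' (R.obj Z) 0) ∘ Ext.mk₀
        = Ext.mk₀ ∘ (fun f : X ⟶ Z => η ≫ R.map f) := by
      funext f
      simp [extChange_apply, Ext.mapExactFunctor_mk₀]
    rw [e]
    exact (Ext.mk₀_bijective _ _).comp (hη Z)
  | succ n ih =>
    obtain ⟨I, j, hj, hI1, hI2⟩ := hI Z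
    let S := ShortComplex.mk _ _ (cokernel.condition j)
    have hS : S.ShortExact := { exact := ShortComplex.exact_cokernel j }
    have : Injective S.X₂ := hI1
    have : Injective (S.map R).X₂ := hI2
    refine AddMonoidHom.bijective_of_surjective_of_bijective_of_right_exact _ _ _ _
      (extChange R η S.X₂ n) (extChange R η S.X₃ n) (extChange R η S.X₁ (n + 1)) ?_ ?_
      ((ShortComplex.ab_exact_iff_function_exact _).mp
        (Ext.covariant_sequence_exact₃' X hS n (n + 1) rfl))
      ((ShortComplex.ab_exact_iff_function_exact _).mp
        (Ext.covariant_sequence_exact₃' X' (hS.map R) n (n + 1) rfl))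
      (ih _).surjective (ih _)
      (fun x₁ ↦ Ext.covariant_sequence_exact₁ _ hS x₁ (by subsingleton) rfl)
      (fun y₁ ↦ Ext.covariant_sequence_exact₁ _ (hS.map R) y₁ (by subsingleton) rfl)
    · ext x
      change ((Ext.mk₀ η).comp (x.mapExactFunctor R) (zero_add n)).comp
        (Ext.mk₀ (R.map S.g)) (add_zero n) = _
      simp [extChange_apply, Ext.mapExactFunctor_comp, Ext.mapExactFunctor_mk₀]
    · ext x
      change ((Ext.mk₀ η).comp (x.mapExactFunctor R) (zero_add n)).comp
        (hS.map R).extClass rfl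
        = (Ext.mk₀ η).comp ((x.comp hS.extClass rfl).mapExactFunctor R) (zero_add (n + 1))
      rw [Ext.mapExactFunctor_comp, Ext.mapExactFunctor_extClass]
      exact Ext.comp_assoc _ _ _ _ _ (by omega)

/-- `Ext(X, Z) ≅ Ext(X', R Z)` for an exact functor `R` which sends enough injective objects to
injective objects, if `X'` represents `Hom(X, -)` along `R`. -/
theorem ext_change_of_rings (R : C ⥤ D) [R.Additive] [PreservesFiniteLimits R]
    [PreservesFiniteColimits R] {X : C} {X' : D} (η : X' ⟶ R.obj X)
    (hη : ∀ Z : C, Function.Bijective fun f : X ⟶ Z => η ≫ R.map f)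
    (hI : ∀ Z : C, ∃ (I : C) (j : Z ⟶ I), Mono j ∧ Injective I ∧ Injective (R.obj I))
    (Z : C) (n : ℕ) : Nonempty (Ext X Z n ≃+ Ext X' (R.obj Z) n) :=
  ⟨AddEquiv.ofBijective _ (extChange_bijective R η hη hI Z n)⟩

/-- Isomorphic second arguments have isomorphic Ext groups. -/
def extCongrRight (X : C) {Y Y' : C} (e : Y ≅ Y') (n : ℕ) : Ext X Y n ≃+ Ext X Y' n where
  toFun x := x.comp (Ext.mk₀ e.hom) (add_zero n)
  invFun x := x.comp (Ext.mk₀ e.inv) (add_zero n)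
  left_inv x := by simp
  right_inv x := by simp
  map_add' x y := by simp

end ChangeOfRings

end SteenrodExt
end

noncomputable section
namespace SteenrodExt
variable {B : Subalgebra (ZMod 2) Steenrod}

/-! ### Injective graded modules -/

/-- A graded module is injective if it is cofree on linear maps `π` to a graded vector space. -/
theorem GrMod.injective_of_cofree (Y : GrMod B) (W : DegreeCat B → ModuleCat.{0} (ZMod 2))
    (π : ∀ m, Y.obj.obj m →ₗ[ZMod 2] W m)
    (hinj : ∀ i (y : Y.obj.obj i), (∀ m (b : i ⟶ m), π m (Y.act b y) = 0) → y = 0)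
    (hsurj : ∀ i (φ : ∀ m, (i ⟶ m) →+ W m), ∃ y, ∀ m (b : i ⟶ m), π m (Y.act b y) = φ m b) :
    Injective Y where
  factors {X X'} g f _ := by
    have hext : ∀ m, ∃ r : X'.obj.obj m →ₗ[ZMod 2] W m,
        r ∘ₗ GrMod.app f m = π m ∘ₗ GrMod.app g m := by
      intro m
      obtain ⟨l, hl⟩ := LinearMap.exists_leftInverse_of_injective (GrMod.app f m)
        (LinearMap.ker_eq_bot.2 (GrMod.injective_app_of_mono f m))
      exact ⟨(π m ∘ₗ GrMod.app g m) ∘ₗ l, by rw [LinearMap.comp_assoc, hl, LinearMap.comp_id]⟩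
    choose r hr using hext
    have huniq : ∀ i (y y' : Y.obj.obj i),
        (∀ m (b : i ⟶ m), π m (Y.act b y) = π m (Y.act b y')) → y = y' := by
      intro i y y' h
      rw [← sub_eq_zero]
      refine hinj i _ fun m b => ?_
      rw [map_sub, map_sub, h, sub_self]
    have hex : ∀ i (x : X'.obj.obj i), ∃ y : Y.obj.obj i,
        ∀ m (b : i ⟶ m), π m (Y.act b y) = r m (X'.act b x) := by
      intro i x
      exact hsurj i fun m => AddMonoidHom.mk' (fun b => r m (X'.act b x)) fun b b' => by
        rw [GrMod.act_add, map_add]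
    choose h hh using hex
    let hlin : ∀ i, X'.obj.obj i →ₗ[ZMod 2] Y.obj.obj i := fun i =>
      { toFun := h i
        map_add' := fun x x' => huniq i _ _ fun m b => by
          rw [hh, map_add, map_add, map_add, map_add, hh, hh]
        map_smul' := fun c x => huniq i _ _ fun m b => by
          rw [hh, map_smul, map_smul, RingHom.id_apply, map_smul, map_smul, hh] }
    refine ⟨GrMod.mkHom hlin fun {i j} a x => huniq j _ _ fun m b => ?_,
      GrMod.hom_ext fun i x => huniq i _ _ fun m b => ?_⟩
    · change π m (Y.act b (h j (X'.act a x))) = π m (Y.act b (Y.act a (h i x)))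
      rw [hh, ← GrMod.act_comp, ← GrMod.act_comp, hh]
    · rw [GrMod.comp_app, GrMod.mkHom_app]
      change π m (Y.act b (h i (GrMod.app f i x))) = _
      rw [hh, ← GrMod.app_act, ← GrMod.app_act]
      exact LinearMap.congr_fun (hr m) (X.act b x)

/-- The cofree graded module on a graded vector space `W`. -/
def GrMod.cofree (W : DegreeCat B → ModuleCat.{0} (ZMod 2)) : GrMod B :=
  GrMod.mk' (fun i => ModuleCat.of (ZMod 2) (∀ n, (i ⟶ n) →+ W n))
    (fun {i j} f =>
      { toFun := fun φ n => (φ n).comp (Preadditive.leftComp n f)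
        map_add' := fun _ _ => rfl
        map_smul' := fun _ _ => rfl })
    (fun i φ => by
      funext n; ext b
      exact congrArg (φ n) (Category.id_comp b))
    (fun f g φ => by
      funext n; ext b
      exact congrArg (φ n) (Category.assoc f g b))
    (fun f g φ => by
      funext n; ext b
      change φ n ((f + g) ≫ b) = φ n (f ≫ b) + φ n (g ≫ b)
      rw [Preadditive.add_comp, map_add])

/-- An element of the cofree module, as a family of functionals. -/
abbrev GrMod.cofree.coeff {W : DegreeCat B → ModuleCat.{0} (ZMod 2)} {i : DegreeCat B}
    (φ : (GrMod.cofree W).obj.obj i) (n : DegreeCat B) : (i ⟶ n) →+ W n := φ n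

theorem GrMod.cofree.ext {W : DegreeCat B → ModuleCat.{0} (ZMod 2)} {i : DegreeCat B}
    {φ ψ : (GrMod.cofree W).obj.obj i}
    (h : ∀ n b, GrMod.cofree.coeff φ n b = GrMod.cofree.coeff ψ n b) : φ = ψ := by
  funext n
  exact AddMonoidHom.ext (h n)

instance GrMod.cofree_injective (W : DegreeCat B → ModuleCat.{0} (ZMod 2)) :
    Injective (GrMod.cofree W) := by
  refine GrMod.injective_of_cofree _ W
    (fun m => { toFun := fun φ => GrMod.cofree.coeff φ m (𝟙 m)
                map_add' := fun _ _ => rfl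
                map_smul' := fun _ _ => rfl }) (fun i φ h => ?_) (fun i φ => ⟨φ, fun m b => ?_⟩)
  · refine GrMod.cofree.ext fun n b => ?_
    have := h n b
    change GrMod.cofree.coeff φ n (b ≫ 𝟙 n) = 0 at this
    rwa [Category.comp_id] at this
  · change φ m (b ≫ 𝟙 m) = φ m b
    rw [Category.comp_id]

/-- The embedding of a graded module in a cofree one. -/
def GrMod.toCofree (M : GrMod B) : M ⟶ GrMod.cofree M.obj.obj :=
  GrMod.mkHom (fun i =>
      { toFun := fun x n => AddMonoidHom.mk' (fun b => M.act b x) fun b b' => M.act_add b b' x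
        map_add' := fun x y => by
          funext n; ext b
          exact map_add (M.act b) x y
        map_smul' := fun c x => by
          funext n; ext b
          exact map_smul (M.act b) c x })
    (fun f x => by
      funext n; ext b
      exact (M.act_comp f b x).symm)

theorem GrMod.coeff_toCofree (M : GrMod B) {i : DegreeCat B} (x : M.obj.obj i) (n : DegreeCat B)
    (b : i ⟶ n) : GrMod.cofree.coeff (GrMod.app M.toCofree i x) n b = M.act b x := rfl

instance (M : GrMod B) : Mono M.toCofree :=
  GrMod.mono_of_injective _ fun i x y h => by
    have := congrArg (fun φ => GrMod.cofree.coeff φ i (𝟙 i)) h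
    simpa only [GrMod.coeff_toCofree, GrMod.act_id] using this

/-! ### Vanishing of Ext -/

theorem DegreeCat.eq_zero_of_lt {i j : DegreeCat B} (h : j.deg < i.deg) (f : i ⟶ j) : f = 0 := by
  have h0 : homog (j.deg - i.deg) = ⊥ := by
    rw [eq_bot_iff]
    refine Submodule.span_le.2 ?_
    rintro _ ⟨w, hw, -⟩
    omega
  exact Subtype.ext ((Submodule.mem_bot _).1 (h0.le f.2.2))

attribute [local instance] Ext.subsingleton_of_injective in
theorem ext_subsingleton_aux (X : GrMod B) (P : ℕ → GrMod B → Prop)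
    (h0 : ∀ Y, P 0 Y → ∀ f : X ⟶ Y, f = 0)
    (hs : ∀ s Y, P (s + 1) Y → P s (cokernel Y.toCofree)) (s : ℕ) (Y : GrMod B) (hY : P s Y) :
    Subsingleton (Ext X Y s) := by
  induction s generalizing Y with
  | zero =>
    have : Subsingleton (X ⟶ Y) := ⟨fun f g => by rw [h0 Y hY f, h0 Y hY g]⟩
    exact Ext.homEquiv₀.subsingleton
  | succ s ih =>
    let S := ShortComplex.mk _ _ (cokernel.condition Y.toCofree)
    have hS : S.ShortExact := { exact := ShortComplex.exact_cokernel Y.toCofree }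
    have h1 : Injective S.X₂ := GrMod.cofree_injective _
    have h2 : Subsingleton (Ext X S.X₃ s) := ih _ (hs s Y hY)
    refine subsingleton_of_forall_eq 0 fun x => ?_
    obtain ⟨y, rfl⟩ := Ext.covariant_sequence_exact₁ X hS x (by subsingleton) rfl
    rw [Subsingleton.elim y 0, Ext.zero_comp]

theorem subsingleton_cokernel_app {M N : GrMod B} (f : M ⟶ N) (n : DegreeCat B)
    [Subsingleton (N.obj.obj n)] : Subsingleton ((cokernel f).obj.obj n) :=
  (GrMod.surjective_app_of_epi (cokernel.π f) n).subsingleton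

theorem ext_subsingleton_of_neg (X Y : GrMod B)
    (hX : ∀ n : DegreeCat B, n.deg ≠ 0 → Subsingleton (X.obj.obj n))
    (hY : ∀ n : DegreeCat B, 0 ≤ n.deg → Subsingleton (Y.obj.obj n)) (s : ℕ) :
    Subsingleton (Ext X Y s) := by
  refine ext_subsingleton_aux X
    (fun _ Y => ∀ n : DegreeCat B, 0 ≤ n.deg → Subsingleton (Y.obj.obj n)) ?_ ?_ s Y hY
  · intro Y hY f
    refine GrMod.hom_ext fun n x => ?_
    by_cases hn : n.deg = 0
    · exact (hY n hn.ge).elim _ _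
    · rw [(hX n hn).elim x 0, map_zero, map_zero]
  · intro s Y hY i hi
    have : Subsingleton ((GrMod.cofree Y.obj.obj).obj.obj i) := by
      refine ⟨fun φ ψ => GrMod.cofree.ext fun n b => ?_⟩
      by_cases hn : 0 ≤ n.deg
      · exact (hY n hn).elim _ _
      · rw [DegreeCat.eq_zero_of_lt (by omega) b, map_zero, map_zero]
    exact subsingleton_cokernel_app _ _

theorem ext_subsingleton_of_lt (X Y : GrMod B) (N : ℕ)
    (hB : ∀ {i j : DegreeCat B} (f : i ⟶ j), (N : ℤ) < j.deg - i.deg → f = 0)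
    (hX : ∀ n : DegreeCat B, n.deg ≠ 0 → Subsingleton (X.obj.obj n)) (s : ℕ)
    (hY : ∀ n : DegreeCat B, n.deg ≤ N * s → Subsingleton (Y.obj.obj n)) :
    Subsingleton (Ext X Y s) := by
  refine ext_subsingleton_aux X
    (fun s Y => ∀ n : DegreeCat B, n.deg ≤ N * s → Subsingleton (Y.obj.obj n)) ?_ ?_ s Y hY
  · intro Y hY f
    refine GrMod.hom_ext fun n x => ?_
    by_cases hn : n.deg = 0
    · exact (hY n (by simp [hn])).elim _ _
    · rw [(hX n hn).elim x 0, map_zero, map_zero]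
  · intro s Y hY i hi
    have : Subsingleton ((GrMod.cofree Y.obj.obj).obj.obj i) := by
      refine ⟨fun φ ψ => GrMod.cofree.ext fun n b => ?_⟩
      by_cases hn : n.deg ≤ N * (s + 1 : ℕ)
      · exact (hY n hn).elim _ _
      · rw [hB b (by push_cast at hn; linarith), map_zero, map_zero]
    exact subsingleton_cokernel_app _ _

/-! ### Products -/

/-- The product of graded modules. -/
def GrMod.prod {ι : Type} (Y : ι → GrMod B) : GrMod B :=
  GrMod.mk' (fun i => ModuleCat.of (ZMod 2) (∀ p, (Y p).obj.obj i))
    (fun {i j} f => LinearMap.pi fun p => (Y p).act f ∘ₗ LinearMap.proj p)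
    (fun i x => by funext p; exact (Y p).act_id i _)
    (fun f g x => by funext p; exact (Y p).act_comp f g _)
    (fun f g x => by funext p; exact (Y p).act_add f g _)

/-- The projections of the product. -/
def GrMod.prod.proj {ι : Type} (Y : ι → GrMod B) (p : ι) : GrMod.prod Y ⟶ Y p :=
  GrMod.mkHom (fun i => LinearMap.proj (φ := fun p => (Y p).obj.obj i) p) (fun _ _ => rfl)

/-- The morphism into a product with given components. -/
def GrMod.prod.lift {ι : Type} {X : GrMod B} {Y : ι → GrMod B} (f : ∀ p, X ⟶ Y p) :
    X ⟶ GrMod.prod Y :=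
  GrMod.mkHom (fun i => LinearMap.pi fun p => GrMod.app (f p) i)
    (fun g x => by funext p; exact GrMod.app_act (f p) g x)

@[simp]
theorem GrMod.prod.lift_proj {ι : Type} {X : GrMod B} {Y : ι → GrMod B} (f : ∀ p, X ⟶ Y p)
    (p : ι) : GrMod.prod.lift f ≫ GrMod.prod.proj Y p = f p := rfl

@[simp]
theorem GrMod.prod.lift_proj_comp {ι : Type} {X Z : GrMod B} {Y : ι → GrMod B}
    (f : ∀ p, X ⟶ Y p) (p : ι) (g : Y p ⟶ Z) :
    GrMod.prod.lift f ≫ GrMod.prod.proj Y p ≫ g = f p ≫ g := rfl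

theorem GrMod.prod.hom_ext {ι : Type} {X : GrMod B} {Y : ι → GrMod B} {f g : X ⟶ GrMod.prod Y}
    (h : ∀ p, f ≫ GrMod.prod.proj Y p = g ≫ GrMod.prod.proj Y p) : f = g :=
  GrMod.hom_ext fun n x => by
    funext p
    exact congrArg (fun f : X ⟶ Y p => GrMod.app f n x) (h p)

instance {ι : Type} (Y : ι → GrMod B) [∀ p, Injective (Y p)] : Injective (GrMod.prod Y) where
  factors g f _ :=
    ⟨GrMod.prod.lift fun p => Injective.factorThru (g ≫ GrMod.prod.proj Y p) f,
      GrMod.prod.hom_ext fun p => by simp⟩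

/-- The comparison of `Ext` into a product with the product of the `Ext` groups. -/
def extProdComparison {ι : Type} (X : GrMod B) (Y : ι → GrMod B) (s : ℕ) :
    Ext X (GrMod.prod Y) s →+ ∀ p, Ext X (Y p) s :=
  AddMonoidHom.mk' (fun e p => e.comp (Ext.mk₀ (GrMod.prod.proj Y p)) (add_zero s))
    (fun e e' => by funext p; exact Ext.add_comp _ _ _ _)

theorem function_exact_pi {ι : Type} {A A' A'' : ι → Type*} [∀ p, AddCommGroup (A p)]
    [∀ p, AddCommGroup (A' p)] [∀ p, AddCommGroup (A'' p)] (f : ∀ p, A p →+ A' p)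
    (g : ∀ p, A' p →+ A'' p) (h : ∀ p, Function.Exact (f p) (g p)) :
    Function.Exact (AddMonoidHom.pi fun p => (f p).comp (Pi.evalAddMonoidHom A p))
      (AddMonoidHom.pi fun p => (g p).comp (Pi.evalAddMonoidHom A' p)) := by
  intro y
  constructor
  · intro hy
    have : ∀ p, ∃ x, f p x = y p := fun p => (h p _).1 (congrFun hy p)
    choose x hx using this
    exact ⟨x, funext hx⟩
  · rintro ⟨x, rfl⟩
    funext p
    exact (h p _).2 ⟨x p, rfl⟩

attribute [local instance] Ext.subsingleton_of_injective in
theorem extProdComparison_bijective {ι : Type} (X : GrMod B) (Y : ι → GrMod B) (s : ℕ) :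
    Function.Bijective (extProdComparison X Y s) := by
  induction s generalizing Y with
  | zero =>
    rw [← Function.Bijective.of_comp_iff _ (Ext.mk₀_bijective _ _)]
    constructor
    · intro f g h
      refine GrMod.prod.hom_ext fun p => (Ext.mk₀_bijective _ _).1 ?_
      have := congrFun h p
      simpa [extProdComparison] using this
    · intro e
      refine ⟨GrMod.prod.lift fun p => Ext.homEquiv₀ (e p), ?_⟩
      funext p
      simp [extProdComparison]
  | succ s ih =>
    let T : ι → ShortComplex (GrMod B) := fun p =>
      ShortComplex.mk _ _ (cokernel.condition (Y p).toCofree)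
    have hT : ∀ p, (T p).ShortExact := fun p =>
      { exact := ShortComplex.exact_cokernel (Y p).toCofree }
    let S : ShortComplex (GrMod B) :=
      { X₁ := GrMod.prod Y
        X₂ := GrMod.prod fun p => (T p).X₂
        X₃ := GrMod.prod fun p => (T p).X₃
        f := GrMod.prod.lift fun p => GrMod.prod.proj Y p ≫ (T p).f
        g := GrMod.prod.lift fun p => GrMod.prod.proj (fun p => (T p).X₂) p ≫ (T p).g
        zero := GrMod.prod.hom_ext fun p => by simp }
    have hS : S.ShortExact := by
      refine GrMod.shortExact_of_eval S (fun n x y h => ?_) (fun n y => ?_) (fun n y hy => ?_)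
      · funext p
        have : Mono (T p).f := (hT p).mono_f
        exact GrMod.injective_app_of_mono (T p).f n (congrFun h p)
      · have : ∀ p, ∃ x, GrMod.app (T p).g n x = y p := fun p =>
          have : Epi (T p).g := (hT p).epi_g
          GrMod.surjective_app_of_epi (T p).g n (y p)
        choose x hx using this
        exact ⟨x, funext hx⟩
      · have : ∀ p, ∃ x, GrMod.app (T p).f n x = y p := fun p =>
          GrMod.exact_eval (hT p).exact n (y p) (congrFun hy p)
        choose x hx using this
        exact ⟨x, funext hx⟩
    let pr : ∀ p, S ⟶ T p := fun p =>
      { τ₁ := GrMod.prod.proj _ p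
        τ₂ := GrMod.prod.proj _ p
        τ₃ := GrMod.prod.proj _ p }
    have : ∀ p, Injective (T p).X₂ := fun p => GrMod.cofree_injective _
    have : Injective S.X₂ := inferInstanceAs (Injective (GrMod.prod fun p => (T p).X₂))
    refine AddMonoidHom.bijective_of_surjective_of_bijective_of_right_exact _ _ _ _
      (extProdComparison X (fun p => (T p).X₂) s) (extProdComparison X (fun p => (T p).X₃) s)
      (extProdComparison X Y (s + 1)) ?_ ?_
      ((ShortComplex.ab_exact_iff_function_exact _).mp
        (Ext.covariant_sequence_exact₃' X hS s (s + 1) rfl))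
      (function_exact_pi _ _ fun p => (ShortComplex.ab_exact_iff_function_exact _).mp
        (Ext.covariant_sequence_exact₃' X (hT p) s (s + 1) rfl))
      (ih _).surjective (ih _)
      (fun x₁ ↦ Ext.covariant_sequence_exact₁ _ hS x₁ (by subsingleton) rfl) ?_
    · ext e p
      change (e.comp (Ext.mk₀ (pr p).τ₂) (add_zero s)).comp (Ext.mk₀ (T p).g) (add_zero s)
        = (e.comp (Ext.mk₀ S.g) (add_zero s)).comp (Ext.mk₀ (pr p).τ₃) (add_zero s)
      simp [(pr p).comm₂₃]
    · ext e p
      change (e.comp (Ext.mk₀ (pr p).τ₃) (add_zero s)).comp (hT p).extClass rfl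
        = (e.comp hS.extClass rfl).comp (Ext.mk₀ (pr p).τ₁) (add_zero (s + 1))
      rw [Ext.comp_assoc e hS.extClass _ rfl (add_zero 1) (by omega),
        ShortComplex.ShortExact.extClass_naturality hS (hT p) (pr p),
        Ext.comp_assoc e _ _ (add_zero s) (zero_add 1) (by omega)]
    · intro y
      have : ∀ p, ∃ x : Ext X (T p).X₃ s, x.comp (hT p).extClass rfl = y p := fun p =>
        Ext.covariant_sequence_exact₁ X (hT p) (y p) (by subsingleton) rfl
      choose x hx using this
      exact ⟨x, funext hx⟩

end SteenrodExt
end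

noncomputable section
namespace SteenrodExt

/-! ### The grading of the Steenrod algebra -/

theorem Sq_zero : Sq 0 = 1 := by
  have := RingQuot.mkAlgHom_rel (ZMod 2) AdemRel.sq_zero
  rw [map_one] at this
  exact this

theorem Sq_adem (a b : ℕ) (ha : 0 < a) (hab : a < 2 * b) :
    Sq a * Sq b = ∑ j ∈ Finset.range (a / 2 + 1),
      ((b - 1 - j).choose (a - 2 * j) : ZMod 2) • (Sq (a + b - j) * Sq j) := by
  have := RingQuot.mkAlgHom_rel (ZMod 2) (AdemRel.adem a b ha hab)
  rw [map_mul, map_sum] at this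
  simp only [map_smul, map_mul] at this
  exact this

/-- The algebra map `Sq^n ↦ Sq^n t^n`, which records degrees. -/
def gradingHom : Steenrod →ₐ[ZMod 2] Polynomial Steenrod :=
  Steenrod.lift (fun n => Polynomial.monomial n (Sq n)) (by
    rintro _ _ (_ | ⟨a, b, ha, hab⟩)
    · simp [Sq_zero]
    · simp only [map_mul, map_sum, map_smul, FreeAlgebra.lift_ι_apply,
        Polynomial.monomial_mul_monomial]
      rw [Sq_adem a b ha hab, map_sum]
      refine Finset.sum_congr rfl fun j hj => ?_
      have : j < a / 2 + 1 := by simpa using hj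
      rw [show a + b - j + j = a + b by omega, Polynomial.smul_monomial])

theorem gradingHom_Sq (n : ℕ) : gradingHom (Sq n) = Polynomial.monomial n (Sq n) :=
  Steenrod.lift_Sq _ _ n

theorem gradingHom_word (w : List ℕ) :
    gradingHom (w.map Sq).prod = Polynomial.monomial w.sum (w.map Sq).prod := by
  induction w with
  | nil => simp
  | cons n w ih => simp [gradingHom_Sq, ih, Polynomial.monomial_mul_monomial]

theorem gradingHom_of_mem_homog {d : ℕ} {x : Steenrod} (hx : x ∈ homog d) :
    gradingHom x = Polynomial.monomial d x := by
  induction hx using Submodule.span_induction with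
  | mem x hx =>
    obtain ⟨w, hw, rfl⟩ := hx
    rw [gradingHom_word, show w.sum = d by exact_mod_cast hw]
  | zero => simp
  | add x y _ _ hx hy => simp [hx, hy]
  | smul c x _ hx => rw [map_smul, hx, Polynomial.smul_monomial]

theorem homog_eq_bot {d : ℤ} (hd : d < 0) : homog d = ⊥ := by
  rw [eq_bot_iff]
  refine Submodule.span_le.2 ?_
  rintro _ ⟨w, hw, -⟩
  omega

/-- The homogeneous component of degree `d`. -/
def component (d : ℤ) : Steenrod →ₗ[ZMod 2] Steenrod :=
  if 0 ≤ d then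
    ((Polynomial.lcoeff Steenrod d.toNat).restrictScalars (ZMod 2)) ∘ₗ gradingHom.toLinearMap
  else 0

theorem component_natCast (d : ℕ) (x : Steenrod) :
    component d x = (gradingHom x).coeff d := by
  simp [component]

theorem component_of_mem {d : ℤ} {x : Steenrod} (hx : x ∈ homog d) : component d x = x := by
  rcases lt_or_ge d 0 with hd | hd
  · rw [homog_eq_bot hd, Submodule.mem_bot] at hx
    rw [hx, map_zero]
  · lift d to ℕ using hd
    rw [component_natCast, gradingHom_of_mem_homog hx, Polynomial.coeff_monomial_same]

theorem component_of_mem_ne {d e : ℤ} (h : d ≠ e) {x : Steenrod} (hx : x ∈ homog e) :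
    component d x = 0 := by
  rcases lt_or_ge e 0 with he | he
  · rw [homog_eq_bot he, Submodule.mem_bot] at hx
    rw [hx, map_zero]
  · lift e to ℕ using he
    rcases lt_or_ge d 0 with hd | hd
    · rw [component, if_neg (by omega), LinearMap.zero_apply]
    · lift d to ℕ using hd
      rw [component_natCast, gradingHom_of_mem_homog hx, Polynomial.coeff_monomial_of_ne]
      exact_mod_cast h

theorem word_mem_homog (w : List ℕ) : (w.map Sq).prod ∈ homog w.sum :=
  Submodule.subset_span ⟨w, rfl, rfl⟩

theorem Sq_mem_homog (n : ℕ) : Sq n ∈ homog n := by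
  simpa using word_mem_homog [n]

/-- Words in the generators `Sq^g`, `g ∈ G`, of degree `d`. -/
def words (G : Set ℕ) (d : ℤ) : Set Steenrod :=
  {x | ∃ w : List ℕ, (∀ n ∈ w, n ∈ G) ∧ (w.sum : ℤ) = d ∧ x = (w.map Sq).prod}

theorem mem_span_words (G : Set ℕ) {x : Steenrod} (hx : x ∈ Algebra.adjoin (ZMod 2) (Sq '' G)) :
    x ∈ Submodule.span (ZMod 2) (⋃ d, words G d) := by
  change x ∈ Subalgebra.toSubmodule (Algebra.adjoin (ZMod 2) (Sq '' G)) at hx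
  rw [Algebra.adjoin_eq_span] at hx
  refine Submodule.span_mono ?_ hx
  intro z hz
  induction hz using Submonoid.closure_induction with
  | mem z hz =>
    obtain ⟨n, hn, rfl⟩ := hz
    exact Set.mem_iUnion.2 ⟨n, [n], by simpa using hn, by simp, by simp⟩
  | one => exact Set.mem_iUnion.2 ⟨0, [], by simp, by simp, by simp⟩
  | mul a b _ _ ha hb =>
    obtain ⟨d, u, hu, hd, rfl⟩ := Set.mem_iUnion.1 ha
    obtain ⟨e, v, hv, he, rfl⟩ := Set.mem_iUnion.1 hb
    refine Set.mem_iUnion.2 ⟨d + e, u ++ v, ?_, by simp [hd, he], by simp⟩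
    intro n hn
    rcases List.mem_append.1 hn with h | h
    exacts [hu n h, hv n h]

theorem component_mem_span_words (G : Set ℕ) {x : Steenrod}
    (hx : x ∈ Algebra.adjoin (ZMod 2) (Sq '' G)) (d : ℤ) :
    component d x ∈ Submodule.span (ZMod 2) (words G d) := by
  have hx' := mem_span_words G hx
  clear hx
  induction hx' using Submodule.span_induction with
  | mem x hx =>
    obtain ⟨e, w, hw, rfl, rfl⟩ := Set.mem_iUnion.1 hx
    by_cases hd : d = w.sum
    · rw [hd, component_of_mem (word_mem_homog w)]
      exact Submodule.subset_span ⟨w, hw, rfl, rfl⟩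
    · rw [component_of_mem_ne hd (word_mem_homog w)]
      exact zero_mem _
  | zero => rw [map_zero]; exact zero_mem _
  | add a b _ _ ha hb => rw [map_add]; exact add_mem ha hb
  | smul c a _ ha => rw [map_smul]; exact Submodule.smul_mem _ _ ha

theorem A2_eq : A2 = Algebra.adjoin (ZMod 2) (Sq '' {1, 2, 4}) := by
  rw [A2, Set.image_insert_eq, Set.image_pair]

theorem A1_le_A2 : A1 ≤ A2 := by
  apply Algebra.adjoin_mono
  intro x hx
  rcases hx with rfl | rfl <;> simp

/-! ### Relations in `A_2` -/

theorem steenrod_add_self (x : Steenrod) : x + x = 0 := by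
  have : (2 : ZMod 2) • x = 0 := by rw [show (2 : ZMod 2) = 0 from rfl, zero_smul]
  rwa [two_smul] at this

theorem steenrod_eq_of_add {x y : Steenrod} (h : x + y = 0) : x = y := by
  have := steenrod_add_self y
  calc x = x + (y + y) := by rw [this, add_zero]
    _ = y := by rw [← add_assoc, h, zero_add]

theorem Sq_one_one : Sq 1 * Sq 1 = 0 := by
  rw [Sq_adem 1 1 (by norm_num) (by norm_num)]
  simp

theorem Sq_three : Sq 3 = Sq 1 * Sq 2 := by
  rw [Sq_adem 1 2 (by norm_num) (by norm_num)]
  simp [Sq_zero]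

theorem Sq_two_two : Sq 2 * Sq 2 = Sq 1 * Sq 2 * Sq 1 := by
  rw [Sq_adem 2 2 (by norm_num) (by norm_num), ← Sq_three]
  simp [Finset.sum_range_succ]

theorem Sq_five : Sq 5 = Sq 1 * Sq 4 := by
  rw [Sq_adem 1 4 (by norm_num) (by norm_num)]
  simp [Sq_zero, show (3 : ZMod 2) = 1 from rfl]

theorem Sq_two_three : Sq 2 * Sq 3 = Sq 5 + Sq 4 * Sq 1 := by
  rw [Sq_adem 2 3 (by norm_num) (by norm_num)]
  simp [Finset.sum_range_succ, Sq_zero]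

theorem Sq_two_four : Sq 2 * Sq 4 = Sq 6 + Sq 5 * Sq 1 := by
  rw [Sq_adem 2 4 (by norm_num) (by norm_num)]
  simp [Finset.sum_range_succ, Sq_zero, show (3 : ZMod 2) = 1 from rfl]

theorem Sq_one_six : Sq 1 * Sq 6 = Sq 7 := by
  rw [Sq_adem 1 6 (by norm_num) (by norm_num)]
  simp [Sq_zero, show (5 : ZMod 2) = 1 from rfl]

theorem Sq_four_four : Sq 4 * Sq 4 = Sq 7 * Sq 1 + Sq 6 * Sq 2 := by
  rw [Sq_adem 4 4 (by norm_num) (by norm_num)]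
  simp [Finset.sum_range_succ, Sq_zero]

end SteenrodExt
end

noncomputable section
namespace SteenrodExt

theorem steenrod_two : (2 : Steenrod) = 0 := by
  rw [← one_add_one_eq_two, steenrod_add_self]

theorem steenrod_four : (4 : Steenrod) = 0 := by
  rw [show (4 : Steenrod) = 2 * 2 by norm_num, steenrod_two, zero_mul]

theorem mul_assoc_of {R : Type*} [Semigroup R] {a b r : R} (h : a * b = r) (x : R) :
    a * (b * x) = r * x := by rw [← mul_assoc, h]

theorem Sq_one_four : Sq 1 * Sq 4 = Sq 4 * Sq 1 + Sq 2 * (Sq 1 * Sq 2) := by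
  have h := Sq_two_three
  rw [Sq_three, Sq_five] at h
  apply steenrod_eq_of_add
  rw [h, show Sq 1 * Sq 4 + (Sq 4 * Sq 1 + (Sq 1 * Sq 4 + Sq 4 * Sq 1))
    = (Sq 1 * Sq 4 + Sq 4 * Sq 1) + (Sq 1 * Sq 4 + Sq 4 * Sq 1) by abel, steenrod_add_self]

/-- The Milnor primitive `Q_1`. -/
def Q1 : Steenrod := Sq 1 * Sq 2 + Sq 2 * Sq 1

/-- The Milnor primitive `Q_2`. -/
def Q2 : Steenrod := Q1 * Sq 4 + Sq 4 * Q1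

theorem eq_add_of_add_eq {x y z : Steenrod} (h : z = x + y) : x = y + z := by
  rw [h]
  apply steenrod_eq_of_add
  rw [show x + (y + (x + y)) = (x + x) + (y + y) by abel, steenrod_add_self, steenrod_add_self,
    add_zero]

theorem rel_one_two : Sq 1 * Sq 2 = Sq 2 * Sq 1 + Q1 := eq_add_of_add_eq rfl

theorem rel_Q1_four : Q1 * Sq 4 = Sq 4 * Q1 + Q2 := eq_add_of_add_eq rfl

theorem rel_two_two : Sq 2 * Sq 2 = Sq 1 * Q1 := by
  rw [Sq_two_two, Q1, mul_add, ← mul_assoc, Sq_one_one, zero_mul, zero_add, mul_assoc]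

theorem rel_Q1_one : Q1 * Sq 1 = Sq 1 * Q1 := by
  simp only [Q1, mul_add, add_mul, mul_assoc, Sq_one_one, mul_assoc_of Sq_one_one, zero_mul,
    mul_zero, zero_add, add_zero]

theorem rel_Q1_two : Q1 * Sq 2 = Sq 2 * Q1 := by
  have h : Sq 1 * (Sq 2 * Sq 2) = 0 := by
    rw [Sq_two_two, ← mul_assoc, ← mul_assoc, Sq_one_one, zero_mul, zero_mul]
  have h' : Sq 2 * (Sq 2 * Sq 1) = 0 := by
    rw [← mul_assoc, Sq_two_two, mul_assoc, Sq_one_one, mul_zero]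
  rw [Q1, add_mul, mul_assoc, h, zero_add, mul_add, h', add_zero, mul_assoc]

theorem rel_Q1_Q1 : Q1 * Q1 = 0 := by
  have h : Sq 1 * (Sq 2 * Q1) = Sq 2 * (Sq 1 * Q1) := by
    rw [← rel_two_two, ← rel_Q1_two, ← mul_assoc, ← rel_two_two, mul_assoc]
  conv_lhs => enter [1]; rw [Q1]
  rw [add_mul, mul_assoc, mul_assoc, h, steenrod_add_self]

theorem rel_one_four : Sq 1 * Sq 4 = Sq 4 * Sq 1 + Sq 2 * Q1 := by
  rw [Sq_one_four, rel_one_two, mul_add, ← mul_assoc, rel_two_two, mul_assoc, rel_Q1_one,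
    ← mul_assoc, Sq_one_one, zero_mul, zero_add]

theorem Sq_one_one_assoc (x : Steenrod) : Sq 1 * (Sq 1 * x) = 0 := by
  have h := congrArg (· * x) Sq_one_one
  simpa only [mul_assoc, zero_mul] using h

theorem rel_one_two_assoc (x : Steenrod) : Sq 1 * (Sq 2 * x) = (Sq 2 * Sq 1 + Q1) * x := by
  have h := congrArg (· * x) rel_one_two
  simpa only [mul_assoc, zero_mul] using h

theorem rel_one_four_assoc (x : Steenrod) : Sq 1 * (Sq 4 * x) = (Sq 4 * Sq 1 + Sq 2 * Q1) * x := by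
  have h := congrArg (· * x) rel_one_four
  simpa only [mul_assoc, zero_mul] using h

theorem rel_Q1_one_assoc (x : Steenrod) : Q1 * (Sq 1 * x) = (Sq 1 * Q1) * x := by
  have h := congrArg (· * x) rel_Q1_one
  simpa only [mul_assoc, zero_mul] using h

theorem rel_Q1_two_assoc (x : Steenrod) : Q1 * (Sq 2 * x) = (Sq 2 * Q1) * x := by
  have h := congrArg (· * x) rel_Q1_two
  simpa only [mul_assoc, zero_mul] using h

theorem rel_Q1_four_assoc (x : Steenrod) : Q1 * (Sq 4 * x) = (Sq 4 * Q1 + Q2) * x := by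
  have h := congrArg (· * x) rel_Q1_four
  simpa only [mul_assoc, zero_mul] using h

theorem rel_Q1_Q1_assoc (x : Steenrod) : Q1 * (Q1 * x) = 0 := by
  have h := congrArg (· * x) rel_Q1_Q1
  simpa only [mul_assoc, zero_mul] using h

theorem rel_two_two_assoc (x : Steenrod) : Sq 2 * (Sq 2 * x) = (Sq 1 * Q1) * x := by
  have h := congrArg (· * x) rel_two_two
  simpa only [mul_assoc, zero_mul] using h

attribute [local simp] mul_add add_mul mul_assoc steenrod_two steenrod_four steenrod_add_self
  Sq_one_one Sq_one_one_assoc rel_one_two rel_one_two_assoc rel_one_four rel_one_four_assoc rel_Q1_one rel_Q1_one_assoc rel_Q1_two rel_Q1_two_assoc rel_Q1_four rel_Q1_four_assoc rel_Q1_Q1 rel_Q1_Q1_assoc rel_two_two rel_two_two_assoc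

theorem rel_Q2_one : Q2 * (Sq 1) = Sq 1 * Q2 := by
  have e : Sq 1 * (Q1 * Sq 4) = Q1 * (Sq 4 * Sq 1) := by
    rw [← mul_assoc, ← rel_Q1_one, mul_assoc, rel_one_four, mul_add, rel_Q1_two_assoc,
      mul_assoc, rel_Q1_Q1, mul_zero, add_zero]
  have e' : Sq 1 * (Sq 4 * Q1) = Sq 4 * (Q1 * Sq 1) := by
    rw [rel_one_four_assoc, add_mul, mul_assoc, mul_assoc, rel_Q1_Q1, mul_zero, add_zero,
      rel_Q1_one]
  rw [Q2, mul_add, e, e', add_mul, mul_assoc, mul_assoc]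

theorem rel_Q2_one_assoc (x : Steenrod) : Q2 * (Sq 1 * x) = (Sq 1 * Q2) * x := by
  have h := congrArg (· * x) rel_Q2_one
  simpa only [mul_assoc, zero_mul] using h

attribute [local simp] rel_Q2_one rel_Q2_one_assoc

theorem rel_Q2_Q1 : Q2 * Q1 = Q1 * Q2 := by
  have h : Q2 * Q1 + Q1 * Q2
      = (Q1 * Sq 4 + Sq 4 * Q1) * Q1 + Q1 * (Q1 * Sq 4 + Sq 4 * Q1) := rfl
  apply steenrod_eq_of_add
  rw [h, mul_add, ← mul_assoc Q1 Q1]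
  simp only [add_mul, mul_assoc, rel_Q1_Q1, mul_zero, zero_mul, zero_add, add_zero,
    steenrod_add_self]

theorem rel_Q2_Q1_assoc (x : Steenrod) : Q2 * (Q1 * x) = (Q1 * Q2) * x := by
  have h := congrArg (· * x) rel_Q2_Q1
  simpa only [mul_assoc, zero_mul] using h

attribute [local simp] rel_Q2_Q1 rel_Q2_Q1_assoc

theorem rel_four_four : Sq 4 * (Sq 4) = Sq 2 * (Sq 4 * Sq 2) + Sq 4 * (Sq 1 * Q1) + Sq 1 * Q2 := by
  have h6 : Sq 6 = Sq 2 * Sq 4 + Sq 5 * Sq 1 := by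
    rw [Sq_two_four, add_assoc, steenrod_add_self, add_zero]
  rw [Sq_four_four, ← Sq_one_six, h6, Sq_five]
  apply steenrod_eq_of_add
  simp
  abel_nf
  simp

theorem rel_four_four_assoc (x : Steenrod) : Sq 4 * (Sq 4 * x) = (Sq 2 * (Sq 4 * Sq 2) + Sq 4 * (Sq 1 * Q1) + Sq 1 * Q2) * x := by
  have h := congrArg (· * x) rel_four_four
  simpa only [mul_assoc, zero_mul] using h

attribute [local simp] rel_four_four rel_four_four_assoc

theorem rel_Q2_two : Q2 * (Sq 2) = Sq 2 * Q2 := by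
  have h : Sq 1 * (Sq 4 * Sq 4) + (Sq 4 * Sq 4) * Sq 1 = Sq 2 * (Q1 * Sq 4) + Sq 4 * (Sq 2 * Q1) := by
    simp only [mul_assoc, rel_one_four, rel_one_four_assoc, mul_add, add_mul]
    abel_nf
    simp
  rw [rel_four_four] at h
  have key : Q2 * Sq 2 + Sq 2 * Q2
      = (Sq 1 * (Sq 2 * (Sq 4 * Sq 2) + Sq 4 * (Sq 1 * Q1) + Sq 1 * Q2)
          + (Sq 2 * (Sq 4 * Sq 2) + Sq 4 * (Sq 1 * Q1) + Sq 1 * Q2) * Sq 1)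
        + (Sq 2 * (Q1 * Sq 4) + Sq 4 * (Sq 2 * Q1)) := by
    apply steenrod_eq_of_add
    simp
    abel_nf
    simp
  rw [h, steenrod_add_self] at key
  exact steenrod_eq_of_add key

theorem rel_Q2_two_assoc (x : Steenrod) : Q2 * (Sq 2 * x) = (Sq 2 * Q2) * x := by
  have h := congrArg (· * x) rel_Q2_two
  simpa only [mul_assoc, zero_mul] using h

attribute [local simp] rel_Q2_two rel_Q2_two_assoc

theorem rel_Q2_four : Q2 * (Sq 4) = Sq 4 * Q2 := by
  have key : Q2 * Sq 4 + Sq 4 * Q2 = Q1 * (Sq 4 * Sq 4) + (Sq 4 * Sq 4) * Q1 := by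
    rw [Q2, add_mul, mul_add, mul_assoc, mul_assoc, mul_assoc,
      show ∀ a b d : Steenrod, a + b + (b + d) = a + d + (b + b) by intros; abel,
      steenrod_add_self, add_zero]
  apply steenrod_eq_of_add
  rw [key, rel_four_four]
  simp
  abel_nf
  simp

theorem rel_Q2_four_assoc (x : Steenrod) : Q2 * (Sq 4 * x) = (Sq 4 * Q2) * x := by
  have h := congrArg (· * x) rel_Q2_four
  simpa only [mul_assoc, zero_mul] using h

attribute [local simp] rel_Q2_four rel_Q2_four_assoc

theorem rel_two_four_two_four : Sq 2 * (Sq 4 * (Sq 2 * (Sq 4))) = Sq 4 * (Sq 2 * (Sq 4 * Sq 2)) + Sq 4 * (Sq 1 * Q2) + Sq 2 * (Q1 * Q2) := by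
  have h : Sq 4 * (Sq 4 * Sq 4) = (Sq 4 * Sq 4) * Sq 4 := (mul_assoc _ _ _).symm
  rw [rel_four_four] at h
  have key : Sq 2 * (Sq 4 * (Sq 2 * Sq 4)) + (Sq 4 * (Sq 2 * (Sq 4 * Sq 2)) + Sq 4 * (Sq 1 * Q2)
      + Sq 2 * (Q1 * Q2)) = (Sq 4 * (Sq 2 * (Sq 4 * Sq 2) + Sq 4 * (Sq 1 * Q1) + Sq 1 * Q2))
      + (Sq 2 * (Sq 4 * Sq 2) + Sq 4 * (Sq 1 * Q1) + Sq 1 * Q2) * Sq 4 := by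
    apply steenrod_eq_of_add
    simp
    abel_nf
    simp
  rw [h, steenrod_add_self] at key
  exact steenrod_eq_of_add key

theorem rel_two_four_two_four_assoc (x : Steenrod) : Sq 2 * (Sq 4 * (Sq 2 * (Sq 4 * x))) = (Sq 4 * (Sq 2 * (Sq 4 * Sq 2)) + Sq 4 * (Sq 1 * Q2) + Sq 2 * (Q1 * Q2)) * x := by
  have h := congrArg (· * x) rel_two_four_two_four
  simpa only [mul_assoc, zero_mul] using h

attribute [local simp] rel_two_four_two_four rel_two_four_two_four_assoc

theorem rel_Q2_Q2 : Q2 * Q2 = 0 := by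
  have h : Sq 2 * (Sq 2 * (Sq 4 * (Sq 2 * Sq 4))) = (Sq 2 * Sq 2) * (Sq 4 * (Sq 2 * Sq 4)) :=
    (mul_assoc _ _ _).symm
  rw [rel_two_four_two_four, rel_two_two] at h
  have key : Q2 * Q2 = Sq 2 * (Sq 4 * (Sq 2 * (Sq 4 * Sq 2)) + Sq 4 * (Sq 1 * Q2)
      + Sq 2 * (Q1 * Q2)) + Sq 1 * Q1 * (Sq 4 * (Sq 2 * Sq 4)) := by
    apply steenrod_eq_of_add
    simp
    abel_nf
    simp
  rw [h, steenrod_add_self] at key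
  exact key

theorem rel_Q2_Q2_assoc (x : Steenrod) : Q2 * (Q2 * x) = 0 := by
  have h := congrArg (· * x) rel_Q2_Q2
  simpa only [mul_assoc, zero_mul] using h

attribute [local simp] rel_Q2_Q2 rel_Q2_Q2_assoc

end SteenrodExt
end

noncomputable section
namespace SteenrodExt

/-! ### The action of the Steenrod algebra on a polynomial ring -/

open Polynomial in
/-- Extraction of an Adem relation from the equality of two generating functions. -/
theorem adem_of_total {R : Type} [CommRing R] [Algebra (ZMod 2) R] (e : ℕ → R) (a b : ℕ)
    (hab : a < 2 * b)
    (h : ∑ j ∈ Finset.range (a + b + 1), C (e j) * (X ^ 2 + X : R[X]) ^ (a + b - j)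
      = ∑ j ∈ Finset.range (a + b + 1), C (e j) * ((1 + X : R[X]) ^ (a + b - j) * (X ^ 2) ^ j)) :
    e b = ∑ j ∈ Finset.range (a / 2 + 1), ((b - 1 - j).choose (a - 2 * j) : ZMod 2) • e j := by
  obtain ⟨m, hm⟩ : ∃ m : ℕ, a + 1 < 2 ^ m := ⟨a + 1, Nat.lt_two_pow_self⟩
  set N := 2 ^ m with hN
  have cast : ∀ u v : ℕ, ((u : ℕ) : ZMod 2) = ((v : ℕ) : ZMod 2) → (u : R) = (v : R) := by
    intro u v huv
    have := congrArg (algebraMap (ZMod 2) R) huv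
    simpa using this
  replace h := congrArg (fun p : R[X] => (p * (1 + X) ^ (N - a - 1)).coeff a) h
  simp only [Finset.sum_mul, finsetSum_coeff, mul_assoc, coeff_C_mul] at h
  have hL : ∀ i : ℕ, ((((X : R[X]) ^ 2 + X) ^ i) * (1 + X) ^ (N - a - 1)).coeff a
      = if i = a then 1 else 0 := by
    intro i
    have : (((X : R[X]) ^ 2 + X) ^ i) * (1 + X) ^ (N - a - 1)
        = (1 + X) ^ (i + (N - a - 1)) * X ^ i := by
      rw [pow_add, show (X : R[X]) ^ 2 + X = (1 + X) * X by ring, mul_pow]; ring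
    rw [this, coeff_mul_X_pow', coeff_one_add_X_pow]
    split_ifs with h1 h2 h2
    · subst h2; simp
    · simpa using cast _ 0 (by simpa using choose_compl m (a - i) (i + (N - a - 1)) (by omega) (by omega) (by omega))
    · omega
    · rfl
  have hR : ∀ j : ℕ, j ≤ a + b →
      ((1 + X : R[X]) ^ (a + b - j) * ((X ^ 2) ^ j * (1 + X) ^ (N - a - 1))).coeff a
      = if 2 * j ≤ a then ((b - 1 - j).choose (a - 2 * j) : R) else 0 := by
    intro j hj
    have : (1 + X : R[X]) ^ (a + b - j) * ((X ^ 2) ^ j * (1 + X) ^ (N - a - 1))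
        = (1 + X) ^ ((a + b - j) + (N - a - 1)) * X ^ (2 * j) := by
      rw [pow_add, pow_mul]; ring
    rw [this, coeff_mul_X_pow', coeff_one_add_X_pow]
    split_ifs with h1
    · rw [show a + b - j + (N - a - 1) = (b - 1 - j) + 2 ^ m by omega]
      exact cast _ _ (choose_add_two_pow_nat _ _ _ (by omega))
    · rfl
  simp only [hL] at h
  rw [Finset.sum_eq_single b] at h
  · rw [show a + b - b = a by omega, if_pos rfl, mul_one] at h
    rw [h]
    symm
    trans ∑ j ∈ Finset.range (a / 2 + 1), e j * (if 2 * j ≤ a then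
        ((b - 1 - j).choose (a - 2 * j) : R) else 0)
    · refine Finset.sum_congr rfl fun j hj => ?_
      rw [if_pos (by simp at hj; omega), Algebra.smul_def]
      simp [mul_comm]
    · trans ∑ j ∈ Finset.range (a + b + 1), e j * (if 2 * j ≤ a then
        ((b - 1 - j).choose (a - 2 * j) : R) else 0)
      · refine Finset.sum_subset (fun x hx => by simp at hx ⊢; omega) fun j _ hj => ?_
        rw [if_neg (by simp at hj; omega), mul_zero]
      · refine Finset.sum_congr rfl fun j hj => ?_
        rw [hR j (by simp at hj; omega)]
  · intro j hj hne
    rw [if_neg (by simp at hj; omega), mul_zero]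
  · intro hb; simp at hb

/-- The polynomial ring `𝔽₂[z₀, z₁, z₂]`. -/
abbrev Poly3 : Type := MvPolynomial (Fin 3) (ZMod 2)

theorem poly3_two : (2 : Poly3) = 0 := by
  have : ((2 : ℕ) : Poly3) = 0 := CharP.cast_eq_zero _ 2
  exact_mod_cast this

theorem poly3_add_self (f : Poly3) : f + f = 0 := by
  rw [← two_mul, poly3_two, zero_mul]

/-- The total Steenrod operation, `z ↦ z + z² T` on the generators. -/
def totalSq : Poly3 →ₐ[ZMod 2] Polynomial Poly3 :=
  MvPolynomial.aeval fun i =>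
    Polynomial.C (MvPolynomial.X i) + Polynomial.C (MvPolynomial.X i ^ 2) * Polynomial.X

theorem totalSq_X (i : Fin 3) : totalSq (MvPolynomial.X i) =
    Polynomial.C (MvPolynomial.X i) + Polynomial.C (MvPolynomial.X i ^ 2) * Polynomial.X := by
  simp [totalSq]

/-- The operation `Sq^n` on polynomials. -/
def polySq (n : ℕ) : Module.End (ZMod 2) Poly3 :=
  ((Polynomial.lcoeff Poly3 n).restrictScalars (ZMod 2)).comp totalSq.toLinearMap

theorem polySq_apply (n : ℕ) (f : Poly3) : polySq n f = (totalSq f).coeff n := rfl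

/-- The inclusion of the constants. -/
def constBi : Poly3 →+* Polynomial (Polynomial Poly3) :=
  (Polynomial.C (R := Polynomial Poly3)).comp (Polynomial.C (R := Poly3))

/-- `∑ Sq^a Sq^b f u^a v^b`. -/
def doubleTotal {S : Type} [CommRing S] (ι : Poly3 →+* S) (u v : S) : Poly3 →+* S :=
  (Polynomial.eval₂RingHom ((Polynomial.eval₂RingHom ι u).comp totalSq.toRingHom) v).comp
    totalSq.toRingHom

theorem doubleTotal_X {S : Type} [CommRing S] (ι : Poly3 →+* S) (u v : S) (i : Fin 3) :
    doubleTotal ι u v (MvPolynomial.X i) =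
      (ι (.X i) + ι (.X i) ^ 2 * u) + (ι (.X i) + ι (.X i) ^ 2 * u) ^ 2 * v := by
  simp [doubleTotal, totalSq_X, ← map_pow]
  simp [totalSq_X, Polynomial.eval₂_add, Polynomial.eval₂_mul, Polynomial.eval₂_pow]

theorem doubleTotal_apply {S : Type} [CommRing S] (ι : Poly3 →+* S) (u v : S) (f : Poly3) (N : ℕ)
    (h0 : (totalSq f).natDegree < N) (h1 : ∀ b < N, (totalSq (polySq b f)).natDegree < N) :
    doubleTotal ι u v f = ∑ b ∈ Finset.range N, ∑ a ∈ Finset.range N,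
      ι (polySq a (polySq b f)) * u ^ a * v ^ b := by
  simp only [doubleTotal, RingHom.comp_apply, Polynomial.coe_eval₂RingHom]
  change Polynomial.eval₂ _ v (totalSq f) = _
  rw [Polynomial.eval₂_eq_sum_range' _ h0]
  refine Finset.sum_congr rfl fun b hb => ?_
  rw [← Finset.sum_mul]
  congr 1
  change Polynomial.eval₂ ι u (totalSq (polySq b f)) = _
  rw [Polynomial.eval₂_eq_sum_range' _ (h1 b (by simpa using hb))]
  rfl

theorem doubleTotal_aux (S : Type) [CommRing S] (h2 : (2 : S) = 0) (x y z : S) :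
    (z + z ^ 2 * ((x ^ 2 + x) * y)) + (z + z ^ 2 * ((x ^ 2 + x) * y)) ^ 2 * y
    = (z + z ^ 2 * ((1 + x) * y)) + (z + z ^ 2 * ((1 + x) * y)) ^ 2 * (x ^ 2 * y) := by
  linear_combination (z ^ 3 * (x ^ 2 + x) * y ^ 2 - z ^ 3 * (1 + x) * x ^ 2 * y ^ 2) * h2

open Polynomial in
theorem doubleTotal_eq :
    doubleTotal (S := Poly3[X][X]) constBi (C (X ^ 2 + X) * X) X
      = doubleTotal (S := Poly3[X][X]) constBi (C (1 + X) * X) (C (X ^ 2) * X) := by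
  have h2 : (2 : Poly3[X][X]) = 0 := by
    have : ((2 : ℕ) : Poly3[X][X]) = 0 := CharP.cast_eq_zero _ 2
    exact_mod_cast this
  refine MvPolynomial.ringHom_ext (fun r => ?_) fun i => ?_
  · obtain rfl | rfl : r = 0 ∨ r = 1 := by revert r; decide
    · simp only [map_zero]
    · simp only [map_one]
  · rw [doubleTotal_X, doubleTotal_X]
    simp only [map_add, map_pow, map_one]
    exact doubleTotal_aux _ h2 _ _ _

open Polynomial in
theorem polySq_total (f : Poly3) (n : ℕ) :
    ∑ b ∈ Finset.range (n + 1), C (polySq (n - b) (polySq b f)) * (X ^ 2 + X : Poly3[X]) ^ (n - b)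
    = ∑ b ∈ Finset.range (n + 1), C (polySq (n - b) (polySq b f)) *
        ((1 + X : Poly3[X]) ^ (n - b) * (X ^ 2) ^ b) := by
  obtain ⟨N, hn, h0, h1⟩ : ∃ N, n < N ∧ (totalSq f).natDegree < N ∧
      ∀ b < N, (totalSq (polySq b f)).natDegree < N := by
    set N₀ := max (n + 1) ((totalSq f).natDegree + 1) with hN₀
    set N₁ := (Finset.range N₀).sup fun b => (totalSq (polySq b f)).natDegree + 1
    refine ⟨max N₀ N₁, by omega, by omega, fun b _ => ?_⟩
    by_cases hb : b < N₀
    · have : (totalSq (polySq b f)).natDegree + 1 ≤ N₁ :=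
        Finset.le_sup (f := fun b => (totalSq (polySq b f)).natDegree + 1) (by simpa using hb)
      omega
    · rw [polySq_apply, Polynomial.coeff_eq_zero_of_natDegree_lt (by omega), map_zero,
        natDegree_zero]
      omega
  have key : ∀ (p q : Poly3[X]), (doubleTotal (S := Poly3[X][X]) constBi (C p * X)
      (C q * X) f).coeff n = ∑ b ∈ Finset.range (n + 1),
        C (polySq (n - b) (polySq b f)) * (p ^ (n - b) * q ^ b) := by
    intro p q
    rw [doubleTotal_apply _ _ _ f N h0 h1]
    simp only [finsetSum_coeff]
    have hc : ∀ a b, (constBi (polySq a (polySq b f))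
        * (C p * X) ^ a * (C q * X) ^ b).coeff n
        = if a + b = n then C (polySq a (polySq b f)) * (p ^ a * q ^ b) else 0 := by
      intro a b
      have : constBi (polySq a (polySq b f))
        * (C p * X) ^ a * (C q * X) ^ b =
          C (C (polySq a (polySq b f)) * (p ^ a * q ^ b)) * X ^ (a + b) := by
        simp only [constBi, RingHom.comp_apply, map_mul, map_pow]; ring
      rw [this, coeff_C_mul_X_pow]
      simp only [eq_comm]
    simp only [hc]
    symm
    trans ∑ b ∈ Finset.range (n + 1), ∑ a ∈ Finset.range N,
      if a + b = n then C (polySq a (polySq b f)) * (p ^ a * q ^ b) else 0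
    · refine Finset.sum_congr rfl fun b hb => ?_
      have hb : b < n + 1 := by simpa using hb
      rw [Finset.sum_eq_single (n - b)]
      · rw [if_pos (by omega)]
      · intro a _ ha
        rw [if_neg (by omega)]
      · intro h; simp at h; omega
    · refine Finset.sum_subset (fun x hx => by simp at hx ⊢; omega) fun b _ hb => ?_
      refine Finset.sum_eq_zero fun a _ => ?_
      rw [if_neg (by simp at hb; omega)]
  have h := congrArg (fun F => (F f).coeff n) doubleTotal_eq
  have e : doubleTotal (S := Poly3[X][X]) constBi (C (X ^ 2 + X) * X) X
     = doubleTotal (S := Poly3[X][X]) constBi (C (X ^ 2 + X) * X) (C 1 * X) := by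
    simp
  simp only [e, key, one_pow, mul_one] at h
  exact h

theorem polySq_zero : polySq 0 = 1 := by
  have : (Polynomial.constantCoeff.comp totalSq.toRingHom) = RingHom.id Poly3 := by
    refine MvPolynomial.ringHom_ext (fun r => ?_) fun i => ?_
    · simp
    · simp [totalSq_X]
  refine LinearMap.ext fun f => ?_
  simpa [polySq_apply] using congrArg (fun F : Poly3 →+* Poly3 => F f) this

/-- The action of the Steenrod algebra on `𝔽₂[z₀, z₁, z₂]`. -/
def actPoly : Steenrod →ₐ[ZMod 2] Module.End (ZMod 2) Poly3 :=
  Steenrod.lift polySq (by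
      rintro _ _ (_ | ⟨a, b, ha, hab⟩)
      · simpa using polySq_zero
      · simp only [map_mul, map_sum, map_smul, FreeAlgebra.lift_ι_apply]
        refine LinearMap.ext fun f => ?_
        have := adem_of_total (fun j => polySq (a + b - j) (polySq j f)) a b hab
          (polySq_total f (a + b))
        simpa using this)

theorem actPoly_Sq (n : ℕ) : actPoly (Sq n) = polySq n := by
  unfold actPoly
  rw [Steenrod.lift_Sq]

end SteenrodExt
end

noncomputable section
namespace SteenrodExt

theorem actPoly_mul (x y : Steenrod) (f : Poly3) :
    actPoly (x * y) f = actPoly x (actPoly y f) := by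
  rw [map_mul, Module.End.mul_apply]

theorem polySq_mul (n : ℕ) (f g : Poly3) :
    polySq n (f * g) = ∑ p ∈ Finset.HasAntidiagonal.antidiagonal n, polySq p.1 f * polySq p.2 g := by
  simp only [polySq_apply, map_mul, Polynomial.coeff_mul]

theorem polySq_zero_apply (f : Poly3) : polySq 0 f = f := by rw [polySq_zero]; rfl

theorem polySq_one_mul (f g : Poly3) :
    polySq 1 (f * g) = polySq 1 f * g + f * polySq 1 g := by
  rw [polySq_mul]
  simp [Finset.Nat.antidiagonal_succ, polySq_zero_apply, add_comm]

theorem polySq_two_mul (f g : Poly3) :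
    polySq 2 (f * g) = polySq 2 f * g + polySq 1 f * polySq 1 g + f * polySq 2 g := by
  rw [polySq_mul]
  simp [Finset.Nat.antidiagonal_succ, polySq_zero_apply]
  ring

theorem polySq_four_mul (f g : Poly3) :
    polySq 4 (f * g) = polySq 4 f * g + polySq 3 f * polySq 1 g + polySq 2 f * polySq 2 g
      + polySq 1 f * polySq 3 g + f * polySq 4 g := by
  rw [polySq_mul]
  simp [Finset.Nat.antidiagonal_succ, polySq_zero_apply]
  ring

theorem totalSq_sq (f : Poly3) :
    totalSq (f ^ 2) = Polynomial.expand Poly3 2 (Polynomial.map (frobenius Poly3 2) (totalSq f)) := by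
  rw [map_pow, ← Polynomial.map_expand, Polynomial.map_frobenius_expand]

theorem polySq_two_mul_sq (n : ℕ) (f : Poly3) : polySq (2 * n) (f ^ 2) = polySq n f ^ 2 := by
  rw [polySq_apply, totalSq_sq, mul_comm, Polynomial.coeff_expand_mul (by norm_num),
    Polynomial.coeff_map, frobenius_def]
  rfl

theorem polySq_odd_sq (n : ℕ) (f : Poly3) : polySq (2 * n + 1) (f ^ 2) = 0 := by
  rw [polySq_apply, totalSq_sq, Polynomial.coeff_expand (by norm_num), if_neg (by omega)]

theorem polySq_X (n : ℕ) (i : Fin 3) :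
    polySq (n + 2) (MvPolynomial.X i) = 0 := by
  rw [polySq_apply, totalSq_X]
  simp only [Polynomial.coeff_add, Polynomial.coeff_C_mul, Polynomial.coeff_C_succ,
    Polynomial.coeff_X_of_ne_one (show n + 2 ≠ 1 by omega), mul_zero, add_zero]

theorem polySq_one_X (i : Fin 3) :
    polySq 1 (MvPolynomial.X i) = MvPolynomial.X i ^ 2 := by
  rw [polySq_apply, totalSq_X, Polynomial.coeff_add, Polynomial.coeff_C_mul]
  simp

/-- The action of the Milnor primitive `Q₁`. -/
def polyQ1 : Module.End (ZMod 2) Poly3 := actPoly Q1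

/-- The action of the Milnor primitive `Q₂`. -/
def polyQ2 : Module.End (ZMod 2) Poly3 := actPoly Q2

theorem polyQ1_apply (f : Poly3) :
    polyQ1 f = polySq 1 (polySq 2 f) + polySq 2 (polySq 1 f) := by
  simp [polyQ1, Q1, actPoly_Sq]

theorem polyQ2_apply (f : Poly3) : polyQ2 f = polyQ1 (polySq 4 f) + polySq 4 (polyQ1 f) := by
  simp [polyQ2, polyQ1, Q2, actPoly_Sq]

theorem polyQ1_polySq_one (f : Poly3) : polyQ1 (polySq 1 f) = polySq 1 (polyQ1 f) := by
  have := congrArg (fun x => actPoly x f) rel_Q1_one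
  simpa [actPoly_Sq, polyQ1] using this

theorem polyQ1_polySq_two (f : Poly3) : polyQ1 (polySq 2 f) = polySq 2 (polyQ1 f) := by
  have := congrArg (fun x => actPoly x f) rel_Q1_two
  simpa [actPoly_Sq, polyQ1] using this

theorem polySq_three_apply (f : Poly3) : polySq 3 f = polySq 1 (polySq 2 f) := by
  have := congrArg (fun x => actPoly x f) Sq_three
  simpa [actPoly_Sq] using this

theorem polyQ1_polySq_three (f : Poly3) : polyQ1 (polySq 3 f) = polySq 3 (polyQ1 f) := by
  rw [polySq_three_apply, polySq_three_apply, polyQ1_polySq_one, polyQ1_polySq_two]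

theorem polyQ1_mul (f g : Poly3) : polyQ1 (f * g) = polyQ1 f * g + f * polyQ1 g := by
  simp only [polyQ1_apply, polySq_one_mul, polySq_two_mul, map_add]
  have s1 : ∀ h : Poly3, polySq 1 (polySq 1 h) = 0 := by
    intro h
    have := congrArg (fun x => actPoly x h) Sq_one_one
    simpa [actPoly_Sq] using this
  simp only [s1]
  linear_combination (polySq 1 f * polySq 2 g + polySq 2 f * polySq 1 g) * poly3_two

theorem polyQ2_mul (f g : Poly3) : polyQ2 (f * g) = polyQ2 f * g + f * polyQ2 g := by
  simp only [polyQ2_apply, polyQ1_mul, polySq_four_mul, map_add, polyQ1_polySq_one,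
    polyQ1_polySq_two, polyQ1_polySq_three]
  linear_combination (polyQ1 f * polySq 4 g + polySq 4 f * polyQ1 g
    + polySq 3 (polyQ1 f) * polySq 1 g + polySq 3 f * polySq 1 (polyQ1 g)
    + polySq 1 (polyQ1 f) * polySq 3 g + polySq 1 f * polySq 3 (polyQ1 g)
    + polySq 2 (polyQ1 f) * polySq 2 g + polySq 2 f * polySq 2 (polyQ1 g)) * poly3_two

theorem polySq_one_sq (f : Poly3) : polySq 1 (f ^ 2) = 0 := polySq_odd_sq 0 f

theorem polyQ1_sq (f : Poly3) : polyQ1 (f ^ 2) = 0 := by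
  rw [pow_two, polyQ1_mul, mul_comm, poly3_add_self]

theorem polyQ2_sq (f : Poly3) : polyQ2 (f ^ 2) = 0 := by
  rw [pow_two, polyQ2_mul, mul_comm, poly3_add_self]

theorem polyQ1_X (i : Fin 3) : polyQ1 (MvPolynomial.X i) = (MvPolynomial.X i ^ 2) ^ 2 := by
  rw [polyQ1_apply, polySq_X 0, map_zero, zero_add, polySq_one_X, polySq_two_mul_sq 1,
    polySq_one_X]

theorem polyQ2_X (i : Fin 3) :
    polyQ2 (MvPolynomial.X i) = ((MvPolynomial.X i ^ 2) ^ 2) ^ 2 := by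
  rw [polyQ2_apply, polySq_X 2, map_zero, zero_add, polyQ1_X, polySq_two_mul_sq 2,
    polySq_two_mul_sq 1, polySq_one_X]

/-- The symmetric polynomial `∑ z_a z_b² z_c⁴`. -/
def altPoly : Poly3 :=
  let x : Poly3 := .X 0
  let y : Poly3 := .X 1
  let z : Poly3 := .X 2
  x * y ^ 2 * (z ^ 2) ^ 2 + x * (y ^ 2) ^ 2 * z ^ 2 + x ^ 2 * y * (z ^ 2) ^ 2 + x ^ 2 * (y ^ 2) ^ 2 * z
    + (x ^ 2) ^ 2 * y * z ^ 2 + (x ^ 2) ^ 2 * y ^ 2 * z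

theorem polyQ_top (g : Poly3) :
    polySq 1 (polyQ1 (polyQ2 (.X 0 * .X 1 * .X 2 * g ^ 2))) = (altPoly * g) ^ 2 := by
  simp only [polySq_one_mul, polyQ1_mul, polyQ2_mul, polyQ2_X, polyQ1_X, polySq_one_X, polySq_one_sq,
    polyQ1_sq, polyQ2_sq, map_add, mul_zero, zero_mul, add_zero, zero_add, altPoly, mul_pow, add_pow_two, poly3_two]
  ring

theorem polySq_one_alt : polySq 1 altPoly = 0 := by
  simp only [altPoly, polySq_one_mul, polySq_one_X, polySq_one_sq, map_add, mul_zero, zero_mul,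
    add_zero, zero_add]
  linear_combination (.X 0 ^ 2 * .X 1 ^ 2 * (.X 2 ^ 2) ^ 2 + .X 0 ^ 2 * (.X 1 ^ 2) ^ 2 * .X 2 ^ 2
    + (.X 0 ^ 2) ^ 2 * .X 1 ^ 2 * .X 2 ^ 2 : Poly3) * poly3_two

theorem polySq_two_sq (f : Poly3) : polySq 2 (f ^ 2) = polySq 1 f ^ 2 := polySq_two_mul_sq 1 f

theorem polySq_four_sq (f : Poly3) : polySq 4 (f ^ 2) = polySq 2 f ^ 2 := polySq_two_mul_sq 2 f

theorem polySq_two_X (i : Fin 3) : polySq 2 (MvPolynomial.X i) = 0 := polySq_X 0 i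

theorem polySq_two_alt : polySq 2 altPoly = 0 := by
  simp only [altPoly, polySq_two_mul, polySq_one_mul, polySq_one_X, polySq_two_X, polySq_two_sq,
    polySq_one_sq, map_add, mul_zero, zero_mul, add_zero, zero_add, zero_pow two_ne_zero]
  linear_combination (.X 0 * (.X 1 ^ 2) ^ 2 * (.X 2 ^ 2) ^ 2 + (.X 0 ^ 2) ^ 2 * .X 1 * (.X 2 ^ 2) ^ 2
    + (.X 0 ^ 2) ^ 2 * (.X 1 ^ 2) ^ 2 * .X 2 : Poly3) * poly3_two

theorem polySq_alt_mul (g : Poly3) :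
    polySq 4 (polySq 2 (polySq 4 (polySq 2 ((altPoly * g) ^ 2)))) =
      (altPoly * polySq 2 (polySq 1 (polySq 2 (polySq 1 g)))) ^ 2 := by
  simp only [polySq_two_sq, polySq_four_sq, polySq_two_mul, polySq_one_mul, polySq_one_alt,
    polySq_two_alt, zero_mul, zero_add]

theorem polySq_test : polySq 2 (polySq 1 (polySq 2 (polySq 1
    ((MvPolynomial.X 0 : Poly3) * .X 0 ^ 2 * .X 1)))) =
      ((.X 0 ^ 2) ^ 2) ^ 2 * .X 1 ^ 2 + .X 0 ^ 2 * (.X 0 ^ 2) ^ 2 * (.X 1 ^ 2) ^ 2 := by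
  simp only [polySq_two_mul, polySq_one_mul, polySq_one_X, polySq_two_X, polySq_two_sq,
    polySq_one_sq, map_add, mul_zero, zero_mul, add_zero, zero_add, zero_pow two_ne_zero]
  linear_combination (2 * .X 0 ^ 6 * .X 1 ^ 4 + .X 0 ^ 8 * .X 1 ^ 2 : Poly3) * poly3_two

/-- A specialization of the polynomial ring to one variable, used to detect nonzero elements. -/
def specialize : Poly3 →ₐ[ZMod 2] Polynomial (ZMod 2) :=
  MvPolynomial.aeval ![Polynomial.X, Polynomial.X ^ 10, Polynomial.X ^ 100]

theorem altPoly_ne_zero : altPoly ≠ 0 := by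
  intro h
  have := congrArg (fun p => (specialize p).coeff 421) h
  simp [altPoly, specialize, ← pow_mul, ← pow_add, ← pow_succ', Polynomial.coeff_X_pow] at this

theorem polySq_test_ne_zero : polySq 2 (polySq 1 (polySq 2 (polySq 1
    ((MvPolynomial.X 0 : Poly3) * .X 0 ^ 2 * .X 1)))) ≠ 0 := by
  rw [polySq_test]
  intro h
  have := congrArg (fun p => (specialize p).coeff 28) h
  simp [specialize, ← pow_mul, ← pow_add, Polynomial.coeff_X_pow] at this

theorem A2_top_ne_zero : Sq 4 * (Sq 2 * (Sq 4 * (Sq 2 * (Sq 1 * (Q1 * Q2))))) ≠ 0 := by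
  intro h
  have := congrArg (fun x => actPoly x (.X 0 * .X 1 * .X 2 * (.X 0 * .X 0 ^ 2 * .X 1) ^ 2)) h
  simp only [actPoly_mul, actPoly_Sq, map_zero, LinearMap.zero_apply] at this
  change polySq 4 (polySq 2 (polySq 4 (polySq 2 (polySq 1 (polyQ1 (polyQ2 _)))))) = 0 at this
  rw [polyQ_top, polySq_alt_mul] at this
  exact mul_ne_zero altPoly_ne_zero polySq_test_ne_zero (pow_eq_zero_iff two_ne_zero |>.1 this)

end SteenrodExt
end

noncomputable section
namespace SteenrodExt

/-! ### Two elements satisfying the relations of `A_1` -/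

/-- The relations between `Sq^1` and `Sq^2`. -/
structure A1Rel {S : Type} [Ring S] (u v : S) : Prop where
  sq_left : u * u = 0
  sq_right : v * v = u * (v * u)

/-- The monomials `1, u, v, uv, vu, uvu, vuv, uvuv`. -/
def word8 {S : Type} [Ring S] (u v : S) : Fin 8 → S :=
  ![1, u, v, u * v, v * u, u * (v * u), v * (u * v), u * (v * (u * v))]

/-- The degrees of the monomials `1, u, v, uv, vu, uvu, vuv, uvuv` for `|u| = 1` and `|v| = 2`. -/
def deg8 : Fin 8 → ℤ := ![0, 1, 2, 3, 3, 4, 5, 6]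

/-- Left multiplication by `u` on the eight monomials. -/
def left8u : Fin 8 → Option (Fin 8) := ![some 1, none, some 3, none, some 5, none, some 7, none]

/-- Left multiplication by `v` on the eight monomials. -/
def left8v : Fin 8 → Option (Fin 8) :=
  ![some 2, some 4, some 5, some 6, none, some 7, none, none]

/-- The monomial with a given index, or zero. -/
def optWord8 {S : Type} [Ring S] (u v : S) : Option (Fin 8) → S
  | none => 0
  | some j => word8 u v j

/-- The complementary monomials, which pair `word8` to the top monomial. -/
def dual8 {S : Type} [Ring S] (u v : S) : Fin 8 → S :=
  ![u * (v * (u * v)), v * (u * v), u * (v * u), u * v, v * u, v, u, 1]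

namespace A1Rel

variable {S : Type} [Ring S] {u v : S}

theorem sq_left_assoc (h : A1Rel u v) (x : S) : u * (u * x) = 0 := by
  rw [← mul_assoc, h.sq_left, zero_mul]

theorem sq_right_assoc (h : A1Rel u v) (x : S) : v * (v * x) = u * (v * (u * x)) := by
  rw [← mul_assoc, h.sq_right, mul_assoc, mul_assoc]

theorem braid (h : A1Rel u v) : v * (u * (v * u)) = u * (v * (u * v)) := by
  rw [← h.sq_right, ← mul_assoc, h.sq_right, mul_assoc, mul_assoc]

theorem braid_assoc (h : A1Rel u v) (x : S) :
    v * (u * (v * (u * x))) = u * (v * (u * (v * x))) := by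
  have := congrArg (· * x) h.braid
  simpa only [mul_assoc] using this

theorem mul_word8_left (h : A1Rel u v) (j : Fin 8) :
    u * word8 u v j = optWord8 u v (left8u j) := by
  fin_cases j <;> simp [word8, left8u, optWord8, h.sq_left, h.sq_left_assoc]

theorem mul_word8_right (h : A1Rel u v) (j : Fin 8) :
    v * word8 u v j = optWord8 u v (left8v j) := by
  fin_cases j <;> simp [word8, left8v, optWord8, h.sq_left, h.sq_left_assoc, h.sq_right,
    h.sq_right_assoc, h.braid, h.braid_assoc]

theorem word8_mul_dual8 (h : A1Rel u v) (i : Fin 8) :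
    word8 u v i * dual8 u v i = word8 u v 7 := by
  fin_cases i <;> simp [word8, dual8, mul_assoc, h.braid]

theorem word8_mul_dual8_of_lt (h : A1Rel u v) (i j : Fin 8) (hij : i < j) :
    word8 u v j * dual8 u v i = 0 := by
  fin_cases i <;> fin_cases j <;> first
    | exact absurd hij (by decide)
    | simp [word8, dual8, mul_assoc, h.sq_left, h.sq_left_assoc, h.sq_right,
        h.sq_right_assoc, h.braid, h.braid_assoc]

end A1Rel

theorem Sq_A1Rel : A1Rel (Sq 1) (Sq 2) := ⟨Sq_one_one, by rw [Sq_two_two, mul_assoc]⟩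

/-! ### A basis of `A_2` -/

/-- The subalgebra generated by `Sq^1`, `Sq^2` and the Milnor primitive `Q_2`. -/
def subD : Subalgebra (ZMod 2) Steenrod := Algebra.adjoin (ZMod 2) {Sq 1, Sq 2, Q2}

/-- The basis `w Q_2^c` of `subD`, `w` one of the eight monomials in `Sq^1`, `Sq^2`. -/
def dVec (i : Fin 8 × Fin 2) : Steenrod := word8 (Sq 1) (Sq 2) i.1 * Q2 ^ (i.2 : ℕ)

/-- The degree of `dVec i`. -/
def dDeg (i : Fin 8 × Fin 2) : ℤ := deg8 i.1 + 7 * (i.2 : ℕ)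

/-- The basis `1, Sq^4, Sq^2 Sq^4, Sq^4 Sq^2 Sq^4` of `A_2` as a right `subD`-module. -/
def bVec : Fin 4 → Steenrod := ![1, Sq 4, Sq 2 * Sq 4, Sq 4 * (Sq 2 * Sq 4)]

/-- The degree of `bVec k`. -/
def bDeg : Fin 4 → ℤ := ![0, 4, 6, 10]

/-- The basis of `A_2`. -/
def aVec (i : Fin 4 × Fin 8 × Fin 2) : Steenrod := bVec i.1 * dVec i.2

/-- The degree of `aVec i`. -/
def aDeg (i : Fin 4 × Fin 8 × Fin 2) : ℤ := bDeg i.1 + dDeg i.2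

theorem mul_mem_homog_of_eq {c d e : ℤ} (h : c + d = e) {x y : Steenrod} (hx : x ∈ homog c)
    (hy : y ∈ homog d) : x * y ∈ homog e := h ▸ mul_mem_homog hx hy

theorem Sq_one_mem_homog : Sq 1 ∈ homog 1 := by simpa using Sq_mem_homog 1
theorem Sq_two_mem_homog : Sq 2 ∈ homog 2 := by simpa using Sq_mem_homog 2
theorem Sq_four_mem_homog : Sq 4 ∈ homog 4 := by simpa using Sq_mem_homog 4

theorem Q1_mem_homog : Q1 ∈ homog 3 :=
  add_mem (mul_mem_homog_of_eq (by norm_num) Sq_one_mem_homog Sq_two_mem_homog)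
    (mul_mem_homog_of_eq (by norm_num) Sq_two_mem_homog Sq_one_mem_homog)

theorem Q2_mem_homog : Q2 ∈ homog 7 :=
  add_mem (mul_mem_homog_of_eq (by norm_num) Q1_mem_homog Sq_four_mem_homog)
    (mul_mem_homog_of_eq (by norm_num) Sq_four_mem_homog Q1_mem_homog)

theorem word8_mem_homog (j : Fin 8) : word8 (Sq 1) (Sq 2) j ∈ homog (deg8 j) := by
  have h1 := Sq_one_mem_homog
  have h2 := Sq_two_mem_homog
  have h12 : Sq 1 * Sq 2 ∈ homog 3 := mul_mem_homog_of_eq (by norm_num) h1 h2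
  have h21 : Sq 2 * Sq 1 ∈ homog 3 := mul_mem_homog_of_eq (by norm_num) h2 h1
  have h212 : Sq 2 * (Sq 1 * Sq 2) ∈ homog 5 := mul_mem_homog_of_eq (by norm_num) h2 h12
  fin_cases j <;> simp only [word8, deg8]
  · exact one_mem_homog
  · exact h1
  · exact h2
  · exact h12
  · exact h21
  · exact mul_mem_homog_of_eq (c := 1) (d := 3) (e := 4) (by norm_num) h1 h21
  · exact h212
  · exact mul_mem_homog_of_eq (c := 1) (d := 5) (e := 6) (by norm_num) h1 h212

theorem Q2_pow_mem_homog (c : Fin 2) : Q2 ^ (c : ℕ) ∈ homog (7 * (c : ℕ)) := by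
  fin_cases c
  · simpa using one_mem_homog
  · simpa using Q2_mem_homog

theorem dVec_mem_homog (i : Fin 8 × Fin 2) : dVec i ∈ homog (dDeg i) :=
  mul_mem_homog (word8_mem_homog _) (Q2_pow_mem_homog _)

theorem bVec_mem_homog (k : Fin 4) : bVec k ∈ homog (bDeg k) := by
  have h4 := Sq_four_mem_homog
  have h24 : Sq 2 * Sq 4 ∈ homog 6 := mul_mem_homog_of_eq (by norm_num) Sq_two_mem_homog h4
  fin_cases k <;> simp only [bVec, bDeg]
  · exact one_mem_homog
  · exact h4
  · exact h24
  · exact mul_mem_homog_of_eq (c := 4) (d := 6) (e := 10) (by norm_num) h4 h24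

theorem aVec_mem_homog (i : Fin 4 × Fin 8 × Fin 2) : aVec i ∈ homog (aDeg i) :=
  mul_mem_homog (bVec_mem_homog _) (dVec_mem_homog _)

theorem Sq_one_mem_D : Sq 1 ∈ subD := Algebra.subset_adjoin (by simp)
theorem Sq_two_mem_D : Sq 2 ∈ subD := Algebra.subset_adjoin (by simp)
theorem Q2_mem_D : Q2 ∈ subD := Algebra.subset_adjoin (by simp)
theorem Q1_mem_D : Q1 ∈ subD :=
  add_mem (mul_mem Sq_one_mem_D Sq_two_mem_D) (mul_mem Sq_two_mem_D Sq_one_mem_D)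

theorem Sq_one_mem_A1 : Sq 1 ∈ A1 := Algebra.subset_adjoin (by simp)
theorem Sq_two_mem_A1 : Sq 2 ∈ A1 := Algebra.subset_adjoin (by simp)
theorem Sq_four_mem_A2 : Sq 4 ∈ A2 := Algebra.subset_adjoin (by simp)

theorem Q1_mem_A1 : Q1 ∈ A1 :=
  add_mem (mul_mem Sq_one_mem_A1 Sq_two_mem_A1) (mul_mem Sq_two_mem_A1 Sq_one_mem_A1)

theorem Q2_mem_A2 : Q2 ∈ A2 :=
  add_mem (mul_mem (A1_le_A2 Q1_mem_A1) Sq_four_mem_A2)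
    (mul_mem Sq_four_mem_A2 (A1_le_A2 Q1_mem_A1))

theorem A1_le_D : A1 ≤ subD := by
  refine Algebra.adjoin_le ?_
  rintro _ (rfl | rfl)
  exacts [Sq_one_mem_D, Sq_two_mem_D]

theorem D_le_A2 : subD ≤ A2 := by
  refine Algebra.adjoin_le ?_
  rintro _ (rfl | rfl | rfl)
  exacts [A1_le_A2 Sq_one_mem_A1, A1_le_A2 Sq_two_mem_A1, Q2_mem_A2]

theorem word8_mem_A1 (j : Fin 8) : word8 (Sq 1) (Sq 2) j ∈ A1 := by
  have h1 := Sq_one_mem_A1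
  have h2 := Sq_two_mem_A1
  fin_cases j
  exacts [one_mem _, h1, h2, mul_mem h1 h2, mul_mem h2 h1, mul_mem h1 (mul_mem h2 h1),
    mul_mem h2 (mul_mem h1 h2), mul_mem h1 (mul_mem h2 (mul_mem h1 h2))]

theorem dVec_mem_D (i : Fin 8 × Fin 2) : dVec i ∈ subD :=
  mul_mem (A1_le_D (word8_mem_A1 _)) (pow_mem Q2_mem_D _)

theorem bVec_mem_A2 (k : Fin 4) : bVec k ∈ A2 := by
  have h2 := A1_le_A2 Sq_two_mem_A1
  have h4 := Sq_four_mem_A2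
  fin_cases k
  exacts [one_mem _, h4, mul_mem h2 h4, mul_mem h4 (mul_mem h2 h4)]

/-- A subspace containing `1` and closed under left multiplication by generators is everything. -/
theorem adjoin_le_of_mul_mem {G : Set Steenrod} (T : Submodule (ZMod 2) Steenrod)
    (h1 : (1 : Steenrod) ∈ T) (hT : ∀ g ∈ G, ∀ x ∈ T, g * x ∈ T) {x : Steenrod}
    (hx : x ∈ Algebra.adjoin (ZMod 2) G) : x ∈ T := by
  have : ∀ y ∈ T, x * y ∈ T := by
    induction hx using Algebra.adjoin_induction with
    | mem g hg => exact hT g hg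
    | algebraMap r => intro y hy; rw [← Algebra.smul_def]; exact T.smul_mem _ hy
    | add a b _ _ ha hb => intro y hy; rw [add_mul]; exact add_mem (ha y hy) (hb y hy)
    | mul a b _ _ ha hb => intro y hy; rw [mul_assoc]; exact ha _ (hb y hy)
  simpa using this 1 h1

theorem mul_mem_span_of {V : Set Steenrod} {T : Submodule (ZMod 2) Steenrod} (g : Steenrod)
    (h : ∀ v ∈ V, g * v ∈ T) (x : Steenrod) (hx : x ∈ Submodule.span (ZMod 2) V) : g * x ∈ T := by
  have : Submodule.span (ZMod 2) V ≤ T.comap (LinearMap.mulLeft (ZMod 2) g) :=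
    Submodule.span_le.2 h
  exact this hx

theorem A1_le_span {x : Steenrod} (hx : x ∈ A1) :
    x ∈ Submodule.span (ZMod 2) (Set.range (word8 (Sq 1) (Sq 2))) := by
  have ho : ∀ o, optWord8 (Sq 1) (Sq 2) o ∈
      Submodule.span (ZMod 2) (Set.range (word8 (Sq 1) (Sq 2))) := by
    rintro (_ | j)
    · exact zero_mem _
    · exact Submodule.subset_span ⟨j, rfl⟩
  refine adjoin_le_of_mul_mem (G := {Sq 1, Sq 2})
    (Submodule.span (ZMod 2) (Set.range (word8 (Sq 1) (Sq 2)))) (Submodule.subset_span ⟨0, rfl⟩) ?_ hx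
  rintro _ (rfl | rfl)
  · refine mul_mem_span_of _ ?_
    rintro _ ⟨j, rfl⟩
    rw [Sq_A1Rel.mul_word8_left]
    exact ho _
  · refine mul_mem_span_of _ ?_
    rintro _ ⟨j, rfl⟩
    rw [Sq_A1Rel.mul_word8_right]
    exact ho _

theorem commute_Q2 {x : Steenrod} (hx : x ∈ A2) : Q2 * x = x * Q2 := by
  induction hx using Algebra.adjoin_induction with
  | mem g hg =>
    rcases hg with rfl | rfl | rfl
    exacts [rel_Q2_one, rel_Q2_two, rel_Q2_four]
  | algebraMap r => exact (Algebra.commutes r Q2).symm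
  | add a b _ _ ha hb => rw [mul_add, ha, hb, add_mul]
  | mul a b _ _ ha hb => rw [← mul_assoc, ha, mul_assoc, hb, mul_assoc]

theorem D_le_span {x : Steenrod} (hx : x ∈ subD) :
    x ∈ Submodule.span (ZMod 2) (Set.range dVec) := by
  have ho : ∀ o (c : Fin 2), optWord8 (Sq 1) (Sq 2) o * Q2 ^ (c : ℕ) ∈
      Submodule.span (ZMod 2) (Set.range dVec) := by
    rintro (_ | j) c
    · simp [optWord8]
    · exact Submodule.subset_span ⟨(j, c), rfl⟩
  refine adjoin_le_of_mul_mem (G := {Sq 1, Sq 2, Q2}) (Submodule.span (ZMod 2) (Set.range dVec))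
    (Submodule.subset_span ⟨(0, 0), by simp [dVec, word8]⟩) ?_ hx
  rintro _ (rfl | rfl | rfl)
  · refine mul_mem_span_of _ ?_
    rintro _ ⟨j, rfl⟩
    rw [dVec, ← mul_assoc, Sq_A1Rel.mul_word8_left]
    exact ho _ _
  · refine mul_mem_span_of _ ?_
    rintro _ ⟨j, rfl⟩
    rw [dVec, ← mul_assoc, Sq_A1Rel.mul_word8_right]
    exact ho _ _
  · refine mul_mem_span_of _ ?_
    rintro _ ⟨⟨j, c⟩, rfl⟩
    rw [dVec, ← mul_assoc, commute_Q2 (A1_le_A2 (word8_mem_A1 _)), mul_assoc]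
    fin_cases c
    · exact Submodule.subset_span ⟨(j, 1), by simp [dVec]⟩
    · simp [rel_Q2_Q2]

/-- The sum of the `b_k D`. -/
def sumBD : Submodule (ZMod 2) Steenrod :=
  Submodule.span (ZMod 2) {x | ∃ k, ∃ d ∈ subD, x = bVec k * d}

theorem bVec_mul_mem (k : Fin 4) {d : Steenrod} (hd : d ∈ subD) : bVec k * d ∈ sumBD :=
  Submodule.subset_span ⟨k, d, hd, rfl⟩

theorem sumBD_mul_mem {x d : Steenrod} (hx : x ∈ sumBD) (hd : d ∈ subD) : x * d ∈ sumBD := by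
  have : sumBD ≤ sumBD.comap (LinearMap.mulRight (ZMod 2) d) := by
    refine Submodule.span_le.2 ?_
    rintro _ ⟨k, d', hd', rfl⟩
    simp only [Submodule.comap_coe, Set.mem_preimage, LinearMap.mulRight_apply, SetLike.mem_coe,
      mul_assoc]
    exact bVec_mul_mem k (mul_mem hd' hd)
  exact this hx

attribute [local simp] mul_add add_mul mul_assoc steenrod_two steenrod_four steenrod_add_self
  Sq_one_one rel_one_two rel_one_four rel_Q1_one rel_Q1_two rel_Q1_four rel_Q1_Q1 rel_two_two
  Sq_one_one_assoc rel_one_two_assoc rel_one_four_assoc rel_Q1_one_assoc rel_Q1_two_assoc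
  rel_Q1_four_assoc rel_Q1_Q1_assoc rel_two_two_assoc
  rel_Q2_one rel_Q2_Q1 rel_four_four rel_Q2_two rel_Q2_four rel_two_four_two_four rel_Q2_Q2
  rel_Q2_one_assoc rel_Q2_Q1_assoc rel_four_four_assoc rel_Q2_two_assoc rel_Q2_four_assoc
  rel_two_four_two_four_assoc rel_Q2_Q2_assoc

theorem one_mul_b_two : Sq 1 * bVec 2 = bVec 2 * Sq 1 + bVec 1 * Q1 + bVec 0 * Q2 := by
  apply steenrod_eq_of_add
  simp [bVec]
  abel_nf
  simp

theorem one_mul_b_three : Sq 1 * bVec 3 =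
    bVec 3 * Sq 1 + bVec 2 * (Sq 2 * Q1) + bVec 1 * Q2 + bVec 0 * (Sq 1 * (Q1 * Q2)) := by
  apply steenrod_eq_of_add
  simp [bVec]
  abel_nf
  simp

theorem two_mul_b_two : Sq 2 * bVec 2 = bVec 1 * (Sq 1 * Q1) + bVec 0 * (Sq 1 * Q2) := by
  apply steenrod_eq_of_add
  simp [bVec]

theorem two_mul_b_three : Sq 2 * bVec 3 =
    bVec 3 * Sq 2 + bVec 1 * (Sq 1 * Q2) + bVec 0 * (Sq 2 * (Q1 * Q2)) := by
  apply steenrod_eq_of_add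
  simp [bVec]

theorem four_mul_b_one : Sq 4 * bVec 1 =
    bVec 2 * Sq 2 + bVec 1 * (Sq 1 * Q1) + bVec 0 * (Sq 1 * Q2) := by
  simp [bVec]

theorem four_mul_b_three : Sq 4 * bVec 3 =
    bVec 3 * (Sq 1 * Q1) + bVec 1 * (Sq 1 * (Sq 2 * Q2)) := by
  apply steenrod_eq_of_add
  simp [bVec]
  abel_nf
  simp

theorem word8_top : word8 (Sq 1) (Sq 2) 7 = Sq 2 * (Sq 1 * Q1) := by
  apply steenrod_eq_of_add
  simp [word8]

theorem gen_mul_b_mem (n : ℕ) (hn : n = 1 ∨ n = 2 ∨ n = 4) (k : Fin 4) : Sq n * bVec k ∈ sumBD := by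
  have b := @bVec_mul_mem
  have b0 := fun {d} (hd : d ∈ subD) => b 0 hd
  have h1 := Sq_one_mem_D
  have h2 := Sq_two_mem_D
  have p1 := Q1_mem_D
  have p2 := Q2_mem_D
  have e0 : bVec 0 = 1 := rfl
  have e1 : bVec 1 = Sq 4 := rfl
  rcases hn with rfl | rfl | rfl <;> fin_cases k
  · simpa [e0] using b 0 h1
  · have : Sq 1 * bVec 1 = bVec 1 * Sq 1 + bVec 0 * (Sq 2 * Q1) := by simp [e0, e1]
    exact this ▸ add_mem (b 1 h1) (b 0 (mul_mem h2 p1))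
  · exact one_mul_b_two ▸ add_mem (add_mem (b 2 h1) (b 1 p1)) (b 0 p2)
  · exact one_mul_b_three ▸ add_mem (add_mem (add_mem (b 3 h1) (b 2 (mul_mem h2 p1))) (b 1 p2))
      (b 0 (mul_mem h1 (mul_mem p1 p2)))
  · simpa [e0] using b 0 h2
  · simpa [bVec] using b 2 (one_mem _)
  · exact two_mul_b_two ▸ add_mem (b 1 (mul_mem h1 p1)) (b 0 (mul_mem h1 p2))
  · exact two_mul_b_three ▸ add_mem (add_mem (b 3 h2) (b 1 (mul_mem h1 p2)))
      (b 0 (mul_mem h2 (mul_mem p1 p2)))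
  · simpa [e0, e1] using b 1 (one_mem _)
  · exact four_mul_b_one ▸ add_mem (add_mem (b 2 h2) (b 1 (mul_mem h1 p1))) (b 0 (mul_mem h1 p2))
  · simpa [bVec] using b 3 (one_mem _)
  · exact four_mul_b_three ▸ add_mem (b 3 (mul_mem h1 p1)) (b 1 (mul_mem h1 (mul_mem h2 p2)))

theorem A2_le_sumBD {x : Steenrod} (hx : x ∈ A2) : x ∈ sumBD := by
  have key : ∀ n : ℕ, (n = 1 ∨ n = 2 ∨ n = 4) → ∀ x ∈ sumBD, Sq n * x ∈ sumBD := by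
    intro n hn
    refine mul_mem_span_of _ ?_
    rintro _ ⟨k, d, hd, rfl⟩
    rw [← mul_assoc]
    exact sumBD_mul_mem (gen_mul_b_mem n hn k) hd
  refine adjoin_le_of_mul_mem (G := {Sq 1, Sq 2, Sq 4}) _ (by simpa [bVec] using bVec_mul_mem 0 (one_mem _)) ?_ hx
  rintro _ (rfl | rfl | rfl)
  exacts [key 1 (by simp), key 2 (by simp), key 4 (by simp)]

theorem A2_le_span {x : Steenrod} (hx : x ∈ A2) :
    x ∈ Submodule.span (ZMod 2) (Set.range aVec) := by
  have : sumBD ≤ Submodule.span (ZMod 2) (Set.range aVec) := by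
    refine Submodule.span_le.2 ?_
    rintro _ ⟨k, d, hd, rfl⟩
    refine mul_mem_span_of _ ?_ _ (D_le_span hd)
    rintro _ ⟨i, rfl⟩
    exact Submodule.subset_span ⟨(k, i), rfl⟩
  exact this (A2_le_sumBD hx)

theorem bVec_mul_top_ne_zero (k : Fin 4) : bVec k * (word8 (Sq 1) (Sq 2) 7 * Q2) ≠ 0 := by
  have h3 : bVec 3 * (word8 (Sq 1) (Sq 2) 7 * Q2) ≠ 0 := by
    rw [word8_top]
    have := A2_top_ne_zero
    change Sq 4 * (Sq 2 * Sq 4) * _ ≠ 0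
    simpa only [mul_assoc] using this
  fin_cases k
  · intro h
    have h' : word8 (Sq 1) (Sq 2) 7 * Q2 = 0 := by
      change 1 * _ = 0 at h
      rwa [one_mul] at h
    rw [h', mul_zero] at h3
    exact h3 rfl
  · intro h
    have h' : Sq 4 * (word8 (Sq 1) (Sq 2) 7 * Q2) = 0 := h
    apply h3
    change Sq 4 * (Sq 2 * Sq 4) * (word8 (Sq 1) (Sq 2) 7 * Q2) = 0
    rw [mul_assoc, mul_assoc, h', mul_zero, mul_zero]
  · intro h
    have h' : Sq 2 * Sq 4 * (word8 (Sq 1) (Sq 2) 7 * Q2) = 0 := h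
    apply h3
    change Sq 4 * (Sq 2 * Sq 4) * (word8 (Sq 1) (Sq 2) 7 * Q2) = 0
    rw [mul_assoc, h', mul_zero]
  · exact h3

theorem top_independent (μ : Fin 4 → ZMod 2)
    (h : ∑ k, μ k • (bVec k * (word8 (Sq 1) (Sq 2) 7 * Q2)) = 0) : μ = 0 := by
  funext l
  have hm : ∀ k, bVec k * (word8 (Sq 1) (Sq 2) 7 * Q2) ∈ homog (bDeg k + 13) := fun k =>
    mul_mem_homog (bVec_mem_homog k) (mul_mem_homog_of_eq (c := 6) (by norm_num)
      (word8_mem_homog 7) Q2_mem_homog)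
  have := congrArg (component (bDeg l + 13)) h
  rw [map_sum, Finset.sum_eq_single l, map_zero, map_smul, component_of_mem (hm l)] at this
  · exact (smul_eq_zero.1 this).resolve_right (bVec_mul_top_ne_zero l)
  · intro k _ hk
    rw [map_smul, component_of_mem_ne _ (hm k), smul_zero]
    have : ∀ k l : Fin 4, k ≠ l → bDeg l + 13 ≠ bDeg k + 13 := by decide
    exact this k l hk
  · simp

theorem word_independent (μ : Fin 4 → Fin 8 → ZMod 2)
    (h : ∑ k, ∑ j, μ k j • (bVec k * (word8 (Sq 1) (Sq 2) j * Q2)) = 0) (j : Fin 8) :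
    ∀ k, μ k j = 0 := by
  induction j using WellFoundedLT.induction with
  | _ i ih =>
    have h' := congrArg (· * dual8 (Sq 1) (Sq 2) i) h
    have hd : dual8 (Sq 1) (Sq 2) i ∈ A2 := by
      have h1 := A1_le_A2 Sq_one_mem_A1
      have h2 := A1_le_A2 Sq_two_mem_A1
      fin_cases i
      exacts [mul_mem h1 (mul_mem h2 (mul_mem h1 h2)), mul_mem h2 (mul_mem h1 h2),
        mul_mem h1 (mul_mem h2 h1), mul_mem h1 h2, mul_mem h2 h1, h2, h1, one_mem _]
    simp only [zero_mul, Finset.sum_mul, smul_mul_assoc, mul_assoc, commute_Q2 hd] at h'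
    have hz : ∀ k j, j ≠ i →
        μ k j • (bVec k * (word8 (Sq 1) (Sq 2) j * (dual8 (Sq 1) (Sq 2) i * Q2))) = 0 := by
      intro k j hj
      rcases lt_or_gt_of_ne hj with hj | hj
      · rw [ih j hj k, zero_smul]
      · rw [← mul_assoc (word8 _ _ _), Sq_A1Rel.word8_mul_dual8_of_lt i j hj, zero_mul, mul_zero,
          smul_zero]
    have h'' : ∀ k, ∑ j, μ k j • (bVec k * (word8 (Sq 1) (Sq 2) j * (dual8 (Sq 1) (Sq 2) i * Q2)))
        = μ k i • (bVec k * (word8 (Sq 1) (Sq 2) 7 * Q2)) := by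
      intro k
      rw [Finset.sum_eq_single i (fun j _ hj => hz k j hj) (by simp),
        ← mul_assoc (word8 _ _ _), Sq_A1Rel.word8_mul_dual8]
    simp only [h''] at h'
    exact fun k => congrFun (top_independent (fun k => μ k i) h') k

theorem aVec_independent : LinearIndependent (ZMod 2) aVec := by
  rw [Fintype.linearIndependent_iff]
  intro g hg
  simp only [Fintype.sum_prod_type, aVec, dVec, Fin.sum_univ_two, Fin.val_zero, Fin.val_one, pow_zero, pow_one,
    mul_one] at hg
  have h0 : ∀ j k, g (k, j, 0) = 0 := by
    refine fun j => word_independent (fun k j => g (k, j, 0)) ?_ j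
    have := congrArg (· * Q2) hg
    simp only [zero_mul, Finset.sum_mul, add_mul, smul_mul_assoc, mul_assoc, rel_Q2_Q2, mul_zero, smul_zero, add_zero] at this
    exact this
  have h1 : ∀ j k, g (k, j, 1) = 0 := by
    refine fun j => word_independent (fun k j => g (k, j, 1)) ?_ j
    simpa only [h0, zero_smul, zero_add] using hg
  rintro ⟨k, j, c⟩
  fin_cases c
  exacts [h0 j k, h1 j k]

end SteenrodExt
end

noncomputable section
namespace SteenrodExt

/-! ### Coordinates on `A_2` and on `subD` -/

theorem exists_coeff : ∃ c : Fin 4 × Fin 8 × Fin 2 → (Steenrod →ₗ[ZMod 2] ZMod 2),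
    ∀ i j, c i (aVec j) = if i = j then 1 else 0 := by
  obtain ⟨g, hg⟩ := LinearMap.exists_leftInverse_of_injective
    (Finsupp.linearCombination (ZMod 2) aVec)
    (LinearMap.ker_eq_bot_of_injective aVec_independent)
  refine ⟨fun i => Finsupp.lapply i ∘ₗ g, fun i j => ?_⟩
  have := congrArg (fun f => f (Finsupp.single j 1)) hg
  simp only [LinearMap.comp_apply, Finsupp.linearCombination_single, one_smul,
    LinearMap.id_apply] at this
  rw [LinearMap.comp_apply, this, Finsupp.lapply_apply, Finsupp.single_apply]
  simp only [eq_comm]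

/-- The coordinates with respect to `aVec`. -/
def coeffA : Fin 4 × Fin 8 × Fin 2 → (Steenrod →ₗ[ZMod 2] ZMod 2) := exists_coeff.choose

theorem coeffA_aVec (i j : Fin 4 × Fin 8 × Fin 2) : coeffA i (aVec j) = if i = j then 1 else 0 :=
  exists_coeff.choose_spec i j

theorem aVec_zero (i : Fin 8 × Fin 2) : aVec (0, i) = dVec i := by
  change 1 * dVec i = dVec i
  rw [one_mul]

theorem coeffA_dVec (i j : Fin 8 × Fin 2) : coeffA (0, i) (dVec j) = if i = j then 1 else 0 := by
  rw [← aVec_zero, coeffA_aVec]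
  simp

/-- Two linear maps which agree on the basis of `A_2` agree on `A_2`. -/
theorem A2_linear_ext {V : Type} [AddCommGroup V] [Module (ZMod 2) V]
    {f g : Steenrod →ₗ[ZMod 2] V} (h : ∀ i, f (aVec i) = g (aVec i)) {x : Steenrod} (hx : x ∈ A2) :
    f x = g x := by
  have : Submodule.span (ZMod 2) (Set.range aVec) ≤ LinearMap.eqLocus f g :=
    Submodule.span_le.2 (by rintro _ ⟨i, rfl⟩; exact h i)
  exact this (A2_le_span hx)

/-- Two linear maps which agree on the basis of `subD` agree on `subD`. -/
theorem D_linear_ext {V : Type} [AddCommGroup V] [Module (ZMod 2) V]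
    {f g : Steenrod →ₗ[ZMod 2] V} (h : ∀ i, f (dVec i) = g (dVec i)) {x : Steenrod}
    (hx : x ∈ subD) : f x = g x := by
  have : Submodule.span (ZMod 2) (Set.range dVec) ≤ LinearMap.eqLocus f g :=
    Submodule.span_le.2 (by rintro _ ⟨i, rfl⟩; exact h i)
  exact this (D_le_span hx)

/-- Two linear maps which agree on the basis of `A_1` agree on `A_1`. -/
theorem A1_linear_ext {V : Type} [AddCommGroup V] [Module (ZMod 2) V]
    {f g : Steenrod →ₗ[ZMod 2] V} (h : ∀ j, f (word8 (Sq 1) (Sq 2) j) = g (word8 (Sq 1) (Sq 2) j))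
    {x : Steenrod} (hx : x ∈ A1) : f x = g x := by
  have : Submodule.span (ZMod 2) (Set.range (word8 (Sq 1) (Sq 2))) ≤ LinearMap.eqLocus f g :=
    Submodule.span_le.2 (by rintro _ ⟨i, rfl⟩; exact h i)
  exact this (A1_le_span hx)

theorem coeffA_eq_zero {n : ℤ} {x : Steenrod} (hx : x ∈ A2) (hn : x ∈ homog n)
    {i : Fin 4 × Fin 8 × Fin 2} (hi : aDeg i ≠ n) : coeffA i x = 0 := by
  have h : coeffA i x = (coeffA i ∘ₗ component (aDeg i)) x := by
    refine A2_linear_ext (fun j => ?_) hx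
    rw [LinearMap.comp_apply]
    by_cases hj : aDeg i = aDeg j
    · rw [component_of_mem (hj ▸ aVec_mem_homog j)]
    · rw [component_of_mem_ne hj (aVec_mem_homog j), map_zero, coeffA_aVec, if_neg]
      rintro rfl
      exact hj rfl
  rw [h, LinearMap.comp_apply, component_of_mem_ne hi hn, map_zero]

/-- The linear extension to `A` of a map given on the basis of `subD`. -/
def extD {V : Type} [AddCommGroup V] [Module (ZMod 2) V] (v : Fin 8 × Fin 2 → V) :
    Steenrod →ₗ[ZMod 2] V :=
  ∑ i, (coeffA (0, i)).smulRight (v i)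

theorem extD_apply {V : Type} [AddCommGroup V] [Module (ZMod 2) V] (v : Fin 8 × Fin 2 → V)
    (x : Steenrod) : extD v x = ∑ i, coeffA (0, i) x • v i := by
  simp [extD]

theorem extD_dVec {V : Type} [AddCommGroup V] [Module (ZMod 2) V] (v : Fin 8 × Fin 2 → V)
    (i : Fin 8 × Fin 2) : extD v (dVec i) = v i := by
  simp [extD_apply, coeffA_dVec]

theorem extD_mem {V : Type} [AddCommGroup V] [Module (ZMod 2) V] (v : Fin 8 × Fin 2 → V)
    (T : Submodule (ZMod 2) V) {n : ℤ} (h : ∀ i, dDeg i = n → v i ∈ T) {x : Steenrod}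
    (hx : x ∈ subD) (hn : x ∈ homog n) : extD v x ∈ T := by
  rw [extD_apply]
  refine sum_mem fun i _ => ?_
  by_cases hi : dDeg i = n
  · exact T.smul_mem _ (h i hi)
  · rw [coeffA_eq_zero (D_le_A2 hx) hn, zero_smul]
    · exact zero_mem _
    · simpa [aDeg, bDeg] using hi

/-- The coordinates `A_2 → subD` with respect to the right basis `bVec`. -/
def kappa (k : Fin 4) : Steenrod →ₗ[ZMod 2] Steenrod :=
  ∑ i, (coeffA (k, i)).smulRight (dVec i)

theorem kappa_apply (k : Fin 4) (x : Steenrod) : kappa k x = ∑ i, coeffA (k, i) x • dVec i := by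
  simp [kappa]

theorem kappa_mem (k : Fin 4) (x : Steenrod) : kappa k x ∈ subD := by
  rw [kappa_apply]
  exact sum_mem fun i _ => Subalgebra.smul_mem _ (dVec_mem_D i) _

theorem kappa_homog (k : Fin 4) {n : ℤ} {x : Steenrod} (hx : x ∈ A2) (hn : x ∈ homog n) :
    kappa k x ∈ homog (n - bDeg k) := by
  rw [kappa_apply]
  refine sum_mem fun i _ => ?_
  by_cases hi : aDeg (k, i) = n
  · refine Submodule.smul_mem _ _ ?_
    rw [← hi, aDeg, add_sub_cancel_left]
    exact dVec_mem_homog i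
  · rw [coeffA_eq_zero hx hn hi, zero_smul]
    exact zero_mem _

theorem kappa_aVec (k l : Fin 4) (i : Fin 8 × Fin 2) :
    kappa k (aVec (l, i)) = if k = l then dVec i else 0 := by
  rw [kappa_apply]
  simp only [coeffA_aVec, Prod.mk.injEq]
  split_ifs with h
  · simp [h]
  · simp [h]

theorem kappa_bVec_mul (k l : Fin 4) {d : Steenrod} (hd : d ∈ subD) :
    kappa k (bVec l * d) = if k = l then d else 0 := by
  have := D_linear_ext (f := kappa k ∘ₗ LinearMap.mulLeft (ZMod 2) (bVec l))
    (g := if k = l then LinearMap.id else 0) (fun i => ?_) hd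
  · simp only [LinearMap.comp_apply, LinearMap.mulLeft_apply] at this
    rw [this]
    split_ifs <;> rfl
  · simp only [LinearMap.comp_apply, LinearMap.mulLeft_apply]
    rw [show bVec l * dVec i = aVec (l, i) from rfl, kappa_aVec]
    split_ifs <;> rfl

theorem sum_bVec_kappa {x : Steenrod} (hx : x ∈ A2) : ∑ k, bVec k * kappa k x = x := by
  have := A2_linear_ext (f := ∑ k, LinearMap.mulLeft (ZMod 2) (bVec k) ∘ₗ kappa k)
    (g := LinearMap.id) (fun i => ?_) hx
  · simpa using this
  · obtain ⟨l, i⟩ := i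
    simp only [LinearMap.sum_apply, LinearMap.comp_apply, LinearMap.mulLeft_apply, kappa_aVec,
      LinearMap.id_apply]
    simp [aVec]

theorem A2_homog_eq_zero {n : ℤ} (h : n ∉ Set.range aDeg) {x : Steenrod} (hx : x ∈ A2)
    (hn : x ∈ homog n) : x = 0 := by
  have h0 := A2_linear_ext (f := ∑ i, (coeffA i).smulRight (aVec i)) (g := LinearMap.id)
    (fun i => by simp [coeffA_aVec]) hx
  rw [LinearMap.id_apply] at h0
  rw [← h0, LinearMap.sum_apply]
  refine Finset.sum_eq_zero fun i _ => ?_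
  rw [LinearMap.smulRight_apply, coeffA_eq_zero hx hn (fun e => h ⟨i, e⟩), zero_smul]

theorem A2_homog_eq_zero_of_lt {n : ℤ} (h : 23 < n) {x : Steenrod} (hx : x ∈ A2)
    (hn : x ∈ homog n) : x = 0 := by
  refine A2_homog_eq_zero ?_ hx hn
  rintro ⟨⟨k, j, c⟩, rfl⟩
  revert h
  simp only [aDeg, dDeg]
  have h1 : bDeg k ≤ 10 := (by decide : ∀ k, bDeg k ≤ 10) k
  have h2 : deg8 j ≤ 6 := (by decide : ∀ j, deg8 j ≤ 6) j
  omega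

/-- The component of `subD = A_1 ⊕ A_1 Q_2` in `A_1`. -/
def alphaD : Steenrod →ₗ[ZMod 2] Steenrod :=
  extD fun i => if i.2 = 0 then word8 (Sq 1) (Sq 2) i.1 else 0

/-- The component of `subD = A_1 ⊕ A_1 Q_2` in `A_1 Q_2`. -/
def betaD : Steenrod →ₗ[ZMod 2] Steenrod :=
  extD fun i => if i.2 = 1 then word8 (Sq 1) (Sq 2) i.1 else 0

theorem word8_eq_dVec (j : Fin 8) : word8 (Sq 1) (Sq 2) j = dVec (j, 0) := by simp [dVec]

theorem word8_mul_Q2 (j : Fin 8) : word8 (Sq 1) (Sq 2) j * Q2 = dVec (j, 1) := by simp [dVec]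

theorem alphaD_A1 {x : Steenrod} (hx : x ∈ A1) : alphaD x = x :=
  A1_linear_ext (f := alphaD) (g := LinearMap.id)
    (fun j => by
      rw [LinearMap.id_apply]
      conv_lhs => rw [word8_eq_dVec]
      rw [alphaD, extD_dVec, if_pos rfl]) hx

theorem betaD_A1 {x : Steenrod} (hx : x ∈ A1) : betaD x = 0 :=
  A1_linear_ext (f := betaD) (g := 0)
    (fun j => by
      rw [word8_eq_dVec, betaD, extD_dVec, if_neg (by simp), LinearMap.zero_apply]) hx

theorem alphaD_mul_Q2 {x : Steenrod} (hx : x ∈ A1) : alphaD (x * Q2) = 0 :=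
  A1_linear_ext (f := alphaD ∘ₗ LinearMap.mulRight (ZMod 2) Q2) (g := 0)
    (fun j => by
      rw [LinearMap.comp_apply, LinearMap.mulRight_apply, word8_mul_Q2, alphaD, extD_dVec,
        if_neg (by simp), LinearMap.zero_apply]) hx

theorem betaD_mul_Q2 {x : Steenrod} (hx : x ∈ A1) : betaD (x * Q2) = x :=
  A1_linear_ext (f := betaD ∘ₗ LinearMap.mulRight (ZMod 2) Q2) (g := LinearMap.id)
    (fun j => by
      rw [LinearMap.comp_apply, LinearMap.mulRight_apply, word8_mul_Q2, betaD, extD_dVec,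
        if_pos rfl, LinearMap.id_apply]) hx

theorem alphaD_mem {x : Steenrod} : alphaD x ∈ A1 := by
  rw [alphaD, extD_apply]
  refine sum_mem fun i _ => Subalgebra.smul_mem _ ?_ _
  split_ifs
  · exact word8_mem_A1 _
  · exact zero_mem _

theorem betaD_mem {x : Steenrod} : betaD x ∈ A1 := by
  rw [betaD, extD_apply]
  refine sum_mem fun i _ => Subalgebra.smul_mem _ ?_ _
  split_ifs
  · exact word8_mem_A1 _
  · exact zero_mem _

theorem alphaD_homog {n : ℤ} {x : Steenrod} (hx : x ∈ subD) (hn : x ∈ homog n) :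
    alphaD x ∈ homog n := by
  refine extD_mem _ _ (fun i hi => ?_) hx hn
  split_ifs with h
  · have := word8_mem_homog i.1
    rw [← hi, dDeg, h]
    simpa using this
  · exact zero_mem _

theorem betaD_homog {n : ℤ} {x : Steenrod} (hx : x ∈ subD) (hn : x ∈ homog n) :
    betaD x ∈ homog (n - 7) := by
  refine extD_mem _ _ (fun i hi => ?_) hx hn
  split_ifs with h
  · have := word8_mem_homog i.1
    rw [← hi, dDeg, h]
    simpa using this
  · exact zero_mem _

theorem D_decomp {x : Steenrod} (hx : x ∈ subD) : alphaD x + betaD x * Q2 = x := by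
  refine D_linear_ext (f := alphaD + LinearMap.mulRight (ZMod 2) Q2 ∘ₗ betaD)
    (g := LinearMap.id) (fun i => ?_) hx
  obtain ⟨j, c⟩ := i
  simp only [LinearMap.add_apply, LinearMap.comp_apply, LinearMap.mulRight_apply, alphaD, betaD,
    extD_dVec, LinearMap.id_apply]
  fin_cases c <;> simp [dVec]

theorem D_mul_eq {x y : Steenrod} (hx : x ∈ subD) (hy : y ∈ subD) :
    x * y = alphaD x * alphaD y + (alphaD x * betaD y + betaD x * alphaD y) * Q2 := by
  have e : Q2 * alphaD y = alphaD y * Q2 := commute_Q2 (A1_le_A2 alphaD_mem)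
  have e' : Q2 * (betaD y * Q2) = 0 := by
    rw [← mul_assoc, commute_Q2 (A1_le_A2 betaD_mem), mul_assoc, rel_Q2_Q2, mul_zero]
  conv_lhs => rw [← D_decomp hx, ← D_decomp hy]
  simp only [mul_add, add_mul, mul_assoc, e, e', mul_zero, add_zero]
  abel

theorem alphaD_mul {x y : Steenrod} (hx : x ∈ subD) (hy : y ∈ subD) :
    alphaD (x * y) = alphaD x * alphaD y := by
  rw [D_mul_eq hx hy, map_add, alphaD_A1 (mul_mem alphaD_mem alphaD_mem), alphaD_mul_Q2, add_zero]
  exact add_mem (mul_mem alphaD_mem betaD_mem) (mul_mem betaD_mem alphaD_mem)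

theorem betaD_mul {x y : Steenrod} (hx : x ∈ subD) (hy : y ∈ subD) :
    betaD (x * y) = alphaD x * betaD y + betaD x * alphaD y := by
  rw [D_mul_eq hx hy, map_add, betaD_A1 (mul_mem alphaD_mem alphaD_mem), betaD_mul_Q2, zero_add]
  exact add_mem (mul_mem alphaD_mem betaD_mem) (mul_mem betaD_mem alphaD_mem)

theorem A1_homog_eq_zero_of_lt {n : ℤ} (h : 6 < n) {x : Steenrod} (hx : x ∈ A1)
    (hn : x ∈ homog n) : x = 0 := by
  have : alphaD x ∈ (⊥ : Submodule (ZMod 2) Steenrod) := by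
    refine extD_mem _ _ (fun i hi => ?_) (A1_le_D hx) hn
    split_ifs with h0
    · exfalso
      rw [dDeg, h0] at hi
      have h2 : ∀ j, deg8 j ≤ 6 := by decide
      have := h2 i.1
      simp at hi
      omega
    · exact zero_mem _
  rwa [alphaD_A1 hx] at this

end SteenrodExt
end

noncomputable section
namespace SteenrodExt
variable {B : Subalgebra (ZMod 2) Steenrod}

/-! ### The action of elements of the algebra on a graded module -/

open Classical in
/-- The action `M_i → M_j` of an element of `B` of degree `j - i`; other elements act as zero. -/
def GrMod.op (M : GrMod B) (i j : ℤ) (a : Steenrod) :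
    M.obj.obj ⟨i⟩ →ₗ[ZMod 2] M.obj.obj ⟨j⟩ :=
  if h : a ∈ Subalgebra.toSubmodule B ⊓ homog (j - i) then
    M.act (i := ⟨i⟩) (j := ⟨j⟩) ⟨a, h⟩ else 0

theorem GrMod.op_eq (M : GrMod B) {i j : ℤ} {a : Steenrod} (ha : a ∈ B) (hd : a ∈ homog (j - i)) :
    M.op i j a = M.act (i := ⟨i⟩) (j := ⟨j⟩) ⟨a, ha, hd⟩ :=
  dif_pos _

theorem GrMod.op_val (M : GrMod B) {i j : DegreeCat B} (f : i ⟶ j) :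
    M.op i.deg j.deg f.1 = M.act f :=
  M.op_eq f.2.1 f.2.2

theorem GrMod.op_zero (M : GrMod B) (i j : ℤ) (x : M.obj.obj ⟨i⟩) : M.op i j 0 x = 0 := by
  rw [M.op_eq (zero_mem _) (zero_mem _)]
  exact M.act_zero (j := ⟨j⟩) x

theorem GrMod.op_add (M : GrMod B) {i j : ℤ} {a b : Steenrod} (ha : a ∈ B)
    (hda : a ∈ homog (j - i)) (hb : b ∈ B) (hdb : b ∈ homog (j - i)) (x : M.obj.obj ⟨i⟩) :
    M.op i j (a + b) x = M.op i j a x + M.op i j b x := by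
  rw [M.op_eq ha hda, M.op_eq hb hdb, M.op_eq (add_mem ha hb) (add_mem hda hdb)]
  exact M.act_add (i := ⟨i⟩) (j := ⟨j⟩) ⟨a, ha, hda⟩ ⟨b, hb, hdb⟩ x

theorem GrMod.op_sum (M : GrMod B) {i j : ℤ} {ι : Type} (s : Finset ι) (a : ι → Steenrod)
    (ha : ∀ k ∈ s, a k ∈ B) (hda : ∀ k ∈ s, a k ∈ homog (j - i)) (x : M.obj.obj ⟨i⟩) :
    M.op i j (∑ k ∈ s, a k) x = ∑ k ∈ s, M.op i j (a k) x := by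
  classical
  induction s using Finset.induction_on with
  | empty => simpa using M.op_zero i j x
  | insert k s hk ih =>
    have ha' : ∀ k ∈ s, a k ∈ B := fun l hl => ha l (Finset.mem_insert_of_mem hl)
    have hd' : ∀ k ∈ s, a k ∈ homog (j - i) := fun l hl => hda l (Finset.mem_insert_of_mem hl)
    rw [Finset.sum_insert hk, Finset.sum_insert hk,
      M.op_add (ha k (Finset.mem_insert_self _ _)) (hda k (Finset.mem_insert_self _ _))
        (sum_mem ha') (sum_mem hd'), ih ha' hd']

theorem GrMod.op_one (M : GrMod B) (i : ℤ) (x : M.obj.obj ⟨i⟩) : M.op i i 1 x = x := by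
  rw [M.op_eq (one_mem _) (by simpa using one_mem_homog)]
  exact M.act_id ⟨i⟩ x

theorem GrMod.op_mul (M : GrMod B) {i j k : ℤ} {a b : Steenrod} (ha : a ∈ B)
    (hda : a ∈ homog (k - j)) (hb : b ∈ B) (hdb : b ∈ homog (j - i)) (x : M.obj.obj ⟨i⟩) :
    M.op i k (a * b) x = M.op j k a (M.op i j b x) := by
  rw [M.op_eq ha hda, M.op_eq hb hdb, M.op_eq (mul_mem ha hb)
    (by have := mul_mem_homog hda hdb; rwa [sub_add_sub_cancel] at this)]
  exact M.act_comp (i := ⟨i⟩) (j := ⟨j⟩) (k := ⟨k⟩) ⟨b, hb, hdb⟩ ⟨a, ha, hda⟩ x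

theorem GrMod.app_op {M N : GrMod B} (φ : M ⟶ N) (i j : ℤ) (a : Steenrod) (x : M.obj.obj ⟨i⟩) :
    GrMod.app φ ⟨j⟩ (M.op i j a x) = N.op i j a (GrMod.app φ ⟨i⟩ x) := by
  by_cases h : a ∈ Subalgebra.toSubmodule B ⊓ homog (j - i)
  · rw [M.op_eq h.1 h.2, N.op_eq h.1 h.2]
    exact GrMod.app_act φ (i := ⟨i⟩) (j := ⟨j⟩) ⟨a, h⟩ x
  · simp [GrMod.op, dif_neg h]

/-- A morphism from its degree parts, with linearity stated for elements. -/
def GrMod.homOfOp {M N : GrMod B} (φ : ∀ n : ℤ, M.obj.obj ⟨n⟩ →ₗ[ZMod 2] N.obj.obj ⟨n⟩)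
    (h : ∀ (i j : ℤ) (a : Steenrod), a ∈ B → a ∈ homog (j - i) → ∀ x : M.obj.obj ⟨i⟩,
      φ j (M.op i j a x) = N.op i j a (φ i x)) : M ⟶ N :=
  GrMod.mkHom (fun n => φ n.deg) (fun {i j} f x => by
    have := h i.deg j.deg f.1 f.2.1 f.2.2 x
    rwa [M.op_val, N.op_val] at this)

/-! ### Change of rings along a matrix representation -/

/-- A representation of `B'` by row-finite matrices over `B`, with homogeneous entries. -/
structure Twist (B B' : Subalgebra (ZMod 2) Steenrod) (P : Type) where
  /-- the degree shift in each coordinate -/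
  shift : P → ℤ
  /-- the support of each row -/
  nbr : P → Finset P
  /-- the matrix entries -/
  mat : P → P → Steenrod →ₗ[ZMod 2] Steenrod
  mat_mem : ∀ (p q : P) {d : Steenrod}, d ∈ B' → mat p q d ∈ B
  mat_homog : ∀ (p q : P) {n : ℤ} {d : Steenrod}, d ∈ B' → d ∈ homog n →
    mat p q d ∈ homog (n + shift p - shift q)
  mat_eq_zero : ∀ {p q : P} {d : Steenrod}, d ∈ B' → q ∉ nbr p → mat p q d = 0
  mat_one_self : ∀ p, mat p p 1 = 1
  mat_one_ne : ∀ p q, p ≠ q → mat p q 1 = 0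
  mat_mul : ∀ (p r : P) {d d' : Steenrod}, d ∈ B' → d' ∈ B' →
    mat p r (d * d') = ∑ q ∈ nbr p, mat p q d * mat q r d'

namespace Twist

variable {B' : Subalgebra (ZMod 2) Steenrod} {P : Type} (T : Twist B B' P)

theorem mat_homog' {i j : ℤ} (p q : P) {d : Steenrod} (hd : d ∈ B') (h : d ∈ homog (j - i)) :
    T.mat p q d ∈ homog (j + T.shift p - (i + T.shift q)) := by
  have := T.mat_homog p q hd h
  rwa [show j - i + T.shift p - T.shift q = j + T.shift p - (i + T.shift q) by ring] at this

/-- The action on tuples. -/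
def rho (Z : GrMod B) (i j : ℤ) (d : Steenrod) :
    (∀ p, Z.obj.obj ⟨i + T.shift p⟩) →ₗ[ZMod 2] (∀ p, Z.obj.obj ⟨j + T.shift p⟩) :=
  LinearMap.pi fun p => ∑ q ∈ T.nbr p,
    Z.op (i + T.shift q) (j + T.shift p) (T.mat p q d) ∘ₗ LinearMap.proj q

theorem rho_apply (Z : GrMod B) (i j : ℤ) (d : Steenrod) (z : ∀ p, Z.obj.obj ⟨i + T.shift p⟩)
    (p : P) : T.rho Z i j d z p =
      ∑ q ∈ T.nbr p, Z.op (i + T.shift q) (j + T.shift p) (T.mat p q d) (z q) := by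
  simp [rho]

theorem rho_apply_of_subset (Z : GrMod B) (i j : ℤ) {d : Steenrod} (hd : d ∈ B')
    (z : ∀ p, Z.obj.obj ⟨i + T.shift p⟩) (p : P) (U : Finset P) (hU : T.nbr p ⊆ U) :
    T.rho Z i j d z p =
      ∑ q ∈ U, Z.op (i + T.shift q) (j + T.shift p) (T.mat p q d) (z q) := by
  rw [rho_apply]
  refine Finset.sum_subset hU fun q _ hq => ?_
  rw [T.mat_eq_zero hd hq, Z.op_zero]

theorem rho_one (Z : GrMod B) (i : ℤ) (z : ∀ p, Z.obj.obj ⟨i + T.shift p⟩) :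
    T.rho Z i i 1 z = z := by
  funext p
  rw [rho_apply, Finset.sum_eq_single p]
  · rw [T.mat_one_self, Z.op_one]
  · intro q _ hq
    rw [T.mat_one_ne p q hq.symm, Z.op_zero]
  · intro h
    rw [T.mat_eq_zero (one_mem _) h, Z.op_zero]

theorem rho_mul (Z : GrMod B) {i j k : ℤ} {d d' : Steenrod} (hd : d ∈ B') (hd' : d' ∈ B')
    (hn : d ∈ homog (k - j)) (hn' : d' ∈ homog (j - i)) (z : ∀ p, Z.obj.obj ⟨i + T.shift p⟩) :
    T.rho Z i k (d * d') z = T.rho Z j k d (T.rho Z i j d' z) := by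
  classical
  funext p
  set U := T.nbr p ∪ (T.nbr p).biUnion T.nbr with hU
  have hUq : ∀ q ∈ T.nbr p, T.nbr q ⊆ U := fun q hq =>
    (Finset.subset_biUnion_of_mem T.nbr hq).trans Finset.subset_union_right
  rw [T.rho_apply_of_subset Z i k (mul_mem hd hd') z p U Finset.subset_union_left, rho_apply]
  trans ∑ q ∈ T.nbr p, ∑ r ∈ U, Z.op (j + T.shift q) (k + T.shift p) (T.mat p q d)
    (Z.op (i + T.shift r) (j + T.shift q) (T.mat q r d') (z r))
  · rw [Finset.sum_comm]
    refine Finset.sum_congr rfl fun r _ => ?_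
    rw [T.mat_mul p r hd hd', Z.op_sum]
    · exact Finset.sum_congr rfl fun q _ => Z.op_mul (T.mat_mem p q hd) (T.mat_homog' p q hd hn)
        (T.mat_mem q r hd') (T.mat_homog' q r hd' hn') _
    · exact fun q _ => mul_mem (T.mat_mem p q hd) (T.mat_mem q r hd')
    · intro q _
      have := mul_mem_homog (T.mat_homog' p q hd hn) (T.mat_homog' q r hd' hn')
      rwa [sub_add_sub_cancel] at this
  · refine Finset.sum_congr rfl fun q hq => ?_
    rw [T.rho_apply_of_subset Z i j hd' z q U (hUq q hq), map_sum]

theorem rho_add (Z : GrMod B) {i j : ℤ} {d d' : Steenrod} (hd : d ∈ B') (hd' : d' ∈ B')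
    (hn : d ∈ homog (j - i)) (hn' : d' ∈ homog (j - i)) (z : ∀ p, Z.obj.obj ⟨i + T.shift p⟩) :
    T.rho Z i j (d + d') z = T.rho Z i j d z + T.rho Z i j d' z := by
  funext p
  rw [Pi.add_apply]
  simp only [rho_apply]
  rw [← Finset.sum_add_distrib]
  refine Finset.sum_congr rfl fun q _ => ?_
  rw [map_add, Z.op_add (T.mat_mem p q hd) (T.mat_homog' p q hd hn)
        (T.mat_mem p q hd') (T.mat_homog' p q hd' hn')]

/-- The graded module of tuples. -/
def obj (Z : GrMod B) : GrMod B' :=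
  GrMod.mk' (fun i => ModuleCat.of (ZMod 2) (∀ p, Z.obj.obj ⟨i.deg + T.shift p⟩))
    (fun {i j} f => T.rho Z i.deg j.deg f.1)
    (fun i x => T.rho_one Z i.deg x)
    (fun f g x => T.rho_mul Z g.2.1 f.2.1 g.2.2 f.2.2 x)
    (fun f g x => T.rho_add Z f.2.1 g.2.1 f.2.2 g.2.2 x)

theorem obj_op (Z : GrMod B) {i j : ℤ} {d : Steenrod} (hd : d ∈ B') (hn : d ∈ homog (j - i))
    (z : ∀ p, Z.obj.obj ⟨i + T.shift p⟩) :
    (T.obj Z).op i j d z = T.rho Z i j d z := by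
  rw [GrMod.op_eq _ hd hn]
  rfl

theorem app_rho {Z Z' : GrMod B} (φ : Z ⟶ Z') (i j : ℤ) (d : Steenrod)
    (z : ∀ p, Z.obj.obj ⟨i + T.shift p⟩) (p : P) :
    GrMod.app φ _ (T.rho Z i j d z p) = T.rho Z' i j d (fun p => GrMod.app φ _ (z p)) p := by
  rw [rho_apply, rho_apply, map_sum]
  exact Finset.sum_congr rfl fun q _ => GrMod.app_op φ _ _ _ _

/-- The functor to graded modules of tuples. -/
@[reducible]
def functor : GrMod B ⥤ GrMod B' where
  obj := T.obj
  map φ := GrMod.mkHom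
    (fun i => LinearMap.pi fun p => GrMod.app φ ⟨i.deg + T.shift p⟩ ∘ₗ LinearMap.proj p)
    (fun {i j} f z => by
      funext p
      exact T.app_rho φ i.deg j.deg f.1 z p)

instance : T.functor.Additive where

theorem functor_exact : PreservesFiniteLimits T.functor ∧ PreservesFiniteColimits T.functor := by
  refine GrMod.exact_functor _ fun S hS => ?_
  have := hS.mono_f
  have := hS.epi_g
  refine GrMod.shortExact_of_eval _ (fun n z z' h => ?_) (fun n z => ?_) (fun n z h => ?_)
  · funext p
    exact GrMod.injective_app_of_mono S.f _ (congrFun h p)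
  · choose y hy using fun p => GrMod.surjective_app_of_epi S.g ⟨n.deg + T.shift p⟩ (z p)
    exact ⟨y, funext hy⟩
  · choose y hy using fun p => GrMod.exact_eval hS.exact ⟨n.deg + T.shift p⟩ (z p) (congrFun h p)
    exact ⟨y, funext hy⟩

instance : PreservesFiniteLimits T.functor := T.functor_exact.1
instance : PreservesFiniteColimits T.functor := T.functor_exact.2

end Twist

end SteenrodExt
end

noncomputable section
namespace SteenrodExt
variable {B : Subalgebra (ZMod 2) Steenrod}

/-! ### The trivial module -/

/-- The value of an element of `Σ^t ℤ₂`. -/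
def suspVal (t : ℤ) (n : DegreeCat B) :
    (susp t (trivialMod B)).obj.obj n →ₗ[ZMod 2] ZMod 2 :=
  Submodule.subtype (if n.deg - t = 0 then ⊤ else ⊥)

theorem suspVal_injective (t : ℤ) (n : DegreeCat B) : Function.Injective (suspVal (B := B) t n) :=
  Subtype.val_injective

theorem suspVal_surjective (t : ℤ) (n : DegreeCat B) (h : n.deg = t) :
    Function.Surjective (suspVal (B := B) t n) := by
  intro c
  refine ⟨⟨c, ?_⟩, rfl⟩
  change c ∈ (if n.deg - t = 0 then ⊤ else ⊥ : Submodule (ZMod 2) (ZMod 2))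
  rw [if_pos (by omega)]
  trivial

theorem susp_subsingleton (t : ℤ) (n : DegreeCat B) (h : n.deg ≠ t) :
    Subsingleton ((susp t (trivialMod B)).obj.obj n) := by
  refine ⟨fun x y => suspVal_injective t n ?_⟩
  have hx := x.2
  have hy := y.2
  change x.1 ∈ (if n.deg - t = 0 then ⊤ else ⊥ : Submodule (ZMod 2) (ZMod 2)) at hx
  change y.1 ∈ (if n.deg - t = 0 then ⊤ else ⊥ : Submodule (ZMod 2) (ZMod 2)) at hy
  rw [if_neg (by omega), Submodule.mem_bot] at hx hy
  exact hx.trans hy.symm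

theorem suspVal_act (t : ℤ) {i j : DegreeCat B} (f : i ⟶ j)
    (x : (susp t (trivialMod B)).obj.obj i) :
    suspVal t j ((susp t (trivialMod B)).act f x) = augmentation f.1 * suspVal t i x := rfl

theorem suspVal_op (t : ℤ) {i j : ℤ} {a : Steenrod} (ha : a ∈ B) (hd : a ∈ homog (j - i))
    (x : (susp t (trivialMod B)).obj.obj ⟨i⟩) :
    suspVal t ⟨j⟩ ((susp t (trivialMod B)).op i j a x) = augmentation a * suspVal t ⟨i⟩ x := by
  rw [GrMod.op_eq _ ha hd]
  rfl

/-- The value of an element of the trivial module. -/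
def trivVal (n : DegreeCat B) : (trivialMod B).obj.obj n →ₗ[ZMod 2] ZMod 2 :=
  Submodule.subtype (if n.deg = 0 then ⊤ else ⊥)

theorem trivVal_injective (n : DegreeCat B) : Function.Injective (trivVal (B := B) n) :=
  Subtype.val_injective

theorem triv_subsingleton (n : DegreeCat B) (h : n.deg ≠ 0) :
    Subsingleton ((trivialMod B).obj.obj n) := by
  refine ⟨fun x y => trivVal_injective n ?_⟩
  have hx := x.2
  have hy := y.2
  change x.1 ∈ (if n.deg = 0 then ⊤ else ⊥ : Submodule (ZMod 2) (ZMod 2)) at hx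
  change y.1 ∈ (if n.deg = 0 then ⊤ else ⊥ : Submodule (ZMod 2) (ZMod 2)) at hy
  rw [if_neg h, Submodule.mem_bot] at hx hy
  exact hx.trans hy.symm

theorem trivVal_op {i j : ℤ} {a : Steenrod} (ha : a ∈ B) (hd : a ∈ homog (j - i))
    (x : (trivialMod B).obj.obj ⟨i⟩) :
    trivVal ⟨j⟩ ((trivialMod B).op i j a x) = augmentation a * trivVal ⟨i⟩ x := by
  rw [GrMod.op_eq _ ha hd]
  rfl

/-- The generator of the trivial module. -/
def trivOne (B : Subalgebra (ZMod 2) Steenrod) : (trivialMod B).obj.obj ⟨0⟩ :=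
  ⟨1, by
    change (1 : ZMod 2) ∈ (if (0 : ℤ) = 0 then ⊤ else ⊥ : Submodule (ZMod 2) (ZMod 2))
    rw [if_pos rfl]
    trivial⟩

theorem trivVal_trivOne : trivVal ⟨0⟩ (trivOne B) = 1 := rfl

theorem trivVal_smul_trivOne (x : (trivialMod B).obj.obj ⟨0⟩) : trivVal ⟨0⟩ x • trivOne B = x := by
  apply trivVal_injective
  rw [map_smul, trivVal_trivOne, smul_eq_mul, mul_one]

theorem trivialMod_hom_ext {Z : GrMod B} {f g : trivialMod B ⟶ Z}
    (h : GrMod.app f ⟨0⟩ (trivOne B) = GrMod.app g ⟨0⟩ (trivOne B)) : f = g := by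
  refine GrMod.hom_ext fun n x => ?_
  obtain ⟨n⟩ := n
  by_cases hn : n = 0
  · subst hn
    rw [← trivVal_smul_trivOne x, map_smul, map_smul, h]
  · have := triv_subsingleton (B := B) ⟨n⟩ hn
    rw [Subsingleton.elim x 0, map_zero, map_zero]

theorem homog_zero_eq {a : Steenrod} (ha : a ∈ homog 0) : a = augmentation a • 1 := by
  have : homog 0 ≤ LinearMap.eqLocus LinearMap.id
      (augmentation.toLinearMap.smulRight (1 : Steenrod)) := by
    refine Submodule.span_le.2 ?_
    rintro _ ⟨w, hw, rfl⟩
    have h0 : ∀ n ∈ w, n = 0 := by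
      have hw : w.sum = 0 := by exact_mod_cast hw
      exact List.sum_eq_zero_iff.1 hw
    have e : (w.map Sq).prod = 1 := by
      refine List.prod_eq_one fun x hx => ?_
      obtain ⟨n, hn, rfl⟩ := List.mem_map.1 hx
      rw [h0 n hn, Sq_zero]
    simp [e]
  simpa using this ha

theorem GrMod.op_smul (M : GrMod B) {i j : ℤ} (a : Steenrod) (c : ZMod 2) (x : M.obj.obj ⟨i⟩) : M.op i j (c • a) x = c • M.op i j a x := by
  obtain rfl | rfl : c = 0 ∨ c = 1 := by revert c; decide
  · rw [zero_smul, zero_smul, M.op_zero]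
  · rw [one_smul, one_smul]

/-- The morphism from the trivial module given by an element killed by the augmentation ideal. -/
def trivHom {Z : GrMod B} (z : Z.obj.obj ⟨0⟩)
    (h : ∀ (j : ℤ) (a : Steenrod), j ≠ 0 → a ∈ B → a ∈ homog j → Z.op 0 j a z = 0) :
    trivialMod B ⟶ Z :=
  GrMod.homOfOp (fun n => if hn : n = 0 then
      hn ▸ (trivVal ⟨0⟩).smulRight z else 0) (by
    intro i j a ha hd x
    by_cases hi : i = 0
    · subst hi
      by_cases hj : j = 0
      · subst hj
        simp only [dif_pos, LinearMap.smulRight_apply, map_smul, trivVal_op ha hd]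
        have e := homog_zero_eq (a := a) (by simpa using hd)
        conv_rhs => rw [e, Z.op_smul, Z.op_one]
        rw [smul_smul, mul_comm]
      · have := triv_subsingleton (B := B) ⟨j⟩ hj
        rw [Subsingleton.elim ((trivialMod B).op 0 j a x) 0, map_zero, dif_pos rfl]
        simp only [LinearMap.smulRight_apply, map_smul]
        rw [h j a hj ha (by simpa using hd), smul_zero]
    · have := triv_subsingleton (B := B) ⟨i⟩ hi
      rw [Subsingleton.elim x 0, map_zero, map_zero, map_zero, map_zero])

theorem trivHom_app {Z : GrMod B} (z : Z.obj.obj ⟨0⟩)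
    (h : ∀ (j : ℤ) (a : Steenrod), j ≠ 0 → a ∈ B → a ∈ homog j → Z.op 0 j a z = 0) :
    GrMod.app (trivHom z h) ⟨0⟩ (trivOne B) = z := by
  change (trivVal ⟨0⟩).smulRight z (trivOne B) = z
  rw [LinearMap.smulRight_apply, trivVal_trivOne, one_smul]

theorem trivialMod_hom_op {Z : GrMod B} (f : trivialMod B ⟶ Z) {j : ℤ} (hj : j ≠ 0) {a : Steenrod} :
    Z.op 0 j a (GrMod.app f ⟨0⟩ (trivOne B)) = 0 := by
  have := triv_subsingleton (B := B) ⟨j⟩ hj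
  rw [← GrMod.app_op, Subsingleton.elim ((trivialMod B).op 0 j a _) 0, map_zero]

/-- `x = x' Sq^1 + x'' Sq^2 + x''' Q_2` for `x ∈ subD` of nonzero degree. -/
theorem D_decomp_gens {n : ℤ} (hn : n ≠ 0) {x : Steenrod} (hx : x ∈ subD) (hd : x ∈ homog n) :
    ∃ a b c : Steenrod, (a ∈ subD ∧ a ∈ homog (n - 1)) ∧ (b ∈ subD ∧ b ∈ homog (n - 2)) ∧
      (c ∈ subD ∧ c ∈ homog (n - 7)) ∧ x = a * Sq 1 + b * Sq 2 + c * Q2 := by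
  have key : extD dVec x ∈
      (Subalgebra.toSubmodule subD ⊓ homog (n - 1)).map (LinearMap.mulRight (ZMod 2) (Sq 1)) ⊔
      (Subalgebra.toSubmodule subD ⊓ homog (n - 2)).map (LinearMap.mulRight (ZMod 2) (Sq 2)) ⊔
      (Subalgebra.toSubmodule subD ⊓ homog (n - 7)).map (LinearMap.mulRight (ZMod 2) Q2) := by
    refine extD_mem _ _ (fun i hi => ?_) hx hd
    obtain ⟨j, c⟩ := i
    obtain rfl | rfl : c = 0 ∨ c = 1 := (by decide : ∀ c : Fin 2, c = 0 ∨ c = 1) c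
    · have hw := fun l => A1_le_D (word8_mem_A1 l)
      have L1 : ∀ l : Fin 8, deg8 l = n - 1 → word8 (Sq 1) (Sq 2) l * Sq 1 ∈
          (Subalgebra.toSubmodule subD ⊓ homog (n - 1)).map
            (LinearMap.mulRight (ZMod 2) (Sq 1)) := fun l hl =>
        ⟨_, ⟨hw l, hl ▸ word8_mem_homog l⟩, rfl⟩
      have L2 : ∀ l : Fin 8, deg8 l = n - 2 → word8 (Sq 1) (Sq 2) l * Sq 2 ∈
          (Subalgebra.toSubmodule subD ⊓ homog (n - 2)).map
            (LinearMap.mulRight (ZMod 2) (Sq 2)) := fun l hl =>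
        ⟨_, ⟨hw l, hl ▸ word8_mem_homog l⟩, rfl⟩
      have hi : deg8 j = n := by simpa [dDeg] using hi
      rw [← word8_eq_dVec]
      refine Submodule.mem_sup_left ?_
      subst hi
      fin_cases j
      · exact absurd rfl hn
      · refine Submodule.mem_sup_left ?_
        simpa [word8] using L1 0 (by decide)
      · refine Submodule.mem_sup_right ?_
        simpa [word8] using L2 0 (by decide)
      · refine Submodule.mem_sup_right ?_
        simpa [word8, mul_assoc] using L2 1 (by decide)
      · refine Submodule.mem_sup_left ?_
        simpa [word8, mul_assoc] using L1 2 (by decide)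
      · refine Submodule.mem_sup_left ?_
        simpa [word8, mul_assoc] using L1 3 (by decide)
      · refine Submodule.mem_sup_right ?_
        simpa [word8, mul_assoc] using L2 4 (by decide)
      · refine Submodule.mem_sup_right ?_
        simpa [word8, mul_assoc] using L2 5 (by decide)
    · refine Submodule.mem_sup_right ⟨word8 (Sq 1) (Sq 2) j, ⟨A1_le_D (word8_mem_A1 j), ?_⟩, ?_⟩
      · have : deg8 j = n - 7 := by
          rw [← hi, dDeg]; simp
        exact this ▸ word8_mem_homog j
      · exact word8_mul_Q2 j
  have e : extD dVec x = x := D_linear_ext (f := extD dVec) (g := LinearMap.id)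
    (fun i => extD_dVec dVec i) hx
  rw [e] at key
  obtain ⟨y, hy, _, ⟨c, hc, rfl⟩, rfl⟩ := Submodule.mem_sup.1 key
  obtain ⟨_, ⟨a, ha, rfl⟩, _, ⟨b, hb, rfl⟩, rfl⟩ := Submodule.mem_sup.1 hy
  exact ⟨a, b, c, ha, hb, hc, rfl⟩

/-- An element killed by `Sq^1`, `Sq^2`, `Q_2` is killed by the augmentation ideal of `subD`. -/
theorem D_kill {Z : GrMod B} (hB : subD ≤ B) {i : ℤ} (z : Z.obj.obj ⟨i⟩)
    (h1 : Z.op i (i + 1) (Sq 1) z = 0) (h2 : Z.op i (i + 2) (Sq 2) z = 0)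
    (h7 : Z.op i (i + 7) Q2 z = 0) (j : ℤ) (a : Steenrod) (hj : j - i ≠ 0) (ha : a ∈ subD)
    (hd : a ∈ homog (j - i)) : Z.op i j a z = 0 := by
  obtain ⟨x, y, w, ⟨hx, hxd⟩, ⟨hy, hyd⟩, ⟨hw, hwd⟩, rfl⟩ := D_decomp_gens hj ha hd
  have m1 : x * Sq 1 ∈ homog (j - i) := mul_mem_homog_of_eq (by ring) hxd Sq_one_mem_homog
  have m2 : y * Sq 2 ∈ homog (j - i) := mul_mem_homog_of_eq (by ring) hyd Sq_two_mem_homog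
  have m7 : w * Q2 ∈ homog (j - i) := mul_mem_homog_of_eq (by ring) hwd Q2_mem_homog
  have b1 := mul_mem (hB hx) (hB Sq_one_mem_D)
  have b2 := mul_mem (hB hy) (hB Sq_two_mem_D)
  have b7 := mul_mem (hB hw) (hB Q2_mem_D)
  rw [Z.op_add (add_mem b1 b2) (add_mem m1 m2) b7 m7, Z.op_add b1 m1 b2 m2,
    Z.op_mul (j := i + 1) (hB hx) (by rwa [sub_add_eq_sub_sub]) (hB Sq_one_mem_D)
      (by simpa using Sq_one_mem_homog),
    Z.op_mul (j := i + 2) (hB hy) (by rwa [sub_add_eq_sub_sub]) (hB Sq_two_mem_D)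
      (by simpa using Sq_two_mem_homog),
    Z.op_mul (j := i + 7) (hB hw) (by rwa [sub_add_eq_sub_sub]) (hB Q2_mem_D)
      (by simpa using Q2_mem_homog), h1, h2, h7]
  simp

end SteenrodExt
end

noncomputable section
namespace SteenrodExt

/-! ### Coinduction from `A_1` to `subD` -/

theorem alphaD_one : alphaD 1 = 1 := alphaD_A1 (one_mem _)

theorem betaD_one : betaD 1 = 0 := betaD_A1 (one_mem _)

/-- Restriction along the projection `subD → A_1`, desuspended `c` times. -/
def twistPi (c : ℤ) : Twist A1 subD Unit where
  shift _ := c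
  nbr _ := Finset.univ
  mat _ _ := alphaD
  mat_mem _ _ _ _ := alphaD_mem
  mat_homog _ _ _ _ hd hn := by simpa using alphaD_homog hd hn
  mat_eq_zero _ h := absurd (Finset.mem_univ _) h
  mat_one_self _ := alphaD_one
  mat_one_ne p q h := absurd (Subsingleton.elim p q) h
  mat_mul _ _ _ _ hd hd' := by simpa using alphaD_mul hd hd'

/-- The coinduction from `A_1` to `subD = A_1 ⊕ A_1 Q_2`: `(K Y)_n = Y_n ⊕ Y_{n+7}`. -/
def twistK : Twist A1 subD Bool where
  shift b := match b with
    | false => 0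
    | true => 7
  nbr _ := Finset.univ
  mat b b' := match b, b' with
    | false, false => alphaD
    | true, true => alphaD
    | false, true => betaD
    | true, false => 0
  mat_mem b b' _ _ := match b, b' with
    | false, false => alphaD_mem
    | true, true => alphaD_mem
    | false, true => betaD_mem
    | true, false => zero_mem _
  mat_homog b b' _ _ hd hn := match b, b' with
    | false, false => by simpa using alphaD_homog hd hn
    | true, true => by simpa using alphaD_homog hd hn
    | false, true => by simpa using betaD_homog hd hn
    | true, false => zero_mem _
  mat_eq_zero _ h := absurd (Finset.mem_univ _) h
  mat_one_self b := match b with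
    | false => alphaD_one
    | true => alphaD_one
  mat_one_ne b b' h := match b, b' with
    | false, false => absurd rfl h
    | true, true => absurd rfl h
    | false, true => betaD_one
    | true, false => rfl
  mat_mul b b' _ _ hd hd' := match b, b' with
    | false, false => by simpa using alphaD_mul hd hd'
    | true, true => by simpa using alphaD_mul hd hd'
    | false, true => by simpa [add_comm] using betaD_mul hd hd'
    | true, false => by simp

theorem twistPi_rho (c : ℤ) (Z : GrMod A1) (i j : ℤ) (d : Steenrod)
    (z : ∀ p, Z.obj.obj ⟨i + (twistPi c).shift p⟩) (p : Unit) :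
    (twistPi c).rho Z i j d z p = Z.op (i + c) (j + c) (alphaD d) (z p) := by
  rw [Twist.rho_apply]
  exact Finset.sum_singleton _ _

theorem twistK_rho_true (Z : GrMod A1) (i j : ℤ) (d : Steenrod)
    (z : ∀ p, Z.obj.obj ⟨i + twistK.shift p⟩) :
    twistK.rho Z i j d z true = Z.op (i + 7) (j + 7) (alphaD d) (z true) := by
  rw [Twist.rho_apply]
  refine (Fintype.sum_bool _).trans ?_
  have h : ∀ x y, x + Z.op (i + 0) (j + 7) 0 y = x := by
    intro x y
    rw [Z.op_zero, add_zero]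
  exact h _ (z false)

theorem twistK_rho_false (Z : GrMod A1) (i j : ℤ) (d : Steenrod)
    (z : ∀ p, Z.obj.obj ⟨i + twistK.shift p⟩) :
    twistK.rho Z i j d z false = Z.op (i + 7) (j + 0) (betaD d) (z true)
      + Z.op (i + 0) (j + 0) (alphaD d) (z false) := by
  rw [Twist.rho_apply]
  exact Fintype.sum_bool _

/-- The inclusion of the first factor of the coinduced module. -/
def inclK (Y : GrMod A1) : (twistPi 0).obj Y ⟶ twistK.obj Y :=
  GrMod.mkHom (fun i =>
    { toFun := fun z b => match b with
        | false => z ()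
        | true => 0
      map_add' := fun z z' => by
        funext b
        cases b
        · rfl
        · exact (add_zero 0).symm
      map_smul' := fun c z => by
        funext b
        cases b
        · rfl
        · exact (smul_zero c).symm })
    (fun {i j} f z => by
      funext b
      cases b
      · refine (twistPi_rho 0 Y i.deg j.deg f.1 z ()).trans ?_
        refine Eq.trans ?_ (twistK_rho_false Y i.deg j.deg f.1 _).symm
        have h : ∀ x, Y.op (i.deg + 0) (j.deg + 0) (alphaD f.1) x =
            Y.op (i.deg + 7) (j.deg + 0) (betaD f.1) 0
              + Y.op (i.deg + 0) (j.deg + 0) (alphaD f.1) x := by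
          intro x
          rw [map_zero, zero_add]
        exact h (z ())
      · refine Eq.trans ?_ (twistK_rho_true Y i.deg j.deg f.1 _).symm
        exact (map_zero (Y.op (i.deg + 7) (j.deg + 7) (alphaD f.1))).symm)

/-- The projection to the second factor of the coinduced module. -/
def projK (Y : GrMod A1) : twistK.obj Y ⟶ (twistPi 7).obj Y :=
  GrMod.mkHom (fun i =>
    { toFun := fun z _ => z true
      map_add' := fun _ _ => rfl
      map_smul' := fun _ _ => rfl })
    (fun {i j} f z => by
      funext b
      refine (twistK_rho_true Y i.deg j.deg f.1 z).trans ?_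
      exact (twistPi_rho 7 Y i.deg j.deg f.1 (fun _ => z true) ()).symm)

/-- The extension `0 → π^* Y → K Y → Σ^{-7} π^* Y → 0`. -/
def seqK (Y : GrMod A1) : ShortComplex (GrMod subD) :=
  ShortComplex.mk (inclK Y) (projK Y) (GrMod.hom_ext fun _ _ => rfl)

theorem seqK_shortExact (Y : GrMod A1) : (seqK Y).ShortExact := by
  refine GrMod.shortExact_of_eval _ (fun n z z' h => ?_) (fun n z => ?_) (fun n z h => ?_)
  · funext p
    exact congrFun h false
  · exact ⟨fun b => match b with
      | false => 0
      | true => z (), rfl⟩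
  · refine ⟨fun _ => z false, ?_⟩
    funext b
    cases b
    · rfl
    · exact (congrFun h ()).symm

theorem inclK_naturality {Y Y' : GrMod A1} (φ : Y ⟶ Y') :
    (twistPi 0).functor.map φ ≫ inclK Y' = inclK Y ≫ twistK.functor.map φ := by
  refine GrMod.hom_ext fun n z => ?_
  funext b
  cases b
  · rfl
  · exact (map_zero (GrMod.app φ _)).symm

theorem GrMod.cofree.coeff_op {B : Subalgebra (ZMod 2) Steenrod}
    {W : DegreeCat B → ModuleCat.{0} (ZMod 2)} {i j : ℤ} {a : Steenrod} (ha : a ∈ B)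
    (hd : a ∈ homog (j - i)) (x : (GrMod.cofree W).obj.obj ⟨i⟩) (n : DegreeCat B)
    (b : (⟨j⟩ : DegreeCat B) ⟶ n) :
    GrMod.cofree.coeff ((GrMod.cofree W).op i j a x) n b =
      GrMod.cofree.coeff x n ((⟨a, ha, hd⟩ : (⟨i⟩ : DegreeCat B) ⟶ ⟨j⟩) ≫ b) := by
  rw [GrMod.op_eq _ ha hd]
  rfl

/-- The morphism of degree zero given by the unit. -/
def DegreeCat.oneHom {B : Subalgebra (ZMod 2) Steenrod} {i j : DegreeCat B} (h : j.deg = i.deg) :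
    i ⟶ j := ⟨1, B.one_mem, by rw [h, sub_self]; exact one_mem_homog⟩

theorem twistK_cofree_injective (W : DegreeCat A1 → ModuleCat.{0} (ZMod 2)) :
    Injective (twistK.obj (GrMod.cofree W)) := by
  have hα : ∀ {i m : DegreeCat subD} (f : i ⟶ m) (n : DegreeCat A1) (_ : n.deg = m.deg),
      alphaD f.1 ∈ homog (n.deg - (i.deg + 0)) := by
    intro i m f n h
    simpa [h] using alphaD_homog f.2.1 f.2.2
  have hβ : ∀ {i m : DegreeCat subD} (f : i ⟶ m) (n : DegreeCat A1) (_ : n.deg = m.deg),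
      betaD f.1 ∈ homog (n.deg - (i.deg + 7)) := by
    intro i m f n h
    have := betaD_homog f.2.1 f.2.2
    rwa [show m.deg - i.deg - 7 = n.deg - (i.deg + 7) by rw [h]; ring] at this
  have key : ∀ {i m : DegreeCat subD} (f : i ⟶ m)
      (z : ∀ p, (GrMod.cofree W).obj.obj ⟨i.deg + twistK.shift p⟩) (n : DegreeCat A1)
      (h : n.deg = m.deg) (h' : n.deg = m.deg + 0),
      GrMod.cofree.coeff (twistK.rho (GrMod.cofree W) i.deg m.deg f.1 z false) n
        (DegreeCat.oneHom (i := ⟨m.deg + 0⟩) h')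
        = GrMod.cofree.coeff (z true) n ⟨betaD f.1, betaD_mem, hβ f n h⟩
          + GrMod.cofree.coeff (z false) n ⟨alphaD f.1, alphaD_mem, hα f n h⟩ := by
    intro i m f z n hn hn'
    have hb : betaD f.1 ∈ homog (m.deg + 0 - (i.deg + 7)) := by
      rw [← hn']; exact hβ f n hn
    have ha : alphaD f.1 ∈ homog (m.deg + 0 - (i.deg + 0)) := by
      rw [← hn']; exact hα f n hn
    have h : ∀ x y, GrMod.cofree.coeff ((GrMod.cofree W).op (i.deg + 7) (m.deg + 0) (betaD f.1) x
        + (GrMod.cofree W).op (i.deg + 0) (m.deg + 0) (alphaD f.1) y) n (DegreeCat.oneHom hn')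
        = GrMod.cofree.coeff x n ⟨betaD f.1, betaD_mem, hβ f n hn⟩
          + GrMod.cofree.coeff y n ⟨alphaD f.1, alphaD_mem, hα f n hn⟩ := by
      intro x y
      have e1 := GrMod.cofree.coeff_op (W := W) betaD_mem hb x n (DegreeCat.oneHom hn')
      have e2 := GrMod.cofree.coeff_op (W := W) alphaD_mem ha y n (DegreeCat.oneHom hn')
      refine (congrArg₂ (· + ·) e1 e2).trans (congrArg₂ (· + ·) ?_ ?_)
      · exact congrArg (GrMod.cofree.coeff x n) (Subtype.ext (one_mul _))
      · exact congrArg (GrMod.cofree.coeff y n) (Subtype.ext (one_mul _))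
    exact (congrArg (fun x => GrMod.cofree.coeff x n (DegreeCat.oneHom hn'))
      (twistK_rho_false (GrMod.cofree W) i.deg m.deg f.1 z)).trans (h _ _)
  refine GrMod.injective_of_cofree _
    (fun m => ModuleCat.of (ZMod 2) (∀ n : {n : DegreeCat A1 // n.deg = m.deg}, W n.1))
    (fun m => { toFun := fun z n => GrMod.cofree.coeff (z false) n.1
                  (DegreeCat.oneHom (i := ⟨m.deg + 0⟩) (n.2.trans (add_zero _).symm))
                map_add' := fun _ _ => rfl
                map_smul' := fun _ _ => rfl }) ?_ ?_
  · intro i z h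
    replace h : ∀ m (f : i ⟶ m) n (hn : n.deg = m.deg),
      GrMod.cofree.coeff (z true) n ⟨betaD f.1, betaD_mem, hβ f n hn⟩
          + GrMod.cofree.coeff (z false) n ⟨alphaD f.1, alphaD_mem, hα f n hn⟩ = 0 :=
      fun m f n hn => (key f z n hn (hn.trans (add_zero _).symm)).symm.trans
        (congrFun (h m f) ⟨n, hn⟩)
    funext b
    cases b
    · refine GrMod.cofree.ext (i := ⟨i.deg + 0⟩) fun n a => ?_
      have hd : a.1 ∈ homog (n.deg - i.deg) := by simpa using a.2.2
      have := h ⟨n.deg⟩ ⟨a.1, A1_le_D a.2.1, hd⟩ n rfl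
      refine Eq.trans ?_ this
      have e : ∀ (x : (GrMod.cofree W).obj.obj ⟨i.deg + 7⟩) (y : (GrMod.cofree W).obj.obj ⟨i.deg + 0⟩)
          (β : (⟨i.deg + 7⟩ : DegreeCat A1) ⟶ n) (α : (⟨i.deg + 0⟩ : DegreeCat A1) ⟶ n),
          β.1 = 0 → α.1 = a.1 → GrMod.cofree.coeff y n a =
            GrMod.cofree.coeff x n β + GrMod.cofree.coeff y n α := by
        intro x y β α hβ hα
        rw [show β = 0 from Subtype.ext hβ, show α = a from Subtype.ext hα, map_zero, zero_add]
      exact e (z true) (z false) _ _ (betaD_A1 a.2.1) (alphaD_A1 a.2.1)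
    · refine GrMod.cofree.ext (i := ⟨i.deg + 7⟩) fun n a => ?_
      have hd : a.1 * Q2 ∈ homog (n.deg - i.deg) :=
        mul_mem_homog_of_eq (by ring) a.2.2 Q2_mem_homog
      have := h ⟨n.deg⟩ ⟨a.1 * Q2, subD.mul_mem (A1_le_D a.2.1) Q2_mem_D, hd⟩ n rfl
      refine Eq.trans ?_ this
      have e : ∀ (x : (GrMod.cofree W).obj.obj ⟨i.deg + 7⟩) (y : (GrMod.cofree W).obj.obj ⟨i.deg + 0⟩)
          (β : (⟨i.deg + 7⟩ : DegreeCat A1) ⟶ n) (α : (⟨i.deg + 0⟩ : DegreeCat A1) ⟶ n),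
          β.1 = a.1 → α.1 = 0 → GrMod.cofree.coeff x n a =
            GrMod.cofree.coeff x n β + GrMod.cofree.coeff y n α := by
        intro x y β α hβ hα
        rw [show β = a from Subtype.ext hβ, show α = 0 from Subtype.ext hα, map_zero, add_zero]
      exact e (z true) (z false) _ _ (betaD_mul_Q2 a.2.1) (alphaD_mul_Q2 a.2.1)
  · intro i φ
    let y0 : (GrMod.cofree W).obj.obj ⟨i.deg + 0⟩ := fun n =>
      AddMonoidHom.mk' (fun a => φ ⟨n.deg⟩ ⟨a.1, A1_le_D a.2.1, by simpa using a.2.2⟩ ⟨n, rfl⟩)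
        (fun a a' => congrFun (map_add (φ ⟨n.deg⟩)
          ⟨a.1, A1_le_D a.2.1, by simpa using a.2.2⟩
          ⟨a'.1, A1_le_D a'.2.1, by simpa using a'.2.2⟩) ⟨n, rfl⟩)
    have hQ : ∀ {n : DegreeCat A1} (a : (⟨i.deg + 7⟩ : DegreeCat A1) ⟶ n),
        a.1 * Q2 ∈ homog (n.deg - i.deg) := fun a =>
      mul_mem_homog_of_eq (by ring) a.2.2 Q2_mem_homog
    let y1 : (GrMod.cofree W).obj.obj ⟨i.deg + 7⟩ := fun n =>
      AddMonoidHom.mk' (fun a => φ ⟨n.deg⟩ ⟨a.1 * Q2, subD.mul_mem (A1_le_D a.2.1) Q2_mem_D, hQ a⟩ ⟨n, rfl⟩)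
        (fun a a' => by
          have := congrFun (map_add (φ ⟨n.deg⟩)
            ⟨a.1 * Q2, subD.mul_mem (A1_le_D a.2.1) Q2_mem_D, hQ a⟩
            ⟨a'.1 * Q2, subD.mul_mem (A1_le_D a'.2.1) Q2_mem_D, hQ a'⟩) ⟨n, rfl⟩
          refine Eq.trans ?_ this
          exact congrArg (fun f => φ ⟨n.deg⟩ f ⟨n, rfl⟩) (Subtype.ext (add_mul _ _ _)))
    refine ⟨fun b => match b with
      | false => y0
      | true => y1, fun m f => ?_⟩
    funext ⟨n, hn⟩
    refine (key f _ n hn (hn.trans (add_zero _).symm)).trans ?_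
    obtain ⟨m⟩ := m
    obtain rfl : n.deg = m := hn
    have e := congrFun (map_add (φ ⟨n.deg⟩)
      ⟨betaD f.1 * Q2, subD.mul_mem (A1_le_D betaD_mem) Q2_mem_D,
        hQ ⟨betaD f.1, betaD_mem, hβ f n rfl⟩⟩
      ⟨alphaD f.1, A1_le_D alphaD_mem, by simpa using hα f n rfl⟩) ⟨n, rfl⟩
    refine e.symm.trans (congrArg (fun f => φ ⟨n.deg⟩ f ⟨n, rfl⟩) (Subtype.ext ?_))
    change betaD f.1 * Q2 + alphaD f.1 = f.1
    rw [add_comm]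
    exact D_decomp f.2.1

end SteenrodExt
end

noncomputable section
namespace SteenrodExt
variable {B : Subalgebra (ZMod 2) Steenrod}

/-! ### `Ext` over `subD` of the trivial module -/

theorem GrMod.op_congr (Z : GrMod B) {i j j' : ℤ} {a : Steenrod} {x : Z.obj.obj ⟨i⟩} (h : j = j')
    (hx : Z.op i j a x = 0) : Z.op i j' a x = 0 := by
  subst h
  exact hx

theorem betaD_Q2 : betaD Q2 = 1 := by
  have := betaD_mul_Q2 (one_mem A1)
  rwa [one_mul] at this

theorem alphaD_Q2 : alphaD Q2 = 0 := by
  have := alphaD_mul_Q2 (one_mem A1)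
  rwa [one_mul] at this

/-- A morphism from the trivial module to a coinduced module lands in the first factor. -/
theorem twistK_hom_true {Z : GrMod A1} (g : trivialMod subD ⟶ twistK.obj Z) :
    GrMod.app g ⟨0⟩ (trivOne subD) true = 0 := by
  have h := trivialMod_hom_op g (j := 7) (by norm_num) (a := Q2)
  have h' := congrFun ((twistK.obj_op Z Q2_mem_D (by simpa using Q2_mem_homog) _).symm.trans h) false
  have h'' := (twistK_rho_false Z 0 7 Q2 _).symm.trans h'
  have e : ∀ (x : Z.obj.obj ⟨0 + 7⟩) (y : Z.obj.obj ⟨0 + 0⟩),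
      Z.op (0 + 7) (7 + 0) (betaD Q2) x + Z.op (0 + 0) (7 + 0) (alphaD Q2) y = 0 → x = 0 := by
    intro x y h
    rw [betaD_Q2, alphaD_Q2] at h
    have e : ∀ u v : Z.obj.obj ⟨0 + 7⟩, u = x → v = 0 → u + v = 0 → x = 0 := by
      rintro _ _ rfl rfl h
      rwa [add_zero] at h
    exact e _ _ (Z.op_one (0 + 7) x) (Z.op_zero (0 + 0) (7 + 0) y) h
  exact e _ _ h''

theorem twistK_hom_op {Z : GrMod A1} (g : trivialMod subD ⟶ twistK.obj Z) {j : ℤ} (hj : j ≠ 0)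
    {d : Steenrod} (hd : d ∈ subD) (hn : d ∈ homog j) (x : Z.obj.obj ⟨0 + 0⟩)
    (hx : GrMod.app g ⟨0⟩ (trivOne subD) false = x) :
    Z.op (0 + 0) (j + 0) (alphaD d) x = 0 := by
  have h := trivialMod_hom_op g hj (a := d)
  have h' := congrFun ((twistK.obj_op Z hd (by simpa using hn) _).symm.trans h) false
  have h'' := (twistK_rho_false Z 0 j d _).symm.trans h'
  have e : ∀ (x : Z.obj.obj ⟨0 + 7⟩) (y : Z.obj.obj ⟨0 + 0⟩), x = 0 →
      Z.op (0 + 7) (j + 0) (betaD d) x + Z.op (0 + 0) (j + 0) (alphaD d) y = 0 →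
        Z.op (0 + 0) (j + 0) (alphaD d) y = 0 := by
    intro x y hx h
    rwa [hx, map_zero, zero_add] at h
  subst hx
  exact e _ _ (twistK_hom_true g) h''

theorem inclK_hom_surjective (Y : GrMod A1) (g : trivialMod subD ⟶ twistK.obj Y) :
    ∃ f : trivialMod subD ⟶ (twistPi 0).obj Y, f ≫ inclK Y = g := by
  refine ⟨trivHom (fun _ => GrMod.app g ⟨0⟩ (trivOne subD) false) ?_, trivialMod_hom_ext ?_⟩
  · intro j a hj ha hd
    refine ((twistPi 0).obj_op Y ha (by simpa using hd) _).trans ?_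
    funext p
    refine (twistPi_rho 0 Y 0 j a _ p).trans ?_
    exact twistK_hom_op g hj ha hd _ rfl
  · refine (congrArg (GrMod.app (inclK Y) ⟨0⟩) (trivHom_app _ _)).trans ?_
    funext b
    cases b
    · rfl
    · exact (twistK_hom_true g).symm

/-- The unit of the coinduction at the trivial module. -/
def unitK : trivialMod subD ⟶ twistK.obj (trivialMod A1) :=
  trivHom (fun b => match b with
    | false => trivOne A1
    | true => 0) (by
    intro j a hj ha hd
    refine (twistK.obj_op _ ha (by simpa using hd) _).trans ?_
    funext b
    cases b
    · refine (twistK_rho_false _ 0 j a _).trans ?_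
      exact (triv_subsingleton (B := A1) ⟨j + 0⟩ (by simpa using hj)).elim _ _
    · refine (twistK_rho_true _ 0 j a _).trans ?_
      exact map_zero ((trivialMod A1).op (0 + 7) (j + 7) (alphaD a)))

theorem unitK_app : GrMod.app unitK ⟨0⟩ (trivOne subD) = fun b => match b with
    | false => trivOne A1
    | true => 0 := trivHom_app _ _

theorem unitK_bijective (Z : GrMod A1) :
    Function.Bijective fun f : trivialMod A1 ⟶ Z => unitK ≫ twistK.functor.map f := by
  have hf : ∀ f : trivialMod A1 ⟶ Z,
      GrMod.app (unitK ≫ twistK.functor.map f) ⟨0⟩ (trivOne subD) false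
        = GrMod.app f ⟨0⟩ (trivOne A1) := by
    intro f
    exact congrArg (fun z : ((twistK.obj (trivialMod A1)).obj.obj ⟨0⟩) =>
      GrMod.app (twistK.functor.map f) ⟨0⟩ z false) unitK_app
  constructor
  · intro f g h
    refine trivialMod_hom_ext ?_
    refine (hf f).symm.trans (Eq.trans ?_ (hf g))
    exact congrArg (fun k : trivialMod subD ⟶ twistK.obj Z =>
      (GrMod.app k ⟨0⟩ (trivOne subD) : ∀ b, Z.obj.obj ⟨0 + twistK.shift b⟩) false) h
  · intro g
    refine ⟨trivHom (GrMod.app g ⟨0⟩ (trivOne subD) false) ?_, trivialMod_hom_ext ?_⟩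
    · intro j a hj ha hd
      refine Z.op_congr (add_zero j) ?_
      have := twistK_hom_op g hj (A1_le_D ha) hd _ rfl
      rw [alphaD_A1 ha] at this
      exact this
    · funext b
      cases b
      · exact (hf _).trans (trivHom_app _ _)
      · exact (twistK_hom_true _).trans (twistK_hom_true g).symm

theorem ext_twistK (Z : GrMod A1) (s : ℕ) :
    Nonempty (Ext (trivialMod A1) Z s ≃+ Ext (trivialMod subD) (twistK.obj Z) s) :=
  ext_change_of_rings twistK.functor unitK unitK_bijective
    (fun Z => ⟨GrMod.cofree Z.obj.obj, Z.toCofree, inferInstance, inferInstance,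
      twistK_cofree_injective _⟩) Z s

attribute [local instance] Ext.subsingleton_of_injective in
theorem inclK_ext_surjective (Y : GrMod A1) (s : ℕ) (x : Ext (trivialMod subD) (twistK.obj Y) s) :
    ∃ y : Ext (trivialMod subD) ((twistPi 0).obj Y) s,
      y.comp (Ext.mk₀ (inclK Y)) (add_zero s) = x := by
  induction s generalizing Y with
  | zero =>
    obtain ⟨g, rfl⟩ := (Ext.mk₀_bijective _ _).2 x
    obtain ⟨f, rfl⟩ := inclK_hom_surjective Y g
    exact ⟨Ext.mk₀ f, by simp⟩
  | succ s ih =>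
    let S := ShortComplex.mk _ _ (cokernel.condition Y.toCofree)
    have hS : S.ShortExact := { exact := ShortComplex.exact_cokernel _ }
    have hK := hS.map_of_exact twistK.functor
    have hP := hS.map_of_exact (twistPi 0).functor
    have : Injective (S.map twistK.functor).X₂ := twistK_cofree_injective _
    let φ : S.map (twistPi 0).functor ⟶ S.map twistK.functor :=
      { τ₁ := inclK S.X₁
        τ₂ := inclK S.X₂
        τ₃ := inclK S.X₃
        comm₁₂ := (inclK_naturality S.f).symm
        comm₂₃ := (inclK_naturality S.g).symm }
    obtain ⟨u, hu⟩ := Ext.covariant_sequence_exact₁ _ hK x (by subsingleton) rfl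
    obtain ⟨v, rfl⟩ := ih _ u
    refine ⟨v.comp hP.extClass rfl, ?_⟩
    rw [← hu]
    have nat := ShortComplex.ShortExact.extClass_naturality hP hK φ
    refine (Ext.comp_assoc (a₁₂ := s + 1) (a₂₃ := 1) v hP.extClass (Ext.mk₀ φ.τ₁) rfl (add_zero 1)
      (by omega)).trans ?_
    refine (congrArg (fun w => Ext.comp v w rfl) nat).trans ?_
    exact (Ext.comp_assoc (a₁₂ := s) (a₂₃ := 1) v (Ext.mk₀ φ.τ₃) hK.extClass (add_zero s)
      (zero_add 1) (by omega)).symm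

theorem GrMod.hom_add_self {M N : GrMod B} (f : M ⟶ N) : f + f = 0 :=
  GrMod.hom_ext fun n x => by
    rw [GrMod.add_app, GrMod.zero_app]
    have : (2 : ZMod 2) • GrMod.app f n x = 0 := by
      rw [show (2 : ZMod 2) = 0 from rfl, zero_smul]
    rwa [two_smul] at this

theorem ext_add_self {M N : GrMod B} {s : ℕ} (x : Ext M N s) : x + x = 0 := by
  have : x.comp (Ext.mk₀ (𝟙 N + 𝟙 N)) (add_zero s) = 0 := by
    rw [GrMod.hom_add_self, Ext.mk₀_zero, Ext.comp_zero]
  rwa [Ext.mk₀_add, Ext.comp_add, Ext.comp_mk₀_id] at this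

/-- Extensions of elementary abelian `2`-groups split. -/
theorem addEquiv_prod_of_exact {A E C : Type*} [AddCommGroup A] [AddCommGroup E] [AddCommGroup C]
    (f : A →+ E) (g : E →+ C) (hf : Function.Injective f) (hg : Function.Surjective g)
    (hfg : ∀ a, g (f a) = 0) (hex : ∀ x, g x = 0 → ∃ a, f a = x) (h2 : ∀ x : E, x + x = 0) :
    Nonempty (E ≃+ C × A) := by
  have h2C : ∀ x : C, x + x = 0 := fun x => by
    obtain ⟨y, rfl⟩ := hg x
    rw [← map_add, h2, map_zero]
  let _ : Module (ZMod 2) E := AddCommGroup.zmodModule fun x => by rw [two_nsmul, h2]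
  let _ : Module (ZMod 2) C := AddCommGroup.zmodModule fun x => by rw [two_nsmul, h2C]
  obtain ⟨σ, hσ⟩ := LinearMap.exists_rightInverse_of_surjective
    (AddMonoidHom.toZModLinearMap 2 g) (LinearMap.range_eq_top.2 hg)
  have hσ' : ∀ c, g (σ c) = c := fun c => congrArg (fun h => h c) hσ
  refine ⟨(AddEquiv.ofBijective (AddMonoidHom.mk' (fun p : C × A => σ p.1 + f p.2) ?_) ?_).symm⟩
  · intro p q
    simp only [Prod.fst_add, Prod.snd_add, map_add]
    abel
  · constructor
    · rw [injective_iff_map_eq_zero]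
      rintro ⟨c, a⟩ h
      change σ c + f a = 0 at h
      have hc : c = 0 := by
        have := congrArg g h
        rwa [map_add, hσ', hfg, add_zero, map_zero] at this
      rw [hc, map_zero, zero_add] at h
      have ha : a = 0 := hf (h.trans (map_zero f).symm)
      rw [hc, ha]
      rfl
    · intro x
      obtain ⟨a, ha⟩ := hex (x - σ (g x)) (by rw [map_sub, hσ', sub_self])
      exact ⟨(g x, a), by change σ (g x) + f a = x; rw [ha]; abel⟩

theorem ext_twistPi_succ (Y : GrMod A1) (s : ℕ) :
    Nonempty (Ext (trivialMod subD) ((twistPi 0).obj Y) (s + 1) ≃+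
      Ext (trivialMod subD) (twistK.obj Y) (s + 1) × Ext (trivialMod subD) ((twistPi 7).obj Y) s) := by
  have hS := seqK_shortExact Y
  refine addEquiv_prod_of_exact (hS.extClass.postcomp (trivialMod subD) rfl)
    ((Ext.mk₀ (inclK Y)).postcomp (trivialMod subD) (add_zero (s + 1))) ?_ ?_ ?_ ?_ ext_add_self
  · refine (injective_iff_map_eq_zero (hS.extClass.postcomp (trivialMod subD) rfl)).2 ?_
    intro x hx
    obtain ⟨y, rfl⟩ := Ext.covariant_sequence_exact₃ _ hS x rfl hx
    obtain ⟨w, rfl⟩ := inclK_ext_surjective Y s y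
    have e : ∀ w : Ext (trivialMod subD) (seqK Y).X₁ s,
        (w.comp (Ext.mk₀ (seqK Y).f) (add_zero s)).comp (Ext.mk₀ (seqK Y).g) (add_zero s) = 0 := by
      intro w
      rw [Ext.comp_assoc_of_third_deg_zero, Ext.mk₀_comp_mk₀, ShortComplex.zero, Ext.mk₀_zero,
        Ext.comp_zero]
    exact e w
  · exact inclK_ext_surjective Y (s + 1)
  · intro x
    have e : ∀ x : Ext (trivialMod subD) (seqK Y).X₃ s,
        (x.comp hS.extClass rfl).comp (Ext.mk₀ (seqK Y).f) (add_zero (s + 1)) = 0 := by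
      intro x
      rw [Ext.comp_assoc_of_third_deg_zero, hS.extClass_comp, Ext.comp_zero]
    exact e x
  · intro x hx
    exact Ext.covariant_sequence_exact₁ _ hS x hx rfl

theorem ext_twistPi_zero (Y : GrMod A1) :
    Nonempty (Ext (trivialMod subD) ((twistPi 0).obj Y) 0 ≃+
      Ext (trivialMod subD) (twistK.obj Y) 0) := by
  have : Mono (inclK Y) := (seqK_shortExact Y).mono_f
  exact ⟨AddEquiv.ofBijective ((Ext.mk₀ (inclK Y)).postcomp (trivialMod subD) (add_zero 0))
    ⟨Ext.postcomp_mk₀_injective_of_mono _ _, inclK_ext_surjective Y 0⟩⟩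

theorem augmentation_alphaD {d : Steenrod} (hd : d ∈ subD) :
    augmentation (alphaD d) = augmentation d := by
  have h := congrArg augmentation (D_decomp hd)
  rw [map_add, map_mul, augmentation_homog (d := 7) (by norm_num) Q2_mem_homog, mul_zero,
    add_zero] at h
  exact h

/-- An isomorphism between graded modules realized inside the same vector space. -/
theorem iso_of_values {M N : GrMod B} {V : Type} [AddCommGroup V] [Module (ZMod 2) V]
    (v : ∀ n, M.obj.obj n →ₗ[ZMod 2] V) (w : ∀ n, N.obj.obj n →ₗ[ZMod 2] V)
    (hv : ∀ n, Function.Injective (v n)) (hw : ∀ n, Function.Injective (w n))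
    (h : ∀ n, LinearMap.range (v n) = LinearMap.range (w n))
    (hact : ∀ {i j : DegreeCat B} (f : i ⟶ j) x y, v i x = w i y →
      v j (M.act f x) = w j (N.act f y)) : Nonempty (M ≅ N) := by
  let e : ∀ n, M.obj.obj n ≃ₗ[ZMod 2] N.obj.obj n := fun n =>
    (LinearEquiv.ofInjective (v n) (hv n)).trans ((LinearEquiv.ofEq _ _ (h n)).trans
      (LinearEquiv.ofInjective (w n) (hw n)).symm)
  have he : ∀ n x, w n (e n x) = v n x := by
    intro n x
    exact congrArg Subtype.val ((LinearEquiv.ofInjective (w n) (hw n)).apply_symm_apply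
      (LinearEquiv.ofEq _ _ (h n) (LinearEquiv.ofInjective (v n) (hv n) x)))
  let φ : M ⟶ N := GrMod.mkHom (fun n => (e n).toLinearMap) (fun {i j} f x => hw j (by
    change w j (e j (M.act f x)) = w j (N.act f (e i x))
    rw [he]
    exact hact f x _ (he i x).symm))
  have : IsIso φ := GrMod.isIso_of_bijective φ fun n => (e n).bijective
  exact ⟨asIso φ⟩

theorem twistPi_susp (c t : ℤ) : Nonempty
    ((twistPi c).obj (susp t (trivialMod A1)) ≅ susp (t - c) (trivialMod subD)) := by
  have hs : ∀ n : DegreeCat subD, ∀ h : n.deg + c = t, Function.Surjective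
      (suspVal (B := A1) t ⟨n.deg + c⟩) := fun n h => suspVal_surjective t ⟨n.deg + c⟩ h
  refine iso_of_values (V := ZMod 2)
    (fun n => suspVal (B := A1) t ⟨n.deg + c⟩ ∘ₗ
      LinearMap.proj (φ := fun _ : Unit => (susp t (trivialMod A1)).obj.obj ⟨n.deg + c⟩) ())
    (fun n => suspVal (t - c) n) ?_ (fun n => suspVal_injective _ n) ?_ ?_
  · intro n x y h
    funext p
    exact suspVal_injective t ⟨n.deg + c⟩ h
  · intro n
    by_cases h : n.deg + c = t
    · trans ⊤
      · rw [LinearMap.range_eq_top]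
        intro r
        obtain ⟨x, rfl⟩ := hs n h r
        exact ⟨fun _ => x, rfl⟩
      · rw [eq_comm, LinearMap.range_eq_top]
        exact suspVal_surjective _ n (by omega)
    · trans ⊥
      · rw [LinearMap.range_eq_bot]
        have := susp_subsingleton (B := A1) t ⟨n.deg + c⟩ h
        ext x
        exact (congrArg (suspVal t ⟨n.deg + c⟩) (Subsingleton.elim _ 0)).trans (map_zero _)
      · rw [eq_comm, LinearMap.range_eq_bot]
        have := susp_subsingleton (B := subD) (t - c) n (by omega)
        ext x
        exact (congrArg (suspVal (t - c) n) (Subsingleton.elim x 0)).trans (map_zero _)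
  · intro i j f x y h
    have h1 : suspVal (B := A1) t ⟨i.deg + c⟩ (x ()) = suspVal (t - c) i y := h
    have hd : alphaD f.1 ∈ homog (j.deg + c - (i.deg + c)) := by
      simpa using alphaD_homog f.2.1 f.2.2
    have h2 := suspVal_op (B := A1) t (i := i.deg + c) (j := j.deg + c) alphaD_mem hd (x ())
    have h3 := congrArg (suspVal (B := A1) t ⟨j.deg + c⟩)
      (twistPi_rho c (susp t (trivialMod A1)) i.deg j.deg f.1 x ())
    refine h3.trans (h2.trans ?_)
    rw [h1, augmentation_alphaD f.2.1, suspVal_act]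

theorem bo_cast {s s' : ℕ} {t t' : ℤ} (hs : s = s') (ht : t = t') :
    Nonempty (bo s t ≃+ bo s' t') := by
  subst hs ht
  exact ⟨AddEquiv.refl _⟩

theorem ext_cast {X : GrMod B} {s s' : ℕ} {t t' : ℤ} (hs : s = s') (ht : t = t') :
    Nonempty (ExtB X s t ≃+ ExtB X s' t') := by
  subst hs ht
  exact ⟨AddEquiv.refl _⟩

/-- Splitting off the first factor of a finite product. -/
def finConsAddEquiv {n : ℕ} (α : Fin (n + 1) → Type*) [∀ i, AddCommGroup (α i)] :
    (α 0 × ∀ i : Fin n, α i.succ) ≃+ ∀ i, α i where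
  toEquiv := Fin.consEquiv α
  map_add' x y := by
    funext i
    refine Fin.cases ?_ (fun j => ?_) i
    · rfl
    · rfl

theorem boV2_succ (s : ℕ) (t : ℤ) :
    Nonempty (bo (s + 1) t × boV2 s (t - 7) ≃+ boV2 (s + 1) t) := by
  obtain ⟨e0⟩ := bo_cast (s := s + 1) (s' := s + 1 - ((0 : Fin (s + 2)) : ℕ)) (t := t)
    (t' := t - 7 * (((0 : Fin (s + 2)) : ℕ) : ℤ)) (by simp) (by simp)
  have e : ∀ i : Fin (s + 1), Nonempty (bo (s - i) (t - 7 - 7 * ((i : ℕ) : ℤ)) ≃+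
      bo (s + 1 - (i.succ : ℕ)) (t - 7 * ((i.succ : ℕ) : ℤ))) := fun i =>
    bo_cast (by simp) (by simp; ring)
  let F : (∀ i : Fin (s + 1), bo (s - i) (t - 7 - 7 * ((i : ℕ) : ℤ))) ≃+
      ∀ i : Fin (s + 1), bo (s + 1 - (i.succ : ℕ)) (t - 7 * ((i.succ : ℕ) : ℤ)) :=
    AddEquiv.piCongrRight fun i => (e i).some
  exact ⟨(AddEquiv.prodCongr e0 ((DirectSum.addEquivProd _).trans F)).trans
    ((finConsAddEquiv fun i : Fin (s + 2) => bo (s + 1 - i) (t - 7 * ((i : ℕ) : ℤ))).trans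
      (DirectSum.addEquivProd _).symm)⟩

/-- `Ext_{subD}(ℤ₂, ℤ₂) = bo[v_2]`. -/
theorem ext_subD (s : ℕ) (t : ℤ) : Nonempty (ExtB (trivialMod subD) s t ≃+ boV2 s t) := by
  induction s generalizing t with
  | zero =>
    obtain ⟨i⟩ := twistPi_susp 0 t
    obtain ⟨e1⟩ := ext_twistPi_zero (susp t (trivialMod A1))
    obtain ⟨e2⟩ := ext_twistK (susp t (trivialMod A1)) 0
    obtain ⟨e3⟩ := ext_cast (X := trivialMod subD) (rfl : 0 = 0) (sub_zero t).symm
    obtain ⟨e4⟩ := bo_cast (s := 0) (s' := 0 - ((0 : Fin 1) : ℕ)) (t := t)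
      (t' := t - 7 * (((0 : Fin 1) : ℕ) : ℤ)) (by simp) (by simp)
    let F : (∀ i : Fin 1, bo (0 - i) (t - 7 * ((i : ℕ) : ℤ))) ≃+
        bo (0 - ((0 : Fin 1) : ℕ)) (t - 7 * (((0 : Fin 1) : ℕ) : ℤ)) :=
      { toFun := fun f => f 0
        invFun := fun x i => Fin.cases x (fun j => j.elim0) i
        left_inv := fun f => by funext i; fin_cases i; rfl
        right_inv := fun x => rfl
        map_add' := fun _ _ => rfl }
    exact ⟨e3.trans ((extCongrRight _ i 0).symm.trans (e1.trans (e2.symm.trans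
      (e4.trans (F.symm.trans (DirectSum.addEquivProd _).symm)))))⟩
  | succ s ih =>
    obtain ⟨i⟩ := twistPi_susp 0 t
    obtain ⟨i7⟩ := twistPi_susp 7 t
    obtain ⟨e1⟩ := ext_twistPi_succ (susp t (trivialMod A1)) s
    obtain ⟨e2⟩ := ext_twistK (susp t (trivialMod A1)) (s + 1)
    obtain ⟨e3⟩ := ext_cast (X := trivialMod subD) (rfl : s + 1 = s + 1) (sub_zero t).symm
    obtain ⟨e4⟩ := ih (t - 7)
    obtain ⟨e5⟩ := boV2_succ s t
    exact ⟨e3.trans ((extCongrRight _ i (s + 1)).symm.trans (e1.trans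
      ((AddEquiv.prodCongr e2.symm ((extCongrRight _ i7 s).trans e4)).trans e5)))⟩

end SteenrodExt
end

noncomputable section
namespace SteenrodExt

/-! ### Unipotent twists preserve injectivity of cofree modules -/

namespace Twist

variable {P : Type} (T : Twist A2 subD P)

/-- The right-`subD`-semilinear extension of the matrix entries to `A_2`. -/
def mix (p q : P) : Steenrod →ₗ[ZMod 2] Steenrod :=
  ∑ k, LinearMap.mulLeft (ZMod 2) (bVec k) ∘ₗ T.mat p q ∘ₗ kappa k

theorem mix_apply (p q : P) (a : Steenrod) :
    T.mix p q a = ∑ k, bVec k * T.mat p q (kappa k a) := by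
  simp [mix]

theorem mix_mem (p q : P) (a : Steenrod) : T.mix p q a ∈ A2 := by
  rw [mix_apply]
  exact sum_mem fun k _ => mul_mem (bVec_mem_A2 k) (T.mat_mem p q (kappa_mem k a))

theorem mix_homog (p q : P) {n : ℤ} {a : Steenrod} (ha : a ∈ A2) (hn : a ∈ homog n) :
    T.mix p q a ∈ homog (n + T.shift p - T.shift q) := by
  rw [mix_apply]
  exact sum_mem fun k _ => mul_mem_homog_of_eq (by ring) (bVec_mem_homog k)
    (T.mat_homog p q (kappa_mem k a) (kappa_homog k ha hn))

theorem mix_bVec_mul (p q : P) (k : Fin 4) {d : Steenrod} (hd : d ∈ subD) :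
    T.mix p q (bVec k * d) = bVec k * T.mat p q d := by
  rw [mix_apply, Finset.sum_eq_single k]
  · rw [kappa_bVec_mul k k hd, if_pos rfl]
  · intro l _ hl
    rw [kappa_bVec_mul l k hd, if_neg hl, map_zero, mul_zero]
  · simp

/-- `mix` on morphisms. -/
def mixHom (i : ℤ) (p q : P) (n : DegreeCat A2) :
    ((⟨i + T.shift p⟩ : DegreeCat A2) ⟶ n) →+ ((⟨i + T.shift q⟩ : DegreeCat A2) ⟶ n) :=
  AddMonoidHom.mk' (fun a => ⟨T.mix p q a.1, T.mix_mem p q a.1, by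
      have := T.mix_homog p q a.2.1 a.2.2
      rwa [show n.deg - (i + T.shift p) + T.shift p - T.shift q = n.deg - (i + T.shift q) by ring]
        at this⟩)
    (fun a a' => Subtype.ext (map_add (T.mix p q) a.1 a'.1))

variable {W : DegreeCat A2 → ModuleCat.{0} (ZMod 2)}

/-- The elements of the module of tuples of a cofree module. -/
abbrev Fam (W : DegreeCat A2 → ModuleCat.{0} (ZMod 2)) (i : ℤ) : Type :=
  ∀ (p : P) (n : DegreeCat A2), ((⟨i + T.shift p⟩ : DegreeCat A2) ⟶ n) →+ W n

open Classical in
/-- The strictly triangular part of the action. -/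
def nil {i : ℤ} (z : T.Fam W i) : T.Fam W i := fun p n =>
  ∑ q ∈ (T.nbr p).erase p, (z q n).comp (T.mixHom i p q n)

/-- The unipotence of a twist. -/
structure Unipotent : Prop where
  mat_self : ∀ (p : P) {d : Steenrod}, d ∈ subD → T.mat p p d = d
  self_mem : ∀ p, p ∈ T.nbr p
  shift_lt : ∀ p, ∀ q ∈ T.nbr p, q ≠ p → T.shift q < T.shift p

variable {T}

theorem Unipotent.mix_self (hT : T.Unipotent) (p : P) {a : Steenrod} (ha : a ∈ A2) :
    T.mix p p a = a := by
  rw [mix_apply]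
  conv_rhs => rw [← sum_bVec_kappa ha]
  exact Finset.sum_congr rfl fun k _ => by rw [hT.mat_self p (kappa_mem k a)]

open Classical in
theorem Unipotent.sum_mixHom (hT : T.Unipotent) {i : ℤ} (z : T.Fam W i) (p : P) (n : DegreeCat A2)
    (a : (⟨i + T.shift p⟩ : DegreeCat A2) ⟶ n) :
    ∑ q ∈ T.nbr p, z q n (T.mixHom i p q n a) = z p n a + T.nil z p n a := by
  rw [← Finset.add_sum_erase _ _ (hT.self_mem p)]
  congr 1
  · exact congrArg (z p n) (Subtype.ext (hT.mix_self p a.2.1))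
  · simp [nil]

open Classical in
theorem Unipotent.nil_congr (hT : T.Unipotent) {i : ℤ} (z z' : T.Fam W i) (e : ℤ)
    (h : ∀ p n a, e < n.deg - (i + T.shift p) → z p n a = z' p n a) (p : P) (n : DegreeCat A2)
    (a : (⟨i + T.shift p⟩ : DegreeCat A2) ⟶ n) (he : e ≤ n.deg - (i + T.shift p)) :
    T.nil z p n a = T.nil z' p n a := by
  simp only [nil, AddMonoidHom.finsetSum_apply, AddMonoidHom.comp_apply]
  refine Finset.sum_congr rfl fun q hq => h q n _ ?_
  have := hT.shift_lt p q (Finset.mem_of_mem_erase hq) (Finset.ne_of_mem_erase hq)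
  omega

theorem hom_eq_zero_of_lt {i n : DegreeCat A2} (h : 23 < n.deg - i.deg) (a : i ⟶ n) : a = 0 :=
  Subtype.ext (A2_homog_eq_zero_of_lt h a.2.1 a.2.2)

theorem Unipotent.eq_of_add_nil (hT : T.Unipotent) {i : ℤ} (z : T.Fam W i)
    (h : ∀ p n a, z p n a + T.nil z p n a = 0) : ∀ p n a, z p n a = 0 := by
  have key : ∀ r : ℕ, ∀ p n a, 23 - (r : ℤ) < n.deg - (i + T.shift p) → z p n a = 0 := by
    intro r
    induction r with
    | zero =>
      intro p n a ha
      rw [hom_eq_zero_of_lt (by simpa using ha) a, map_zero]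
    | succ r ih =>
      intro p n a ha
      have h0 := hT.nil_congr z 0 (23 - r) (fun p n a ha => ih p n a ha) p n a
        (by push_cast at ha; omega)
      have h1 : T.nil (0 : T.Fam W i) p n a = 0 := by simp [nil]
      have := h p n a
      rwa [h0, h1, add_zero] at this
  intro p n a
  exact key (24 + (n.deg - (i + T.shift p)).natAbs) p n a (by
    have := neg_abs_le (n.deg - (i + T.shift p))
    push_cast
    linarith)

theorem Unipotent.exists_add_nil (hT : T.Unipotent) {i : ℤ} (ψ : T.Fam W i) :
    ∃ z : T.Fam W i, ∀ p n a, z p n a + T.nil z p n a = ψ p n a := by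
  let step : T.Fam W i → T.Fam W i := fun z p n => ψ p n - T.nil z p n
  have key : ∀ r : ℕ, ∀ p n a, 23 - (r : ℤ) < n.deg - (i + T.shift p) →
      step^[r] 0 p n a = step^[r + 1] 0 p n a := by
    intro r
    induction r with
    | zero =>
      intro p n a ha
      rw [hom_eq_zero_of_lt (by simpa using ha) a, map_zero, map_zero]
    | succ r ih =>
      intro p n a ha
      rw [Function.iterate_succ_apply', Function.iterate_succ_apply' step (r + 1)]
      change ψ p n a - T.nil _ p n a = ψ p n a - T.nil _ p n a
      rw [hT.nil_congr _ _ (23 - r) (fun p n a ha => ih p n a ha) p n a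
        (by push_cast at ha; omega)]
  refine ⟨step^[24] 0, fun p n a => ?_⟩
  have e : step^[24] 0 p n a = ψ p n a - T.nil (step^[24] 0) p n a := by
    by_cases h : n.deg < i + T.shift p
    · rw [DegreeCat.eq_zero_of_lt h a, map_zero, map_zero, map_zero, sub_zero]
    · rw [key 24 p n a (by push_cast; omega), Function.iterate_succ_apply']
      rfl
  exact eq_sub_iff_add_eq.1 e

variable (T)

/-- `b_k` as a morphism. -/
def bHom {m : ℤ} (p : P) (k : Fin 4) (n : DegreeCat A2) (h : n.deg = m + T.shift p + bDeg k) :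
    (⟨m + T.shift p⟩ : DegreeCat A2) ⟶ n :=
  ⟨bVec k, bVec_mem_A2 k, by
    rw [h, add_sub_cancel_left]; exact bVec_mem_homog k⟩

/-- `b_k f` as a morphism. -/
def bMul {i m : DegreeCat subD} (f : i ⟶ m) (p : P) (k : Fin 4) (n : DegreeCat A2)
    (h : n.deg = m.deg + T.shift p + bDeg k) : (⟨i.deg + T.shift p⟩ : DegreeCat A2) ⟶ n :=
  ⟨bVec k * f.1, A2.mul_mem (bVec_mem_A2 k) (D_le_A2 f.2.1),
    mul_mem_homog_of_eq (by rw [h]; ring) (bVec_mem_homog k) f.2.2⟩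

theorem coeff_rho {i m : DegreeCat subD} (f : i ⟶ m)
    (z : ∀ p, (GrMod.cofree W).obj.obj ⟨i.deg + T.shift p⟩) (p : P) (k : Fin 4) (n : DegreeCat A2)
    (h : n.deg = m.deg + T.shift p + bDeg k) :
    GrMod.cofree.coeff (T.rho (GrMod.cofree W) i.deg m.deg f.1 z p) n (T.bHom p k n h)
      = ∑ q ∈ T.nbr p, GrMod.cofree.coeff (z q) n (T.mixHom i.deg p q n (T.bMul f p k n h)) := by
  rw [rho_apply]
  have hs : ∀ (s : Finset P) (x : P → (GrMod.cofree W).obj.obj ⟨m.deg + T.shift p⟩)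
      (b : (⟨m.deg + T.shift p⟩ : DegreeCat A2) ⟶ n),
      GrMod.cofree.coeff (∑ q ∈ s, x q) n b = ∑ q ∈ s, GrMod.cofree.coeff (x q) n b := by
    intro s x b
    exact map_sum (AddMonoidHom.mk' (fun y : (GrMod.cofree W).obj.obj ⟨m.deg + T.shift p⟩ =>
      GrMod.cofree.coeff y n b) (fun _ _ => rfl)) x s
  refine (hs _ _ _).trans (Finset.sum_congr rfl fun q _ => ?_)
  refine (GrMod.cofree.coeff_op (T.mat_mem p q f.2.1) (T.mat_homog' p q f.2.1 f.2.2) _ _ _).trans ?_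
  refine congrArg (GrMod.cofree.coeff (z q) n) (Subtype.ext ?_)
  exact (T.mix_bVec_mul p q k f.2.1).symm

variable {T}

theorem Unipotent.eq_zero_of_sum (hT : T.Unipotent) {i : DegreeCat subD} (z : T.Fam W i.deg)
    (h : ∀ m (f : i ⟶ m) p k (n : DegreeCat A2) (hn : n.deg = m.deg + T.shift p + bDeg k),
      ∑ q ∈ T.nbr p, z q n (T.mixHom i.deg p q n (T.bMul f p k n hn)) = 0) :
    ∀ p n a, z p n a = 0 := by
  refine hT.eq_of_add_nil z fun p n a => ?_
  rw [← hT.sum_mixHom]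
  have e : a = ∑ k, T.bMul (i := i) (m := ⟨n.deg - T.shift p - bDeg k⟩)
      ⟨kappa k a.1, kappa_mem k a.1, by
        have := kappa_homog k a.2.1 a.2.2
        rwa [show n.deg - (i.deg + T.shift p) - bDeg k
          = n.deg - T.shift p - bDeg k - i.deg by ring] at this⟩ p k n (by ring) := by
    apply Subtype.ext
    rw [AddSubmonoidClass.coe_finsetSum]
    exact (sum_bVec_kappa a.2.1).symm
  rw [e]
  simp only [map_sum]
  rw [Finset.sum_comm]
  exact Finset.sum_eq_zero fun k _ => h _ _ p k n _

theorem Unipotent.cofree_injective (hT : T.Unipotent) (W : DegreeCat A2 → ModuleCat.{0} (ZMod 2)) :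
    Injective (T.obj (GrMod.cofree W)) := by
  refine GrMod.injective_of_cofree _ (fun m => ModuleCat.of (ZMod 2)
      (∀ (p : P) (k : Fin 4) (n : {n : DegreeCat A2 // n.deg = m.deg + T.shift p + bDeg k}), W n.1))
    (fun m => { toFun := fun z p k n => GrMod.cofree.coeff (z p) n.1 (T.bHom p k n.1 n.2)
                map_add' := fun _ _ => rfl
                map_smul' := fun _ _ => rfl }) ?_ ?_
  · intro i z h
    have h1 : ∀ m (f : i ⟶ m) p k (n : DegreeCat A2) (hn : n.deg = m.deg + T.shift p + bDeg k),
        ∑ q ∈ T.nbr p, GrMod.cofree.coeff (z q) n (T.mixHom i.deg p q n (T.bMul f p k n hn)) = 0 :=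
      fun m f p k n hn => (T.coeff_rho f z p k n hn).symm.trans
        (congrFun (congrFun (congrFun (h m f) p) k) ⟨n, hn⟩)
    have h2 := hT.eq_zero_of_sum (i := i) z h1
    funext p
    exact GrMod.cofree.ext (fun n a => h2 p n a)
  · intro i φ
    have hκ : ∀ (p : P) (k : Fin 4) (n : DegreeCat A2)
        (a : (⟨i.deg + T.shift p⟩ : DegreeCat A2) ⟶ n),
        kappa k a.1 ∈ homog (n.deg - T.shift p - bDeg k - i.deg) := by
      intro p k n a
      have := kappa_homog k a.2.1 a.2.2
      rwa [show n.deg - (i.deg + T.shift p) - bDeg k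
        = n.deg - T.shift p - bDeg k - i.deg by ring] at this
    let κ : ∀ (p : P) (k : Fin 4) (n : DegreeCat A2),
        ((⟨i.deg + T.shift p⟩ : DegreeCat A2) ⟶ n) →+ (i ⟶ ⟨n.deg - T.shift p - bDeg k⟩) :=
      fun p k n => AddMonoidHom.mk' (fun a => ⟨kappa k a.1, kappa_mem k a.1, hκ p k n a⟩)
        (fun a a' => Subtype.ext (map_add (kappa k) a.1 a'.1))
    let ev : ∀ (m : DegreeCat subD) (p : P) (k : Fin 4)
        (n : {n : DegreeCat A2 // n.deg = m.deg + T.shift p + bDeg k}), (i ⟶ m) →+ W n.1 :=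
      fun m p k n => AddMonoidHom.mk' (fun f => φ m f p k n) (fun f f' =>
        congrFun (congrFun (congrFun (map_add (φ m) f f') p) k) n)
    let ψ : T.Fam W i.deg := fun p n =>
      ∑ k, (ev ⟨n.deg - T.shift p - bDeg k⟩ p k ⟨n, by ring⟩).comp (κ p k n)
    obtain ⟨z, hz⟩ := hT.exists_add_nil ψ
    refine ⟨z, fun m f => ?_⟩
    funext p k ⟨n, hn⟩
    refine (T.coeff_rho f z p k n hn).trans ((hT.sum_mixHom z p n _).trans ((hz p n _).trans ?_))
    simp only [ψ, AddMonoidHom.finsetSum_apply, AddMonoidHom.comp_apply]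
    rw [Finset.sum_eq_single k]
    · obtain ⟨m⟩ := m
      obtain rfl : m = n.deg - T.shift p - bDeg k := by
        have : n.deg = m + T.shift p + bDeg k := hn
        omega
      refine congrArg (fun g => φ _ g p k ⟨n, hn⟩) (Subtype.ext ?_)
      exact (kappa_bVec_mul k k f.2.1).trans (if_pos rfl)
    · intro l _ hl
      have : κ p l n (T.bMul f p k n hn) = 0 :=
        Subtype.ext ((kappa_bVec_mul l k f.2.1).trans (if_neg hl))
      rw [this, map_zero]
    · simp

end Twist

end SteenrodExt
end

noncomputable section
namespace SteenrodExt
variable {B B' : Subalgebra (ZMod 2) Steenrod}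

/-! ### Ext groups through a unipotent twist -/

theorem exists_suspVal_eq {t t' : ℤ} {n : DegreeCat B} {n' : DegreeCat B'}
    (h : n.deg = t ↔ n'.deg = t') (x : (susp t (trivialMod B)).obj.obj n) :
    ∃ y, suspVal (B := B') t' n' y = suspVal t n x := by
  by_cases hn : n.deg = t
  · exact suspVal_surjective t' n' (h.1 hn) _
  · have := susp_subsingleton (B := B) t n hn
    exact ⟨0, by rw [Subsingleton.elim x 0, map_zero, map_zero]⟩

namespace Twist

variable {P : Type} {T : Twist A2 subD P}

theorem Unipotent.suspVal_rho (hT : T.Unipotent)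
    (haug : ∀ p q, p ≠ q → ∀ d ∈ subD, augmentation (T.mat p q d) = 0) (t : ℤ)
    {i j : ℤ} {d : Steenrod} (hd : d ∈ subD) (hn : d ∈ homog (j - i))
    (z : ∀ p, (susp t (trivialMod A2)).obj.obj ⟨i + T.shift p⟩) (p : P) :
    suspVal t ⟨j + T.shift p⟩ (T.rho (susp t (trivialMod A2)) i j d z p)
      = augmentation d * suspVal t ⟨i + T.shift p⟩ (z p) := by
  rw [rho_apply, map_sum, Finset.sum_eq_single p]
  · rw [suspVal_op t (T.mat_mem p p hd) (T.mat_homog' p p hd hn), hT.mat_self p hd]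
  · intro q _ hq
    rw [suspVal_op t (T.mat_mem p q hd) (T.mat_homog' p q hd hn), haug p q hq.symm d hd, zero_mul]
  · exact fun h => absurd (hT.self_mem p) h

theorem Unipotent.obj_susp (hT : T.Unipotent)
    (haug : ∀ p q, p ≠ q → ∀ d ∈ subD, augmentation (T.mat p q d) = 0) (t : ℤ) :
    Nonempty (T.obj (susp t (trivialMod A2)) ≅
      GrMod.prod fun p => susp (t - T.shift p) (trivialMod subD)) := by
  refine iso_of_values (V := P → ZMod 2)
    (fun n => LinearMap.pi fun p => suspVal (B := A2) t ⟨n.deg + T.shift p⟩ ∘ₗ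
      LinearMap.proj (φ := fun p => (susp t (trivialMod A2)).obj.obj ⟨n.deg + T.shift p⟩) p)
    (fun n => LinearMap.pi fun p => suspVal (B := subD) (t - T.shift p) n ∘ₗ
      LinearMap.proj (φ := fun p => (susp (t - T.shift p) (trivialMod subD)).obj.obj n) p)
    ?_ ?_ ?_ ?_
  · intro n x y h
    funext p
    exact suspVal_injective t ⟨n.deg + T.shift p⟩ (congrFun h p)
  · intro n x y h
    funext p
    exact suspVal_injective _ n (congrFun h p)
  · intro n
    have hd : ∀ p, (⟨n.deg + T.shift p⟩ : DegreeCat A2).deg = t ↔ n.deg = t - T.shift p :=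
      fun p => eq_sub_iff_add_eq.symm
    apply le_antisymm
    · rintro _ ⟨x, rfl⟩
      choose y hy using fun p => exists_suspVal_eq (hd p) (x p)
      exact ⟨y, funext hy⟩
    · rintro _ ⟨x, rfl⟩
      choose y hy using fun p => exists_suspVal_eq (hd p).symm (x p)
      exact ⟨y, funext hy⟩
  · intro i j f x y h
    funext p
    refine (hT.suspVal_rho haug t f.2.1 f.2.2 x p).trans ?_
    have hp : suspVal (B := A2) t ⟨i.deg + T.shift p⟩ (x p) = suspVal (t - T.shift p) i (y p) :=
      congrFun h p
    rw [hp]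
    rfl

/-- The Ext groups of a module represented, through a unipotent twist, by the trivial module. -/
theorem Unipotent.ext (hT : T.Unipotent)
    (haug : ∀ p q, p ≠ q → ∀ d ∈ subD, augmentation (T.mat p q d) = 0) {X : GrMod A2}
    (η : trivialMod subD ⟶ T.obj X)
    (hη : ∀ Z, Function.Bijective fun f : X ⟶ Z => η ≫ T.functor.map f) (s : ℕ) (t : ℤ) :
    Nonempty (ExtB X s t ≃+ ∀ p, boV2 s (t - T.shift p)) := by
  obtain ⟨e⟩ := ext_change_of_rings T.functor η hη
    (fun Z => ⟨GrMod.cofree Z.obj.obj, Z.toCofree, inferInstance, inferInstance,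
      hT.cofree_injective _⟩) (susp t (trivialMod A2)) s
  obtain ⟨i⟩ := hT.obj_susp haug t
  exact ⟨e.trans ((extCongrRight _ i s).trans
    ((AddEquiv.ofBijective _ (extProdComparison_bijective _ _ s)).trans
      (AddEquiv.piCongrRight fun p => (ext_subD s (t - T.shift p)).some)))⟩

end Twist

/-! ### The module `M_10` -/

theorem kappa_mul (k : Fin 4) {x d : Steenrod} (hx : x ∈ A2) (hd : d ∈ subD) :
    kappa k (x * d) = kappa k x * d := by
  conv_lhs => rw [← sum_bVec_kappa hx, Finset.sum_mul, map_sum]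
  simp only [mul_assoc]
  rw [Finset.sum_eq_single k]
  · rw [kappa_bVec_mul k k (mul_mem (kappa_mem k x) hd), if_pos rfl]
  · intro l _ hl
    rw [kappa_bVec_mul k l (mul_mem (kappa_mem l x) hd), if_neg hl.symm]
  · simp

/-- The coordinates of `A_2 ⊗_{subD} ℤ₂`. -/
def augK (k : Fin 4) : Steenrod →ₗ[ZMod 2] ZMod 2 := augmentation.toLinearMap ∘ₗ kappa k

theorem augK_apply (k : Fin 4) (x : Steenrod) : augK k x = augmentation (kappa k x) := rfl

theorem augK_bVec (k l : Fin 4) : augK k (bVec l) = if k = l then 1 else 0 := by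
  have := kappa_bVec_mul k l (one_mem subD)
  rw [mul_one] at this
  rw [augK_apply, this]
  split_ifs <;> simp

theorem augK_eq_zero (k : Fin 4) {n : ℤ} (h : n ≠ bDeg k) {x : Steenrod} (hx : x ∈ A2)
    (hn : x ∈ homog n) : augK k x = 0 :=
  augmentation_homog (sub_ne_zero.2 h) (kappa_homog k hx hn)

theorem augK_mul (k : Fin 4) {x y : Steenrod} (hx : x ∈ A2) (hy : y ∈ A2) :
    augK k (x * y) = ∑ l, augK k (x * bVec l) * augK l y := by
  conv_lhs => rw [← sum_bVec_kappa hy, Finset.mul_sum, map_sum]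
  refine Finset.sum_congr rfl fun l _ => ?_
  rw [augK_apply, ← mul_assoc, kappa_mul k (mul_mem hx (bVec_mem_A2 l)) (kappa_mem l y), map_mul]
  rfl

theorem augmentation_Q1 : augmentation Q1 = 0 :=
  augmentation_homog (d := 3) (by norm_num) Q1_mem_homog

theorem augmentation_Q2 : augmentation Q2 = 0 :=
  augmentation_homog (d := 7) (by norm_num) Q2_mem_homog

/-- The ideal of `A_2` defining `M_10`. -/
abbrev M10.ideal : Submodule A2 A2 := Submodule.span A2 {sq1, sq2, sq1 * sq2 * sq4}

theorem augK_mul_D (k : Fin 4) {x d : Steenrod} (hx : x ∈ A2) (hd : d ∈ subD) :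
    augK k (x * d) = augK k x * augmentation d := by
  rw [augK_apply, kappa_mul k hx hd, map_mul, augK_apply]

theorem M10.augK_ideal (k : Fin 4) (a : A2) (ha : a ∈ M10.ideal) : augK k a.1 = 0 := by
  induction ha using Submodule.span_induction generalizing k with
  | mem a ha =>
    have h0 : ∀ (b d : Steenrod), b ∈ A2 → d ∈ subD → augmentation d = 0 → augK k (b * d) = 0 := by
      intro b d hb hd h
      rw [augK_mul_D k hb hd, h, mul_zero]
    have a1 : augmentation (Sq 1) = 0 := by rw [augmentation_Sq]; simp
    have a2 : augmentation (Sq 2) = 0 := by rw [augmentation_Sq]; simp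
    rcases ha with rfl | rfl | rfl
    · simpa [sq1] using h0 1 (Sq 1) (one_mem _) Sq_one_mem_D a1
    · simpa [sq2] using h0 1 (Sq 2) (one_mem _) Sq_two_mem_D a2
    · change augK k (Sq 1 * Sq 2 * Sq 4) = 0
      have e : Sq 1 * Sq 2 * Sq 4 = bVec 2 * Sq 1 + bVec 1 * Q1 + bVec 0 * Q2 := by
        rw [← one_mul_b_two, mul_assoc]
        rfl
      rw [e, map_add, map_add, h0 _ _ (bVec_mem_A2 2) Sq_one_mem_D a1,
        h0 _ _ (bVec_mem_A2 1) Q1_mem_D augmentation_Q1,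
        h0 _ _ (bVec_mem_A2 0) Q2_mem_D augmentation_Q2, add_zero, add_zero]
  | zero => exact map_zero _
  | add a b _ _ ha hb => exact (map_add (augK k) a.1 b.1).trans (by rw [ha, hb, add_zero])
  | smul c a _ ha =>
    refine (augK_mul k c.2 a.2).trans (Finset.sum_eq_zero fun l _ => ?_)
    rw [ha, mul_zero]

/-- The coordinates on `M_10`. -/
def M10.coord : M10Carrier →ₗ[ZMod 2] (Fin 4 → ZMod 2) :=
  (Submodule.liftQ (M10.ideal.restrictScalars (ZMod 2))
    (LinearMap.pi fun k => augK k ∘ₗ (Subalgebra.toSubmodule A2).subtype)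
    (fun a ha => LinearMap.mem_ker.2 (funext fun k => M10.augK_ideal k a ha))) ∘ₗ
  (Submodule.Quotient.restrictScalarsEquiv (ZMod 2) M10.ideal).symm.toLinearMap

theorem M10.mk_add (a b : A2) : M10.mk (a + b) = M10.mk a + M10.mk b := rfl

theorem M10.mk_mul (a b : A2) : M10.mk (a * b) = a • M10.mk b := rfl

theorem M10.mk_smul (c : ZMod 2) (b : A2) : M10.mk (c • b) = c • M10.mk b := rfl

theorem M10.mk_eq_zero {a : A2} : M10.mk a = 0 ↔ a ∈ M10.ideal :=
  Submodule.Quotient.mk_eq_zero _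

theorem M10.mk_Q2 : M10.mk ⟨Q2, Q2_mem_A2⟩ = 0 := by
  rw [M10.mk_eq_zero]
  have h1 : sq1 ∈ M10.ideal := Submodule.subset_span (by simp)
  have h2 : sq2 ∈ M10.ideal := Submodule.subset_span (by simp)
  have h3 : sq1 * sq2 * sq4 ∈ M10.ideal := Submodule.subset_span (by simp)
  have e : (⟨Q2, Q2_mem_A2⟩ : A2) = sq1 * sq2 * sq4 +
      ((sq2 * sq4) • sq1 + ((sq4 * sq1) • sq2 + (sq4 * sq2) • sq1)) := by
    apply Subtype.ext
    change Q2 = Sq 1 * Sq 2 * Sq 4 +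
      ((Sq 2 * Sq 4) * Sq 1 + ((Sq 4 * Sq 1) * Sq 2 + (Sq 4 * Sq 2) * Sq 1))
    have h : Sq 1 * Sq 2 * Sq 4 = Sq 2 * Sq 4 * Sq 1 + Sq 4 * Q1 + 1 * Q2 := by
      rw [mul_assoc]
      exact one_mul_b_two
    have hq : Sq 4 * Q1 = Sq 4 * Sq 1 * Sq 2 + Sq 4 * Sq 2 * Sq 1 := by
      rw [Q1]
      noncomm_ring
    rw [h, ← hq]
    apply steenrod_eq_of_add
    rw [one_mul]
    abel_nf
    simp [steenrod_two]
  rw [e]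
  exact add_mem h3 (add_mem (Submodule.smul_mem _ _ h1)
    (add_mem (Submodule.smul_mem _ _ h2) (Submodule.smul_mem _ _ h1)))

theorem M10.mk_D {d : Steenrod} (hd : d ∈ subD) :
    M10.mk ⟨d, D_le_A2 hd⟩ = augmentation d • M10.mk 1 := by
  let S : Submodule (ZMod 2) Steenrod :=
    { carrier := {x | ∃ h : x ∈ A2, M10.mk ⟨x, h⟩ = augmentation x • M10.mk 1}
      add_mem' := by
        rintro x y ⟨hx, ex⟩ ⟨hy, ey⟩
        exact ⟨add_mem hx hy, (M10.mk_add ⟨x, hx⟩ ⟨y, hy⟩).trans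
          (by rw [ex, ey, map_add, add_smul])⟩
      zero_mem' := ⟨zero_mem _, by rw [map_zero, zero_smul]; rfl⟩
      smul_mem' := by
        rintro c x ⟨hx, ex⟩
        exact ⟨A2.smul_mem hx c, (M10.mk_smul c ⟨x, hx⟩).trans
          (by rw [ex, map_smul, smul_smul, smul_eq_mul])⟩ }
  have key : d ∈ S := by
    refine adjoin_le_of_mul_mem (G := {Sq 1, Sq 2, Q2}) S ⟨one_mem _, ?_⟩ ?_ hd
    · rw [map_one, one_smul]
      rfl
    · have h : ∀ (g : Steenrod) (hg : g ∈ A2), M10.mk ⟨g, hg⟩ = 0 → augmentation g = 0 →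
          ∀ x ∈ S, g * x ∈ S := by
        rintro g hg e0 a0 x ⟨hx, ex⟩
        refine ⟨A2.mul_mem hg hx, (M10.mk_mul ⟨g, hg⟩ ⟨x, hx⟩).trans ?_⟩
        rw [ex, map_mul, a0, zero_mul, zero_smul, smul_comm, ← M10.mk_mul, mul_one, e0, smul_zero]
      rintro _ (rfl | rfl | rfl)
      · exact h _ sq1.2 (M10.mk_eq_zero.2 (Submodule.subset_span (by simp [sq1])))
          (by rw [augmentation_Sq]; simp)
      · exact h _ sq2.2 (M10.mk_eq_zero.2 (Submodule.subset_span (by simp [sq2])))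
          (by rw [augmentation_Sq]; simp)
      · exact h _ Q2_mem_A2 M10.mk_Q2 augmentation_Q2
  exact key.2

theorem M10.basisVec_eq (k : Fin 4) : M10.basisVec k = M10.mk ⟨bVec k, bVec_mem_A2 k⟩ := by
  fin_cases k
  · rfl
  · rfl
  · rfl
  · exact congrArg M10.mk (mul_assoc sq4 sq2 sq4)

theorem M10.sum_coord (v : M10Carrier) : ∑ k, M10.coord v k • M10.basisVec k = v := by
  obtain ⟨a, rfl⟩ := Submodule.Quotient.mk_surjective _ v
  change ∑ k, augK k a.1 • M10.basisVec k = M10.mk a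
  have e : a = ∑ k, (⟨bVec k, bVec_mem_A2 k⟩ * ⟨kappa k a.1, D_le_A2 (kappa_mem k a.1)⟩ : A2) := by
    apply Subtype.ext
    rw [AddSubmonoidClass.coe_finsetSum]
    exact (sum_bVec_kappa a.2).symm
  have hs : ∀ f : Fin 4 → A2, M10.mk (∑ k, f k) = ∑ k, M10.mk (f k) := fun f =>
    map_sum (M10.ideal.mkQ) f _
  conv_rhs => rw [e, hs]
  refine Finset.sum_congr rfl fun k _ => ?_
  rw [M10.mk_mul, M10.mk_D (kappa_mem k a.1), smul_comm, ← M10.mk_mul, mul_one, M10.basisVec_eq]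
  rfl

theorem M10.coord_basisVec (k l : Fin 4) : M10.coord (M10.basisVec l) k = if k = l then 1 else 0 := by
  rw [M10.basisVec_eq]
  exact augK_bVec k l

theorem M10.linearIndependent_basisVec : LinearIndependent (ZMod 2) M10.basisVec := by
  rw [Fintype.linearIndependent_iff]
  intro g hg k
  have := congrFun (congrArg M10.coord hg) k
  simpa [M10.coord_basisVec] using this

theorem M10.span_basisVec : Submodule.span (ZMod 2) (Set.range M10.basisVec) = ⊤ := by
  refine eq_top_iff.2 fun v _ => ?_
  rw [← M10.sum_coord v]
  exact sum_mem fun k _ => Submodule.smul_mem _ _ (Submodule.subset_span ⟨k, rfl⟩)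

end SteenrodExt
end

noncomputable section
namespace SteenrodExt

/-! ### The Ext groups of `M_10` -/

/-- An element killed by the augmentation ideal of `subD` generates a quotient of `M_10`. -/
theorem op_eq_sum_augK {Z : GrMod A2} {m : ℤ} (z : Z.obj.obj ⟨m⟩)
    (h : ∀ (j : ℤ) (d : Steenrod), j ≠ m → d ∈ subD → d ∈ homog (j - m) → Z.op m j d z = 0)
    {n : ℤ} {a : Steenrod} (ha : a ∈ A2) (hd : a ∈ homog (n - m)) :
    Z.op m n a z = ∑ k, augK k a • Z.op m n (bVec k) z := by
  have hκ : ∀ k, kappa k a ∈ homog (n - bDeg k - m) := fun k => by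
    have := kappa_homog k ha hd
    rwa [show n - m - bDeg k = n - bDeg k - m by ring] at this
  have hb : ∀ k, bVec k ∈ homog (n - (n - bDeg k)) := fun k => by
    rw [sub_sub_cancel]
    exact bVec_mem_homog k
  conv_lhs => rw [← sum_bVec_kappa ha]
  rw [Z.op_sum _ _ (fun k _ => mul_mem (bVec_mem_A2 k) (D_le_A2 (kappa_mem k a)))
    (fun k _ => mul_mem_homog_of_eq (by ring) (hb k) (hκ k))]
  refine Finset.sum_congr rfl fun k _ => ?_
  by_cases hk : n - bDeg k = m
  · have h0 : kappa k a ∈ homog 0 := by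
      have := hκ k
      rwa [hk, sub_self] at this
    rw [homog_zero_eq h0, mul_smul_comm, mul_one, Z.op_smul]
    rfl
  · rw [Z.op_mul (bVec_mem_A2 k) (hb k) (D_le_A2 (kappa_mem k a)) (hκ k),
      h _ _ hk (kappa_mem k a) (hκ k), map_zero,
      augK_eq_zero k (fun e => hk (by omega)) ha hd, zero_smul]

namespace M10

/-- The class of a homogeneous element. -/
def elt (n : ℤ) (a : Steenrod) (ha : a ∈ A2) (hd : a ∈ homog n) : M10.obj.obj ⟨n⟩ :=
  ⟨M10.mk ⟨a, ha⟩, Submodule.subset_span ⟨⟨a, ha⟩, hd, rfl⟩⟩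

/-- The element of the cyclic module underlying a homogeneous element. -/
def val (n : ℤ) : M10.obj.obj ⟨n⟩ →ₗ[ZMod 2] M10Carrier :=
  Submodule.subtype (Submodule.span (ZMod 2)
    {v | ∃ a : A2, (a : Steenrod) ∈ homog n ∧ v = M10.mk a})

theorem val_injective (n : ℤ) : Function.Injective (val n) := Subtype.val_injective

theorem val_elt (n : ℤ) (a : Steenrod) (ha : a ∈ A2) (hd : a ∈ homog n) :
    val n (elt n a ha hd) = M10.mk ⟨a, ha⟩ := rfl

theorem exists_elt (n : ℤ) (v : M10.obj.obj ⟨n⟩) : ∃ a ha hd, v = elt n a ha hd := by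
  obtain ⟨v, hv⟩ := v
  suffices h : ∃ a : A2, (a : Steenrod) ∈ homog n ∧ v = M10.mk a by
    obtain ⟨a, ha, rfl⟩ := h
    exact ⟨a.1, a.2, ha, rfl⟩
  induction hv using Submodule.span_induction with
  | mem v hv => exact hv
  | zero => exact ⟨0, zero_mem _, rfl⟩
  | add v w _ _ hv hw =>
    obtain ⟨a, ha, rfl⟩ := hv
    obtain ⟨b, hb, rfl⟩ := hw
    exact ⟨a + b, add_mem ha hb, rfl⟩
  | smul c v _ hv =>
    obtain ⟨a, ha, rfl⟩ := hv
    exact ⟨c • a, Submodule.smul_mem _ _ ha, rfl⟩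

theorem op_elt {i j : ℤ} {b : Steenrod} (hb : b ∈ A2) (hj : b ∈ homog (j - i)) {a : Steenrod}
    (ha : a ∈ A2) (hd : a ∈ homog i) :
    M10.op i j b (elt i a ha hd) =
      elt j (b * a) (A2.mul_mem hb ha) (mul_mem_homog_of_eq (by ring) hj hd) := by
  rw [M10.op_eq hb hj]
  rfl

/-- The generator. -/
def one : M10.obj.obj ⟨0⟩ := elt 0 1 (one_mem _) one_mem_homog

theorem op_one_elt {n : ℤ} {a : Steenrod} (ha : a ∈ A2) (hd : a ∈ homog n) :
    M10.op 0 n a one = elt n a ha hd := by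
  rw [one, op_elt ha (by simpa using hd)]
  congr 1
  exact mul_one a

theorem op_one_D {j : ℤ} {d : Steenrod} (hj : j ≠ 0) (hd : d ∈ subD) (hn : d ∈ homog (j - 0)) :
    M10.op 0 j d one = 0 := by
  rw [op_one_elt (D_le_A2 hd) (by simpa using hn)]
  apply val_injective
  rw [val_elt, M10.mk_D hd, augmentation_homog (by simpa using hj) hn, zero_smul, map_zero]

/-- The morphism from `M_10` given by an element killed by the augmentation ideal of `subD`. -/
def desc {Z : GrMod A2} (z : Z.obj.obj ⟨0⟩)
    (h : ∀ (j : ℤ) (d : Steenrod), j ≠ 0 → d ∈ subD → d ∈ homog (j - 0) → Z.op 0 j d z = 0) :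
    M10 ⟶ Z :=
  GrMod.homOfOp (fun n => ∑ k, (LinearMap.proj k ∘ₗ M10.coord ∘ₗ val n).smulRight
      (Z.op 0 n (bVec k) z)) (by
    have key : ∀ (n : ℤ) (a : Steenrod) (ha : a ∈ A2) (hd : a ∈ homog n),
        (∑ k, (LinearMap.proj k ∘ₗ M10.coord ∘ₗ val n).smulRight (Z.op 0 n (bVec k) z))
          (elt n a ha hd) = Z.op 0 n a z := by
      intro n a ha hd
      rw [op_eq_sum_augK z h ha (by simpa using hd), LinearMap.sum_apply]
      rfl
    intro i j b hb hj x
    obtain ⟨a, ha, hd, rfl⟩ := exists_elt i x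
    rw [op_elt hb hj, key, key, Z.op_mul hb hj ha (by simpa using hd)])

theorem desc_app {Z : GrMod A2} (z : Z.obj.obj ⟨0⟩)
    (h : ∀ (j : ℤ) (d : Steenrod), j ≠ 0 → d ∈ subD → d ∈ homog (j - 0) → Z.op 0 j d z = 0) :
    GrMod.app (desc z h) ⟨0⟩ one = z := by
  change (∑ k, (LinearMap.proj k ∘ₗ M10.coord ∘ₗ val 0).smulRight (Z.op 0 0 (bVec k) z))
      (elt 0 1 _ _) = z
  have := op_eq_sum_augK z h (one_mem A2) (by simpa using one_mem_homog)
  rw [Z.op_one] at this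
  rw [LinearMap.sum_apply]
  exact this.symm

theorem hom_ext {Z : GrMod A2} {f g : M10 ⟶ Z} (h : GrMod.app f ⟨0⟩ one = GrMod.app g ⟨0⟩ one) :
    f = g := by
  refine GrMod.hom_ext fun n x => ?_
  obtain ⟨a, ha, hd, rfl⟩ := exists_elt n.deg x
  have e : ∀ k : M10 ⟶ Z, GrMod.app k n (elt n.deg a ha hd)
      = Z.op 0 n.deg a (GrMod.app k ⟨0⟩ one) := fun k => by
    rw [← GrMod.app_op, op_one_elt ha hd]
  rw [e f, e g, h]

end M10

/-- Restriction from `A_2` to `subD`. -/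
def twistId : Twist A2 subD Unit where
  shift _ := 0
  nbr _ := Finset.univ
  mat _ _ := LinearMap.id
  mat_mem _ _ _ hd := D_le_A2 hd
  mat_homog _ _ _ _ _ hn := by simpa using hn
  mat_eq_zero _ h := absurd (Finset.mem_univ _) h
  mat_one_self _ := rfl
  mat_one_ne p q h := absurd (Subsingleton.elim p q) h
  mat_mul _ _ _ _ _ _ := by simp

theorem twistId_unipotent : twistId.Unipotent where
  mat_self _ _ _ := rfl
  self_mem _ := Finset.mem_univ _
  shift_lt p q _ h := absurd (Subsingleton.elim q p) h

theorem twistId_rho (Z : GrMod A2) (i j : ℤ) (d : Steenrod)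
    (z : ∀ p, Z.obj.obj ⟨i + twistId.shift p⟩) (p : Unit) :
    twistId.rho Z i j d z p = Z.op (i + 0) (j + 0) d (z p) := by
  rw [Twist.rho_apply]
  exact Finset.sum_singleton _ _

/-- The unit at `M_10`. -/
def unitM10 : trivialMod subD ⟶ twistId.obj M10 :=
  trivHom (fun _ => M10.one) (by
    intro j d hj hd hn
    refine (twistId.obj_op _ hd (by simpa using hn) _).trans ?_
    funext p
    refine (twistId_rho _ 0 j d _ p).trans ?_
    exact M10.op_one_D (by simpa using hj) hd (by simpa using hn))

theorem unitM10_bijective (Z : GrMod A2) :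
    Function.Bijective fun f : M10 ⟶ Z => unitM10 ≫ twistId.functor.map f := by
  have hf : ∀ f : M10 ⟶ Z, GrMod.app (unitM10 ≫ twistId.functor.map f) ⟨0⟩ (trivOne subD)
      = fun _ => GrMod.app f ⟨0⟩ M10.one := fun f =>
    congrArg (fun z : (twistId.obj M10).obj.obj ⟨0⟩ => GrMod.app (twistId.functor.map f) ⟨0⟩ z)
      (trivHom_app _ _)
  constructor
  · intro f g h
    refine M10.hom_ext ?_
    have := (hf f).symm.trans ((congrArg (fun k : trivialMod subD ⟶ twistId.obj Z =>
      GrMod.app k ⟨0⟩ (trivOne subD)) h).trans (hf g))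
    exact congrFun this ()
  · intro g
    refine ⟨M10.desc (GrMod.app g ⟨0⟩ (trivOne subD) ()) ?_, trivialMod_hom_ext ?_⟩
    · intro j d hj hd hn
      refine Z.op_congr (add_zero j) ?_
      have h := trivialMod_hom_op g hj (a := d)
      have h' := congrFun ((twistId.obj_op Z hd (by simpa using hn) _).symm.trans h) ()
      exact (twistId_rho Z 0 j d _ ()).symm.trans h'
    · refine (hf _).trans ?_
      funext p
      exact M10.desc_app _ _

/-- `Ext_{A_2}(M_10, ℤ₂) = bo[v_2]`. -/
theorem ext_M10 (s : ℕ) (t : ℤ) : Nonempty (ExtB M10 s t ≃+ boV2 s t) := by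
  obtain ⟨e⟩ := twistId_unipotent.ext (fun p q h => absurd (Subsingleton.elim p q) h) unitM10
    unitM10_bijective s t
  obtain ⟨i⟩ := ext_cast (X := trivialMod subD) (rfl : s = s) (sub_zero t)
  obtain ⟨e0⟩ := ext_subD s t
  obtain ⟨e1⟩ := ext_subD s (t - 0)
  exact ⟨e.trans ((AddEquiv.piUnique _).trans (e1.symm.trans (i.trans e0)))⟩

end SteenrodExt
end

noncomputable section
namespace SteenrodExt

/-! ### A deformation of the inclusion `subD → A_2` -/

/-- The coefficient of the deformation of `Sq^2`. -/
def defo : Steenrod := Sq 4 * (Sq 2 * Sq 4) + Sq 4 * (Sq 2 * (Sq 1 * Q1)) + Sq 2 * (Sq 1 * Q2)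

section

attribute [local simp] mul_add add_mul mul_assoc steenrod_two steenrod_four steenrod_add_self
  Sq_one_one rel_one_two rel_one_four rel_Q1_one rel_Q1_two rel_Q1_four rel_Q1_Q1 rel_two_two
  Sq_one_one_assoc rel_one_two_assoc rel_one_four_assoc rel_Q1_one_assoc rel_Q1_two_assoc
  rel_Q1_four_assoc rel_Q1_Q1_assoc rel_two_two_assoc
  rel_Q2_one rel_Q2_Q1 rel_four_four rel_Q2_two rel_Q2_four rel_two_four_two_four rel_Q2_Q2
  rel_Q2_one_assoc rel_Q2_Q1_assoc rel_four_four_assoc rel_Q2_two_assoc rel_Q2_four_assoc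
  rel_two_four_two_four_assoc rel_Q2_Q2_assoc

theorem defo_mul_defo : defo * defo = 0 := by
  apply steenrod_eq_of_add
  simp [defo]

theorem defo_rel : Sq 2 * defo + defo * Sq 2 = Sq 1 * (defo * Sq 1) := by
  apply steenrod_eq_of_add
  simp [defo]
  abel_nf
  simp

end

theorem defo_mem : defo ∈ A2 := by
  have h1 := D_le_A2 Sq_one_mem_D
  have h2 := D_le_A2 Sq_two_mem_D
  have h4 := Sq_four_mem_A2
  exact add_mem (add_mem (mul_mem h4 (mul_mem h2 h4))
    (mul_mem h4 (mul_mem h2 (mul_mem h1 (D_le_A2 Q1_mem_D))))) (mul_mem h2 (mul_mem h1 Q2_mem_A2))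

theorem defo_homog : defo ∈ homog 10 := by
  refine add_mem (add_mem (bVec_mem_homog 3) ?_) ?_
  · exact mul_mem_homog_of_eq (d := 6) (by norm_num) Sq_four_mem_homog
      (mul_mem_homog_of_eq (d := 4) (by norm_num) Sq_two_mem_homog
        (mul_mem_homog_of_eq (by norm_num) Sq_one_mem_homog Q1_mem_homog))
  · exact mul_mem_homog_of_eq (d := 8) (by norm_num) Sq_two_mem_homog
      (mul_mem_homog_of_eq (by norm_num) Sq_one_mem_homog Q2_mem_homog)

open Polynomial in
/-- The deformation of `Sq^2`. -/
def defoTwo : Polynomial Steenrod := C (Sq 2) + C defo * X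

open Polynomial in
theorem defo_A1Rel : A1Rel (C (Sq 1)) defoTwo := by
  have hX : ∀ a : Steenrod, (X : Steenrod[X]) * C a = C a * X := fun a => X_mul_C a
  have hC : ∀ (a b : Steenrod) (f : Steenrod[X]), C a * (C b * f) = C (a * b) * f := fun a b f => by
    rw [C_mul, mul_assoc]
  have hXa : ∀ (a : Steenrod) (f : Steenrod[X]), (X : Steenrod[X]) * (C a * f) = C a * (X * f) :=
    fun a f => by rw [← mul_assoc, hX, mul_assoc]
  constructor
  · rw [← C_mul, Sq_one_one, C_0]
  · simp only [defoTwo, mul_add, add_mul, mul_assoc, hX, hXa, hC, ← C_mul]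
    rw [defo_mul_defo, ← defo_rel, Sq_two_two, mul_assoc]
    simp only [map_add, add_mul, C_0, zero_mul, add_zero]
    abel

theorem C_Q2_commute_defoTwo : Polynomial.C Q2 * defoTwo = defoTwo * Polynomial.C Q2 := by
  rw [defoTwo, mul_add, add_mul, mul_assoc, Polynomial.X_mul_C, ← mul_assoc, ← mul_assoc]
  simp only [← Polynomial.C_mul, commute_Q2 defo_mem, commute_Q2 (D_le_A2 Sq_two_mem_D)]

/-- The values of the deformation on the basis of `subD`. -/
def defoVec (i : Fin 8 × Fin 2) : Polynomial Steenrod :=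
  word8 (Polynomial.C (Sq 1)) defoTwo i.1 * Polynomial.C Q2 ^ (i.2 : ℕ)

/-- The deformation of the inclusion of `subD`. -/
def defoMap : Steenrod →ₗ[ZMod 2] Polynomial Steenrod := extD defoVec

theorem defoMap_dVec (i : Fin 8 × Fin 2) : defoMap (dVec i) = defoVec i := extD_dVec _ i

theorem defoMap_one : defoMap 1 = 1 := by
  have := defoMap_dVec (0, 0)
  simpa [dVec, defoVec, word8] using this

theorem defoMap_optWord8 (o : Option (Fin 8)) (c : Fin 2) :
    defoMap (optWord8 (Sq 1) (Sq 2) o * Q2 ^ (c : ℕ)) =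
      optWord8 (Polynomial.C (Sq 1)) defoTwo o * Polynomial.C Q2 ^ (c : ℕ) := by
  rcases o with _ | j
  · simp [optWord8]
  · exact defoMap_dVec (j, c)

theorem defoMap_Sq_one_mul {d : Steenrod} (hd : d ∈ subD) :
    defoMap (Sq 1 * d) = Polynomial.C (Sq 1) * defoMap d := by
  refine D_linear_ext (f := defoMap ∘ₗ LinearMap.mulLeft (ZMod 2) (Sq 1))
    (g := LinearMap.mulLeft (ZMod 2) (Polynomial.C (Sq 1)) ∘ₗ defoMap) (fun i => ?_) hd
  simp only [LinearMap.comp_apply, LinearMap.mulLeft_apply, defoMap_dVec]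
  rw [dVec, defoVec, ← mul_assoc, ← mul_assoc, Sq_A1Rel.mul_word8_left, defo_A1Rel.mul_word8_left,
    defoMap_optWord8]

theorem defoMap_Sq_two_mul {d : Steenrod} (hd : d ∈ subD) :
    defoMap (Sq 2 * d) = defoTwo * defoMap d := by
  refine D_linear_ext (f := defoMap ∘ₗ LinearMap.mulLeft (ZMod 2) (Sq 2))
    (g := LinearMap.mulLeft (ZMod 2) defoTwo ∘ₗ defoMap) (fun i => ?_) hd
  simp only [LinearMap.comp_apply, LinearMap.mulLeft_apply, defoMap_dVec]
  rw [dVec, defoVec, ← mul_assoc, ← mul_assoc, Sq_A1Rel.mul_word8_right,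
    defo_A1Rel.mul_word8_right, defoMap_optWord8]

theorem C_Q2_commute_word8 (j : Fin 8) :
    Commute (Polynomial.C Q2) (word8 (Polynomial.C (Sq 1)) defoTwo j) := by
  have hv : Commute (Polynomial.C Q2) defoTwo := C_Q2_commute_defoTwo
  have hu : Commute (Polynomial.C Q2) (Polynomial.C (Sq 1)) := by
    change _ * _ = _ * _
    rw [← Polynomial.C_mul, ← Polynomial.C_mul, rel_Q2_one]
  fin_cases j
  exacts [Commute.one_right _, hu, hv, hu.mul_right hv, hv.mul_right hu,
    hu.mul_right (hv.mul_right hu), hv.mul_right (hu.mul_right hv),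
    hu.mul_right (hv.mul_right (hu.mul_right hv))]

theorem defoMap_Q2_mul {d : Steenrod} (hd : d ∈ subD) :
    defoMap (Q2 * d) = Polynomial.C Q2 * defoMap d := by
  refine D_linear_ext (f := defoMap ∘ₗ LinearMap.mulLeft (ZMod 2) Q2)
    (g := LinearMap.mulLeft (ZMod 2) (Polynomial.C Q2) ∘ₗ defoMap) (fun i => ?_) hd
  obtain ⟨j, c⟩ := i
  simp only [LinearMap.comp_apply, LinearMap.mulLeft_apply, defoMap_dVec]
  rw [dVec, defoVec, ← mul_assoc, ← mul_assoc, commute_Q2 (A1_le_A2 (word8_mem_A1 _)),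
    (C_Q2_commute_word8 j).eq, mul_assoc, mul_assoc]
  fin_cases c
  · have := defoMap_dVec (j, 1)
    simpa [dVec, defoVec] using this
  · simp [rel_Q2_Q2, ← Polynomial.C_mul]

theorem defoMap_mul {d d' : Steenrod} (hd : d ∈ subD) (hd' : d' ∈ subD) :
    defoMap (d * d') = defoMap d * defoMap d' := by
  let S : Submodule (ZMod 2) Steenrod :=
    { carrier := {x | x ∈ subD ∧ defoMap (x * d') = defoMap x * defoMap d'}
      add_mem' := fun {x y} hx hy => ⟨add_mem hx.1 hy.1, by
        rw [add_mul, map_add, map_add, add_mul, hx.2, hy.2]⟩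
      zero_mem' := ⟨zero_mem _, by simp⟩
      smul_mem' := fun c x hx => ⟨subD.smul_mem hx.1 c, by
        rw [smul_mul_assoc, map_smul, map_smul, smul_mul_assoc, hx.2]⟩ }
  have key : d ∈ S := by
    refine adjoin_le_of_mul_mem (G := {Sq 1, Sq 2, Q2}) S ⟨one_mem _, ?_⟩ ?_ hd
    · rw [one_mul, defoMap_one, one_mul]
    · rintro _ (rfl | rfl | rfl) x ⟨hx, e⟩
      · exact ⟨mul_mem Sq_one_mem_D hx, by
          rw [mul_assoc, defoMap_Sq_one_mul (mul_mem hx hd'), e, defoMap_Sq_one_mul hx, mul_assoc]⟩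
      · exact ⟨mul_mem Sq_two_mem_D hx, by
          rw [mul_assoc, defoMap_Sq_two_mul (mul_mem hx hd'), e, defoMap_Sq_two_mul hx, mul_assoc]⟩
      · exact ⟨mul_mem Q2_mem_D hx, by
          rw [mul_assoc, defoMap_Q2_mul (mul_mem hx hd'), e, defoMap_Q2_mul hx, mul_assoc]⟩
  exact key.2

/-- Polynomials over `A_2`, homogeneous of degree `n` for a variable of degree `-8`. -/
def polyHomog (n : ℤ) : Submodule (ZMod 2) (Polynomial Steenrod) where
  carrier := {f | ∀ k : ℕ, f.coeff k ∈ A2 ∧ f.coeff k ∈ homog (n + 8 * k)}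
  add_mem' hf hg k := by
    rw [Polynomial.coeff_add]
    exact ⟨add_mem (hf k).1 (hg k).1, add_mem (hf k).2 (hg k).2⟩
  zero_mem' k := by
    rw [Polynomial.coeff_zero]
    exact ⟨zero_mem _, zero_mem _⟩
  smul_mem' c f hf k := by
    rw [Polynomial.coeff_smul]
    exact ⟨A2.smul_mem (hf k).1 c, Submodule.smul_mem _ _ (hf k).2⟩

theorem mul_mem_polyHomog {m n r : ℤ} (h : m + n = r) {f g : Polynomial Steenrod}
    (hf : f ∈ polyHomog m) (hg : g ∈ polyHomog n) : f * g ∈ polyHomog r := by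
  intro k
  rw [Polynomial.coeff_mul]
  refine ⟨sum_mem fun x _ => mul_mem (hf x.1).1 (hg x.2).1, sum_mem fun x hx => ?_⟩
  refine mul_mem_homog_of_eq ?_ (hf x.1).2 (hg x.2).2
  have : x.1 + x.2 = k := by simpa using hx
  rw [← this, ← h]
  push_cast
  ring

theorem C_mem_polyHomog {n : ℤ} {a : Steenrod} (ha : a ∈ A2) (hn : a ∈ homog n) :
    Polynomial.C a ∈ polyHomog n := by
  intro k
  rw [Polynomial.coeff_C]
  split_ifs with h
  · subst h
    exact ⟨ha, by simpa using hn⟩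
  · exact ⟨zero_mem _, zero_mem _⟩

theorem defoTwo_mem : defoTwo ∈ polyHomog 2 := by
  refine add_mem (C_mem_polyHomog (D_le_A2 Sq_two_mem_D) Sq_two_mem_homog) fun k => ?_
  rw [Polynomial.coeff_C_mul, Polynomial.coeff_X]
  split_ifs with h
  · subst h
    rw [mul_one]
    exact ⟨defo_mem, by simpa using defo_homog⟩
  · rw [mul_zero]
    exact ⟨zero_mem _, zero_mem _⟩

theorem defoVec_mem (i : Fin 8 × Fin 2) : defoVec i ∈ polyHomog (dDeg i) := by
  obtain ⟨j, c⟩ := i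
  have hu := C_mem_polyHomog (D_le_A2 Sq_one_mem_D) Sq_one_mem_homog
  have hv := defoTwo_mem
  have h1 : (1 : Polynomial Steenrod) ∈ polyHomog 0 := by
    have := C_mem_polyHomog (one_mem A2) one_mem_homog
    rwa [Polynomial.C_1] at this
  refine mul_mem_polyHomog (m := deg8 j) (n := 7 * (c : ℕ)) rfl ?_ ?_
  · have huv := mul_mem_polyHomog (r := 3) (by norm_num) hu hv
    have hvu := mul_mem_polyHomog (r := 3) (by norm_num) hv hu
    have hvuv := mul_mem_polyHomog (r := 5) (by norm_num) hv huv
    fin_cases j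
    exacts [h1, hu, hv, huv, hvu, mul_mem_polyHomog (by rfl) hu hvu, hvuv,
      mul_mem_polyHomog (by rfl) hu hvuv]
  · fin_cases c
    · simpa using h1
    · simpa using C_mem_polyHomog Q2_mem_A2 Q2_mem_homog

/-- A bound for the degree of the deformation. -/
def defoBound : ℕ := Finset.univ.sup fun i => (defoVec i).natDegree

/-- The coefficients of the deformation, extended by zero to negative exponents. -/
def defoCoeff (n : ℤ) : Steenrod →ₗ[ZMod 2] Steenrod :=
  if 0 ≤ n then (Polynomial.lcoeff Steenrod n.toNat).restrictScalars (ZMod 2) ∘ₗ defoMap else 0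

end SteenrodExt
end

noncomputable section
namespace SteenrodExt

/-! ### The twist of `C^∞_{-∞}` -/

theorem defoCoeff_natCast (k : ℕ) (d : Steenrod) : defoCoeff k d = (defoMap d).coeff k := by
  rw [defoCoeff, if_pos (Int.natCast_nonneg k)]
  rfl

theorem defoCoeff_of_neg {n : ℤ} (h : n < 0) (d : Steenrod) : defoCoeff n d = 0 := by
  rw [defoCoeff, if_neg (by omega)]
  rfl

theorem coeff_defoMap (k : ℕ) (d : Steenrod) :
    (defoMap d).coeff k = ∑ i, coeffA (0, i) d • (defoVec i).coeff k := by
  rw [defoMap, extD_apply, Polynomial.finsetSum_coeff]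
  rfl

theorem coeff_defoMap_mem (k : ℕ) (d : Steenrod) : (defoMap d).coeff k ∈ A2 := by
  rw [coeff_defoMap]
  exact sum_mem fun i _ => A2.smul_mem (defoVec_mem i k).1 _

theorem coeff_defoMap_homog (k : ℕ) {n : ℤ} {d : Steenrod} (hd : d ∈ subD) (hn : d ∈ homog n) :
    (defoMap d).coeff k ∈ homog (n + 8 * k) := by
  have : defoMap d ∈ polyHomog n := extD_mem _ _ (fun i hi => hi ▸ defoVec_mem i) hd hn
  exact (this k).2

theorem coeff_defoMap_eq_zero {k : ℕ} (hk : defoBound < k) (d : Steenrod) :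
    (defoMap d).coeff k = 0 := by
  rw [coeff_defoMap]
  refine Finset.sum_eq_zero fun i _ => ?_
  rw [Polynomial.coeff_eq_zero_of_natDegree_lt, smul_zero]
  exact (Finset.le_sup (f := fun i => (defoVec i).natDegree) (Finset.mem_univ i)).trans_lt hk

theorem coeff_zero_defoMap {d : Steenrod} (hd : d ∈ subD) : (defoMap d).coeff 0 = d := by
  refine D_linear_ext (f := (Polynomial.lcoeff Steenrod 0).restrictScalars (ZMod 2) ∘ₗ defoMap)
    (g := LinearMap.id) (fun i => ?_) hd
  obtain ⟨j, c⟩ := i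
  change (defoMap (dVec (j, c))).coeff 0 = dVec (j, c)
  rw [defoMap_dVec]
  have hv : defoTwo.coeff 0 = Sq 2 := by simp [defoTwo]
  have h8 : ∀ j, (word8 (Polynomial.C (Sq 1)) defoTwo j).coeff 0 = word8 (Sq 1) (Sq 2) j := by
    intro j
    fin_cases j <;> simp [word8, Polynomial.mul_coeff_zero, hv]
  rw [defoVec, dVec, Polynomial.mul_coeff_zero, h8, ← Polynomial.C_pow, Polynomial.coeff_C_zero]

theorem augmentation_coeff_defoMap {k : ℕ} (hk : k ≠ 0) (d : Steenrod) :
    augmentation ((defoMap d).coeff k) = 0 := by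
  rw [coeff_defoMap, map_sum]
  refine Finset.sum_eq_zero fun i _ => ?_
  have h0 : 0 ≤ dDeg i := by
    have : 0 ≤ deg8 i.1 := (by decide : ∀ j, 0 ≤ deg8 j) i.1
    unfold dDeg
    omega
  rw [map_smul, augmentation_homog (by omega) (defoVec_mem i k).2, smul_zero]

/-- The representation of `subD` by Toeplitz matrices over `A_2`. -/
def twistCP : Twist A2 subD ℤ where
  shift p := 8 * p - 2
  nbr p := (Finset.range (defoBound + 1)).image fun k : ℕ => p - k
  mat p q := defoCoeff (p - q)
  mat_mem p q d hd := by
    rcases lt_or_ge (p - q) 0 with h | h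
    · rw [defoCoeff_of_neg h]
      exact zero_mem _
    · obtain ⟨k, hk⟩ := Int.eq_ofNat_of_zero_le h
      rw [hk, defoCoeff_natCast]
      exact coeff_defoMap_mem k d
  mat_homog p q n d hd hn := by
    rcases lt_or_ge (p - q) 0 with h | h
    · rw [defoCoeff_of_neg h]
      exact zero_mem _
    · obtain ⟨k, hk⟩ := Int.eq_ofNat_of_zero_le h
      rw [hk, defoCoeff_natCast]
      have := coeff_defoMap_homog k hd hn
      rwa [show n + 8 * (k : ℤ) = n + (8 * p - 2) - (8 * q - 2) by rw [← hk]; ring] at this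
  mat_eq_zero {p q d} hd hq := by
    rcases lt_or_ge (p - q) 0 with h | h
    · rw [defoCoeff_of_neg h]
    · obtain ⟨k, hk⟩ := Int.eq_ofNat_of_zero_le h
      rw [hk, defoCoeff_natCast]
      refine coeff_defoMap_eq_zero ?_ d
      by_contra hb
      exact hq (Finset.mem_image.2 ⟨k, Finset.mem_range.2 (by omega), by omega⟩)
  mat_one_self p := by
    rw [sub_self]
    exact (defoCoeff_natCast 0 1).trans (coeff_zero_defoMap (one_mem _))
  mat_one_ne p q h := by
    rcases lt_or_ge (p - q) 0 with h' | h'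
    · rw [defoCoeff_of_neg h']
    · obtain ⟨k, hk⟩ := Int.eq_ofNat_of_zero_le h'
      rw [hk, defoCoeff_natCast, defoMap_one, Polynomial.coeff_one, if_neg]
      omega
  mat_mul p r d d' hd hd' := by
    rw [Finset.sum_image (fun a _ b _ h => by simpa using h)]
    simp only [sub_sub_cancel, defoCoeff_natCast]
    rcases lt_or_ge (p - r) 0 with h | h
    · rw [defoCoeff_of_neg h, eq_comm]
      refine Finset.sum_eq_zero fun k _ => ?_
      rw [defoCoeff_of_neg (by omega), mul_zero]
    · obtain ⟨N, hN⟩ := Int.eq_ofNat_of_zero_le h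
      rw [hN, defoCoeff_natCast, defoMap_mul hd hd', Polynomial.coeff_mul,
        Finset.Nat.sum_antidiagonal_eq_sum_range_succ
          (fun i j => (defoMap d).coeff i * (defoMap d').coeff j) N]
      trans ∑ k ∈ Finset.range (N + defoBound + 1),
        (defoMap d).coeff k * defoCoeff (p - k - r) d'
      · refine (Finset.sum_congr rfl fun k hk => ?_).trans
          (Finset.sum_subset (Finset.range_mono (by omega)) fun k _ hk => ?_)
        · have hk : k < N + 1 := by simpa using hk
          rw [show p - k - r = ((N - k : ℕ) : ℤ) by omega, defoCoeff_natCast]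
        · have hk : ¬ k < N + 1 := by simpa using hk
          rw [defoCoeff_of_neg (by omega), mul_zero]
      · refine (Finset.sum_subset (Finset.range_mono (by omega)) fun k _ hk => ?_).symm
        have hk : ¬ k < defoBound + 1 := by simpa using hk
        rw [coeff_defoMap_eq_zero (by omega), zero_mul]

theorem twistCP_shift (p : ℤ) : twistCP.shift p = 8 * p - 2 := rfl

theorem twistCP_mat (p q : ℤ) : twistCP.mat p q = defoCoeff (p - q) := rfl

theorem twistCP_nbr {p q : ℤ} (h : q ∈ twistCP.nbr p) : q ≤ p := by
  obtain ⟨k, _, rfl⟩ := Finset.mem_image.1 h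
  omega

theorem twistCP_unipotent : twistCP.Unipotent where
  mat_self p d hd := by
    rw [twistCP_mat, sub_self]
    exact (defoCoeff_natCast 0 d).trans (coeff_zero_defoMap hd)
  self_mem p := Finset.mem_image.2 ⟨0, by simp, by simp⟩
  shift_lt p q hq h := by
    have := twistCP_nbr hq
    rw [twistCP_shift, twistCP_shift]
    omega

theorem twistCP_augmentation (p q : ℤ) (h : p ≠ q) (d : Steenrod) (_ : d ∈ subD) :
    augmentation (twistCP.mat p q d) = 0 := by
  rw [twistCP_mat]
  rcases lt_or_ge (p - q) 0 with h' | h'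
  · rw [defoCoeff_of_neg h', map_zero]
  · obtain ⟨k, hk⟩ := Int.eq_ofNat_of_zero_le h'
    rw [hk, defoCoeff_natCast, augmentation_coeff_defoMap (by omega)]

theorem defoMap_Sq_one : defoMap (Sq 1) = Polynomial.C (Sq 1) := by
  simpa [defoMap_one] using defoMap_Sq_one_mul (one_mem subD)

theorem defoMap_Sq_two : defoMap (Sq 2) = defoTwo := by
  simpa [defoMap_one] using defoMap_Sq_two_mul (one_mem subD)

theorem defoMap_Q2 : defoMap Q2 = Polynomial.C Q2 := by
  simpa [defoMap_one] using defoMap_Q2_mul (one_mem subD)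

theorem twistCP_rho_of_C (Z : GrMod A2) (i j : ℤ) {d : Steenrod} (hd : d ∈ subD)
    (h : defoMap d = Polynomial.C d) (z : ∀ p, Z.obj.obj ⟨i + twistCP.shift p⟩) (p : ℤ) :
    twistCP.rho Z i j d z p =
      Z.op (i + twistCP.shift p) (j + twistCP.shift p) d (z p) := by
  rw [Twist.rho_apply, Finset.sum_eq_single p]
  · rw [twistCP_unipotent.mat_self p hd]
  · intro q hq hne
    have := twistCP_nbr hq
    obtain ⟨k, hk⟩ := Int.eq_ofNat_of_zero_le (sub_nonneg.2 this)
    rw [twistCP_mat, hk, defoCoeff_natCast, h, Polynomial.coeff_C, if_neg (by omega), Z.op_zero]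
  · exact fun h => absurd (twistCP_unipotent.self_mem p) h

theorem twistCP_rho_two (Z : GrMod A2) (i j : ℤ)
    (z : ∀ p, Z.obj.obj ⟨i + twistCP.shift p⟩) (p : ℤ) :
    twistCP.rho Z i j (Sq 2) z p =
      Z.op (i + twistCP.shift p) (j + twistCP.shift p) (Sq 2) (z p) +
      Z.op (i + twistCP.shift (p - 1)) (j + twistCP.shift p) defo (z (p - 1)) := by
  rw [Twist.rho_apply_of_subset twistCP Z i j Sq_two_mem_D z p (insert (p - 1) (twistCP.nbr p))
    (Finset.subset_insert _ _)]
  have h1 : ∀ q, q ≠ p → q ≠ p - 1 → twistCP.mat p q (Sq 2) = 0 := by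
    intro q hp hp1
    rw [twistCP_mat]
    rcases lt_or_ge (p - q) 0 with h' | h'
    · rw [defoCoeff_of_neg h']
    · obtain ⟨k, hk⟩ := Int.eq_ofNat_of_zero_le h'
      rw [hk, defoCoeff_natCast, defoMap_Sq_two, defoTwo, Polynomial.coeff_add,
        Polynomial.coeff_C, if_neg (by omega), Polynomial.coeff_C_mul, Polynomial.coeff_X,
        if_neg (by omega), mul_zero, add_zero]
  have h2 : twistCP.mat p (p - 1) (Sq 2) = defo := by
    rw [twistCP_mat, sub_sub_cancel]
    refine (defoCoeff_natCast 1 _).trans ?_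
    simp [defoMap_Sq_two, defoTwo, Polynomial.coeff_C]
  rw [Finset.sum_eq_add_of_mem p (p - 1)
    (Finset.mem_insert_of_mem (twistCP_unipotent.self_mem p)) (Finset.mem_insert_self _ _)
    (by omega) (fun q _ hq => by rw [h1 q hq.1 hq.2, Z.op_zero]),
    twistCP_unipotent.mat_self p Sq_two_mem_D, h2]

end SteenrodExt
end

noncomputable section
namespace SteenrodExt

/-! ### Families of elements behaving like the `x^{4p-1}` -/

theorem GrMod.op_of_ne {B : Subalgebra (ZMod 2) Steenrod} (Z : GrMod B) {m j c : ℤ} {a : Steenrod}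
    (ha : a ∈ homog c) (h : j ≠ m + c) (z : Z.obj.obj ⟨m⟩) : Z.op m j a z = 0 := by
  by_cases hd : a ∈ homog (j - m)
  · have h0 : a = 0 := by
      rw [← component_of_mem hd, component_of_mem_ne (by omega) ha]
    rw [h0, Z.op_zero]
  · rw [GrMod.op, dif_neg (fun h' => hd h'.2), LinearMap.zero_apply]

/-- The element `a` of degree `c` annihilates `z`. -/
structure Kills (Z : GrMod A2) {m : ℤ} (z : Z.obj.obj ⟨m⟩) (c : ℤ) (a : Steenrod) : Prop where
  mem : a ∈ A2
  homog : a ∈ homog c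
  op : ∀ j, Z.op m j a z = 0

namespace Kills

variable {Z : GrMod A2} {m : ℤ} {z : Z.obj.obj ⟨m⟩}

theorem of_op {c : ℤ} {a : Steenrod} (ha : a ∈ A2) (hc : a ∈ SteenrodExt.homog c)
    (h : Z.op m (m + c) a z = 0) : Kills Z z c a where
  mem := ha
  homog := hc
  op j := by
    by_cases hj : j = m + c
    · rw [hj, h]
    · exact Z.op_of_ne hc hj z

theorem mul {c c' e : ℤ} (he : c' + c = e) {a x : Steenrod} (hx : x ∈ A2)
    (hc : x ∈ SteenrodExt.homog c') (h : Kills Z z c a) : Kills Z z e (x * a) := by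
  refine of_op (mul_mem hx h.mem) (mul_mem_homog_of_eq he hc h.homog) ?_
  rw [Z.op_mul (j := m + c) hx (by rwa [show m + e - (m + c) = c' by omega]) h.mem
    (by simpa using h.homog), h.op, map_zero]

theorem add {c : ℤ} {a b : Steenrod} (ha : Kills Z z c a) (hb : Kills Z z c b) :
    Kills Z z c (a + b) := by
  refine of_op (add_mem ha.mem hb.mem) (add_mem ha.homog hb.homog) ?_
  rw [Z.op_add ha.mem (by simpa using ha.homog) hb.mem (by simpa using hb.homog), ha.op, hb.op,
    add_zero]

theorem op_add {c : ℤ} {a b : Steenrod} (ha : a ∈ A2) (hc : a ∈ SteenrodExt.homog c)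
    (hb : Kills Z z c b) (j : ℤ) : Z.op m j (a + b) z = Z.op m j a z := by
  by_cases hj : j = m + c
  · subst hj
    rw [Z.op_add ha (by simpa using hc) hb.mem (by simpa using hb.homog), hb.op, add_zero]
  · rw [Z.op_of_ne hc hj, Z.op_of_ne (add_mem hc hb.homog) hj]

end Kills

/-- The degree of `x^{4p-1}`. -/
abbrev cpDeg (p : ℤ) : ℤ := 0 + twistCP.shift p

theorem cpDeg_eq (p : ℤ) : cpDeg p = 8 * p - 2 := zero_add _

/-- The relations between the elements `x^{4p-1}`, `p ∈ I`. -/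
structure CPFamily (Z : GrMod A2) (I : Set ℤ) (z : ∀ p, Z.obj.obj ⟨cpDeg p⟩) : Prop where
  lower : ∀ p ∈ I, p - 1 ∈ I
  one : ∀ p ∈ I, Kills Z (z p) 1 (Sq 1)
  milnor : ∀ p ∈ I, Kills Z (z p) 7 Q2
  two : ∀ p ∈ I, ∀ j, Z.op (cpDeg p) j (Sq 2) (z p) = Z.op (cpDeg (p - 1)) j (bVec 3) (z (p - 1))

theorem kills_one_Q1 {Z : GrMod A2} {m : ℤ} {z : Z.obj.obj ⟨m⟩} (h : Kills Z z 1 (Sq 1)) :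
    Kills Z z 4 (Sq 1 * Q1) := by
  rw [← rel_Q1_one]
  exact h.mul (by norm_num) (D_le_A2 Q1_mem_D) Q1_mem_homog

theorem defo_op {Z : GrMod A2} {m : ℤ} {z : Z.obj.obj ⟨m⟩} (h1 : Kills Z z 1 (Sq 1))
    (h7 : Kills Z z 7 Q2) (j : ℤ) : Z.op m j defo z = Z.op m j (bVec 3) z := by
  have m1 := D_le_A2 Sq_one_mem_D
  have m2 := D_le_A2 Sq_two_mem_D
  have k1 : Kills Z z 10 (Sq 4 * (Sq 2 * (Sq 1 * Q1))) :=
    ((kills_one_Q1 h1).mul (e := 6) (by norm_num) m2 Sq_two_mem_homog).mul (by norm_num)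
      Sq_four_mem_A2 Sq_four_mem_homog
  have k2 : Kills Z z 10 (Sq 2 * (Sq 1 * Q2)) :=
    (h7.mul (e := 8) (by norm_num) m1 Sq_one_mem_homog).mul (by norm_num) m2 Sq_two_mem_homog
  rw [defo, add_assoc]
  exact Kills.op_add (bVec_mem_A2 3) (bVec_mem_homog 3) (k1.add k2) j

section

attribute [local simp] mul_add add_mul mul_assoc steenrod_two steenrod_four steenrod_add_self
  Sq_one_one rel_one_two rel_one_four rel_Q1_one rel_Q1_two rel_Q1_four rel_Q1_Q1 rel_two_two
  Sq_one_one_assoc rel_one_two_assoc rel_one_four_assoc rel_Q1_one_assoc rel_Q1_two_assoc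
  rel_Q1_four_assoc rel_Q1_Q1_assoc rel_two_two_assoc
  rel_Q2_one rel_Q2_Q1 rel_four_four rel_Q2_two rel_Q2_four rel_two_four_two_four rel_Q2_Q2
  rel_Q2_one_assoc rel_Q2_Q1_assoc rel_four_four_assoc rel_Q2_two_assoc rel_Q2_four_assoc
  rel_two_four_two_four_assoc rel_Q2_Q2_assoc

theorem b_two_mul_b_three : bVec 2 * bVec 3 =
    bVec 3 * (Sq 2 * (Sq 1 * Q1)) + bVec 2 * (Q1 * Q2) + bVec 2 * (Sq 2 * (Sq 1 * Q2)) := by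
  apply steenrod_eq_of_add
  simp [bVec]
  abel_nf
  simp

theorem b_three_mul_b_three : bVec 3 * bVec 3 =
    bVec 3 * (Q1 * Q2) + bVec 3 * (Sq 2 * (Sq 1 * Q2)) := by
  apply steenrod_eq_of_add
  simp [bVec]
  abel_nf
  simp

theorem b_two_two_b_two_two_Q1 :
    bVec 2 * Sq 2 * (bVec 2 * (Sq 2 * Q1)) = bVec 2 * (Sq 2 * (Sq 1 * Q1)) * Q2 := by
  simp [bVec]

theorem one_mul_b_one : Sq 1 * bVec 1 = bVec 1 * Sq 1 + Sq 2 * Q1 := by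
  simp [bVec]

end

namespace CPFamily

variable {Z : GrMod A2} {I : Set ℤ} {z : ∀ p, Z.obj.obj ⟨cpDeg p⟩}

/-- Two elements of `A_2`, applied to elements of the family, in any degree. -/
theorem op_mul_two (h : CPFamily Z I z) {p : ℤ} (hp : p ∈ I) {x : Steenrod} {c : ℤ} (hx : x ∈ A2)
    (hc : x ∈ homog c) (j : ℤ) : Z.op (cpDeg p) j (x * Sq 2) (z p)
      = Z.op (cpDeg (p - 1)) j (x * bVec 3) (z (p - 1)) := by
  by_cases hj : j = cpDeg p + (c + 2)
  · have e := cpDeg_eq p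
    have e' := cpDeg_eq (p - 1)
    rw [Z.op_mul (j := cpDeg p + 2) hx (by rwa [show j - (cpDeg p + 2) = c by omega])
      (D_le_A2 Sq_two_mem_D) (by simpa using Sq_two_mem_homog), h.two p hp,
      Z.op_mul (j := cpDeg p + 2) hx (by rwa [show j - (cpDeg p + 2) = c by omega])
      (bVec_mem_A2 3) (by
        rw [show cpDeg p + 2 - cpDeg (p - 1) = 10 by omega]
        exact bVec_mem_homog 3)]
  · have e := cpDeg_eq p
    have e' := cpDeg_eq (p - 1)
    rw [Z.op_of_ne (mul_mem_homog hc Sq_two_mem_homog) hj, Z.op_of_ne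
      (mul_mem_homog hc (bVec_mem_homog 3)) (by
        have : bDeg 3 = 10 := rfl
        omega)]

theorem op_Q1 (h : CPFamily Z I z) {p : ℤ} (hp : p ∈ I) (j : ℤ) :
    Z.op (cpDeg p) j Q1 (z p) = Z.op (cpDeg (p - 1)) j (bVec 2 * (Sq 2 * Q1)) (z (p - 1)) := by
  have m1 := D_le_A2 Sq_one_mem_D
  have m2 := D_le_A2 Sq_two_mem_D
  have mQ := D_le_A2 Q1_mem_D
  have e : Q1 = Sq 1 * Sq 2 + Sq 2 * Sq 1 := rfl
  conv_lhs => rw [e]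
  rw [Kills.op_add (mul_mem m1 m2) (mul_mem_homog_of_eq (by norm_num) Sq_one_mem_homog
    Sq_two_mem_homog) ((h.one p hp).mul (e := 3) (by norm_num) m2 Sq_two_mem_homog),
    h.op_mul_two hp m1 Sq_one_mem_homog, one_mul_b_three]
  have hp' := h.lower p hp
  have k0 : Kills Z (z (p - 1)) 11 (bVec 3 * Sq 1) :=
    (h.one _ hp').mul rfl (bVec_mem_A2 3) (bVec_mem_homog 3)
  have k1 : Kills Z (z (p - 1)) 11 (bVec 1 * Q2) :=
    (h.milnor _ hp').mul rfl (bVec_mem_A2 1) (bVec_mem_homog 1)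
  have k2 : Kills Z (z (p - 1)) 11 (bVec 0 * (Sq 1 * (Q1 * Q2))) :=
    (((h.milnor _ hp').mul (e := 10) rfl mQ Q1_mem_homog).mul (e := 11) rfl m1
      Sq_one_mem_homog).mul rfl (bVec_mem_A2 0) (bVec_mem_homog 0)
  rw [add_comm (bVec 3 * Sq 1), add_assoc, add_assoc, Kills.op_add
    (mul_mem (bVec_mem_A2 2) (mul_mem m2 mQ)) _ (k0.add (k1.add k2))]
  exact mul_mem_homog_of_eq (d := 5) (by rfl) (bVec_mem_homog 2)
    (mul_mem_homog_of_eq (by rfl) Sq_two_mem_homog Q1_mem_homog)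

theorem kills_Q1 (h : CPFamily Z I z) {p : ℤ} (hp : p ∈ I) : Kills Z (z p) 3 Q1 := by
  have m1 := D_le_A2 Sq_one_mem_D
  have m2 := D_le_A2 Sq_two_mem_D
  have mQ := D_le_A2 Q1_mem_D
  refine Kills.of_op mQ Q1_mem_homog ?_
  have e0 := cpDeg_eq p
  have e1 := cpDeg_eq (p - 1)
  have e2 := cpDeg_eq (p - 1 - 1)
  have hb : bVec 2 * Sq 2 ∈ A2 := mul_mem (bVec_mem_A2 2) m2
  have hb8 : bVec 2 * Sq 2 ∈ homog 8 := mul_mem_homog_of_eq (by rfl) (bVec_mem_homog 2) Sq_two_mem_homog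
  have hb11 : bVec 2 * (Sq 2 * Q1) ∈ homog 11 := mul_mem_homog_of_eq (d := 5) (by rfl) (bVec_mem_homog 2)
    (mul_mem_homog_of_eq (by rfl) Sq_two_mem_homog Q1_mem_homog)
  rw [h.op_Q1 hp, ← mul_assoc, Z.op_mul (j := cpDeg (p - 1) + 3) hb
    (by rwa [show cpDeg p + 3 - (cpDeg (p - 1) + 3) = 8 by omega]) mQ
    (by simpa using Q1_mem_homog), h.op_Q1 (h.lower p hp), ← Z.op_mul hb
    (by rwa [show cpDeg p + 3 - (cpDeg (p - 1) + 3) = 8 by omega])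
    (mul_mem (bVec_mem_A2 2) (mul_mem m2 mQ))
    (by rwa [show cpDeg (p - 1) + 3 - cpDeg (p - 1 - 1) = 11 by omega]),
    b_two_two_b_two_two_Q1]
  exact ((h.milnor _ (h.lower _ (h.lower p hp))).mul (e := 19) rfl
    (mul_mem (bVec_mem_A2 2) (mul_mem m2 (mul_mem m1 mQ)))
    (mul_mem_homog_of_eq (d := 6) (by rfl) (bVec_mem_homog 2) (mul_mem_homog_of_eq (d := 4) (by rfl)
      Sq_two_mem_homog (mul_mem_homog_of_eq (by rfl) Sq_one_mem_homog Q1_mem_homog)))).op _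

theorem kills_one_mul (h : CPFamily Z I z) {p : ℤ} (hp : p ∈ I) (k : Fin 4) (j : ℤ) :
    Z.op (cpDeg p) j (Sq 1 * bVec k) (z p) = 0 := by
  have m1 := D_le_A2 Sq_one_mem_D
  have m2 := D_le_A2 Sq_two_mem_D
  have mQ := D_le_A2 Q1_mem_D
  have k1 := h.one p hp
  have kQ := h.kills_Q1 hp
  have k7 := h.milnor p hp
  have b := fun k => bVec_mem_A2 k
  have hb := fun k => bVec_mem_homog k
  fin_cases k
  · change Z.op _ _ (Sq 1 * 1) _ = 0
    rw [mul_one]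
    exact k1.op j
  · change Z.op _ _ (Sq 1 * bVec 1) _ = 0
    rw [one_mul_b_one]
    exact ((k1.mul (e := 5) rfl (b 1) (hb 1)).add (kQ.mul rfl m2 Sq_two_mem_homog)).op j
  · change Z.op _ _ (Sq 1 * bVec 2) _ = 0
    rw [one_mul_b_two]
    exact (((k1.mul (e := 7) rfl (b 2) (hb 2)).add (kQ.mul rfl (b 1) (hb 1))).add
      (k7.mul rfl (b 0) (hb 0))).op j
  · change Z.op _ _ (Sq 1 * bVec 3) _ = 0
    rw [one_mul_b_three]
    exact ((((k1.mul (e := 11) rfl (b 3) (hb 3)).add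
      ((kQ.mul (e := 5) rfl m2 Sq_two_mem_homog).mul rfl (b 2) (hb 2))).add
      (k7.mul rfl (b 1) (hb 1))).add
      (((k7.mul (e := 10) rfl mQ Q1_mem_homog).mul (e := 11) rfl m1 Sq_one_mem_homog).mul
        rfl (b 0) (hb 0))).op j

theorem two_mul_b_two_op (h : CPFamily Z I z) {p : ℤ} (hp : p ∈ I) (j : ℤ) :
    Z.op (cpDeg p) j (Sq 2 * bVec 2) (z p) = 0 := by
  rw [two_mul_b_two]
  exact (((kills_one_Q1 (h.one p hp)).mul (e := 8) rfl (bVec_mem_A2 1) (bVec_mem_homog 1)).add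
    (((h.milnor p hp).mul (e := 8) rfl (D_le_A2 Sq_one_mem_D) Sq_one_mem_homog).mul rfl
      (bVec_mem_A2 0) (bVec_mem_homog 0))).op j

theorem four_mul_b_three_op (h : CPFamily Z I z) {p : ℤ} (hp : p ∈ I) (j : ℤ) :
    Z.op (cpDeg p) j (Sq 4 * bVec 3) (z p) = 0 := by
  rw [four_mul_b_three]
  exact (((kills_one_Q1 (h.one p hp)).mul (e := 14) rfl (bVec_mem_A2 3) (bVec_mem_homog 3)).add
    ((((h.milnor p hp).mul (e := 9) rfl (D_le_A2 Sq_two_mem_D) Sq_two_mem_homog).mul (e := 10) rfl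
      (D_le_A2 Sq_one_mem_D) Sq_one_mem_homog).mul rfl (bVec_mem_A2 1) (bVec_mem_homog 1))).op j

theorem four_mul_b_one_op (h : CPFamily Z I z) {p : ℤ} (hp : p ∈ I) (j : ℤ) :
    Z.op (cpDeg p) j (Sq 4 * bVec 1) (z p) = 0 := by
  have m1 := D_le_A2 Sq_one_mem_D
  have m2 := D_le_A2 Sq_two_mem_D
  have k1 : Kills Z (z p) 8 (bVec 1 * (Sq 1 * Q1)) :=
    (kills_one_Q1 (h.one p hp)).mul rfl (bVec_mem_A2 1) (bVec_mem_homog 1)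
  have k2 : Kills Z (z p) 8 (bVec 0 * (Sq 1 * Q2)) :=
    ((h.milnor p hp).mul (e := 8) rfl m1 Sq_one_mem_homog).mul rfl (bVec_mem_A2 0)
      (bVec_mem_homog 0)
  have hp' := h.lower p hp
  have k7 := h.milnor _ hp'
  rw [four_mul_b_one, add_assoc, Kills.op_add (mul_mem (bVec_mem_A2 2) m2)
    (mul_mem_homog_of_eq (by rfl) (bVec_mem_homog 2) Sq_two_mem_homog) (k1.add k2),
    h.op_mul_two hp (bVec_mem_A2 2) (bVec_mem_homog 2), b_two_mul_b_three]
  exact ((((kills_one_Q1 (h.one _ hp')).mul (e := 6) rfl m2 Sq_two_mem_homog).mul (e := 16) rfl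
    (bVec_mem_A2 3) (bVec_mem_homog 3)).add ((k7.mul (e := 10) rfl (D_le_A2 Q1_mem_D)
      Q1_mem_homog).mul rfl (bVec_mem_A2 2) (bVec_mem_homog 2))).add
    (((k7.mul (e := 8) rfl m1 Sq_one_mem_homog).mul (e := 10) rfl m2 Sq_two_mem_homog).mul rfl
      (bVec_mem_A2 2) (bVec_mem_homog 2)) |>.op j

theorem two_mul_b_three_op (h : CPFamily Z I z) {p : ℤ} (hp : p ∈ I) (j : ℤ) :
    Z.op (cpDeg p) j (Sq 2 * bVec 3) (z p) = 0 := by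
  have m1 := D_le_A2 Sq_one_mem_D
  have m2 := D_le_A2 Sq_two_mem_D
  have mQ := D_le_A2 Q1_mem_D
  have k7' := h.milnor p hp
  have k1 : Kills Z (z p) 12 (bVec 1 * (Sq 1 * Q2)) :=
    (k7'.mul (e := 8) rfl m1 Sq_one_mem_homog).mul rfl (bVec_mem_A2 1) (bVec_mem_homog 1)
  have k2 : Kills Z (z p) 12 (bVec 0 * (Sq 2 * (Q1 * Q2))) :=
    ((k7'.mul (e := 10) rfl mQ Q1_mem_homog).mul (e := 12) rfl m2 Sq_two_mem_homog).mul rfl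
      (bVec_mem_A2 0) (bVec_mem_homog 0)
  have k7 := h.milnor _ (h.lower p hp)
  rw [two_mul_b_three, add_assoc, Kills.op_add (mul_mem (bVec_mem_A2 3) m2)
    (mul_mem_homog_of_eq (by rfl) (bVec_mem_homog 3) Sq_two_mem_homog) (k1.add k2),
    h.op_mul_two hp (bVec_mem_A2 3) (bVec_mem_homog 3), b_three_mul_b_three]
  exact (((k7.mul (e := 10) rfl mQ Q1_mem_homog).mul (e := 20) rfl (bVec_mem_A2 3)
    (bVec_mem_homog 3)).add (((k7.mul (e := 8) rfl m1 Sq_one_mem_homog).mul (e := 10) rfl m2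
      Sq_two_mem_homog).mul rfl (bVec_mem_A2 3) (bVec_mem_homog 3))).op j

end CPFamily

end SteenrodExt
end

noncomputable section
namespace SteenrodExt

/-! ### Morphisms from submodules of `C^∞_{-∞}` -/

theorem op_of_generators {M N : GrMod A2} (φ : ∀ n : ℤ, M.obj.obj ⟨n⟩ →ₗ[ZMod 2] N.obj.obj ⟨n⟩)
    (h : ∀ g : ℕ, (g = 1 ∨ g = 2 ∨ g = 4) → ∀ (n : ℤ) (x : M.obj.obj ⟨n⟩),
      φ (n + g) (M.op n (n + g) (Sq g) x) = N.op n (n + g) (Sq g) (φ n x))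
    (i j : ℤ) (a : Steenrod) (ha : a ∈ A2) (hd : a ∈ homog (j - i)) (x : M.obj.obj ⟨i⟩) :
    φ j (M.op i j a x) = N.op i j a (φ i x) := by
  have word : ∀ w : List ℕ, (∀ g ∈ w, g ∈ ({1, 2, 4} : Set ℕ)) → ∀ j : ℤ, (w.sum : ℤ) = j - i →
      (w.map Sq).prod ∈ A2 ∧
        φ j (M.op i j (w.map Sq).prod x) = N.op i j (w.map Sq).prod (φ i x) := by
    intro w
    induction w with
    | nil =>
      intro _ j hj
      obtain rfl : j = i := by simp at hj; omega
      exact ⟨one_mem _, by rw [List.map_nil, List.prod_nil, M.op_one, N.op_one]⟩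
    | cons g w ih =>
      intro hw j hj
      rw [List.sum_cons] at hj
      obtain ⟨hm, e⟩ := ih (fun n hn => hw n (List.mem_cons_of_mem _ hn)) (i + w.sum) (by ring)
      have hg := hw g List.mem_cons_self
      have hgA : Sq g ∈ A2 := by
        rw [A2_eq]
        exact Algebra.subset_adjoin ⟨g, hg, rfl⟩
      have hwd : (w.map Sq).prod ∈ homog (i + (w.sum : ℤ) - i) := by
        simpa using word_mem_homog w
      obtain rfl : j = i + w.sum + g := by rw [Nat.cast_add] at hj; omega
      have hgd : Sq g ∈ homog (i + w.sum + g - (i + (w.sum : ℤ))) := by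
        simpa using Sq_mem_homog g
      rw [List.map_cons, List.prod_cons]
      refine ⟨mul_mem hgA hm, ?_⟩
      rw [M.op_mul hgA hgd hm hwd, N.op_mul hgA hgd hm hwd, ← e]
      exact h g (by simpa using hg) _ _
  have key : ∀ b ∈ Submodule.span (ZMod 2) (words {1, 2, 4} (j - i)),
      (b ∈ A2 ∧ b ∈ homog (j - i)) ∧ φ j (M.op i j b x) = N.op i j b (φ i x) := by
    intro b hb
    induction hb using Submodule.span_induction with
    | mem b hb =>
      obtain ⟨w, hw, hs, rfl⟩ := hb
      exact ⟨⟨(word w hw j hs).1, hs ▸ word_mem_homog w⟩, (word w hw j hs).2⟩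
    | zero => exact ⟨⟨zero_mem _, zero_mem _⟩, by rw [M.op_zero, N.op_zero, map_zero]⟩
    | add a b _ _ ha hb =>
      exact ⟨⟨add_mem ha.1.1 hb.1.1, add_mem ha.1.2 hb.1.2⟩, by
        rw [M.op_add ha.1.1 ha.1.2 hb.1.1 hb.1.2, N.op_add ha.1.1 ha.1.2 hb.1.1 hb.1.2, map_add,
          ha.2, hb.2]⟩
    | smul c a _ ha =>
      exact ⟨⟨A2.smul_mem ha.1.1 c, Submodule.smul_mem _ c ha.1.2⟩, by
        rw [M.op_smul, N.op_smul, map_smul, ha.2]⟩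
  have := component_mem_span_words {1, 2, 4} (A2_eq ▸ ha) (j - i)
  rw [component_of_mem hd] at this
  exact (key a this).2

/-- `x^{4p-1+e_k} = b_k x^{4p-1}`. -/
def cpExp : Fin 4 → ℤ := ![0, 2, 3, 5]

/-- The integer `p` with `k = 4p - 1 + e_j`. -/
def cpRow (k : ℤ) : ℤ := if k % 4 = 0 then k / 4 - 1 else (k + 1) / 4

/-- The index `j` with `k = 4p - 1 + e_j`. -/
def cpCol (k : ℤ) : Fin 4 :=
  if k % 4 = 0 then 3 else if k % 4 = 1 then 1 else if k % 4 = 2 then 2 else 0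

theorem cpRow_eq (p : ℤ) (j : Fin 4) : cpRow (4 * p - 1 + cpExp j) = p := by
  have h := (by decide : ∀ j : Fin 4, cpExp j = 0 ∨ cpExp j = 2 ∨ cpExp j = 3 ∨ cpExp j = 5) j
  unfold cpRow
  split_ifs <;> omega

theorem cpCol_eq (p : ℤ) (j : Fin 4) : cpCol (4 * p - 1 + cpExp j) = j := by
  fin_cases j
  · change cpCol (4 * p - 1 + 0) = 0
    rw [cpCol, if_neg (by omega), if_neg (by omega), if_neg (by omega)]
  · change cpCol (4 * p - 1 + 2) = 1
    rw [cpCol, if_neg (by omega), if_pos (by omega)]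
  · change cpCol (4 * p - 1 + 3) = 2
    rw [cpCol, if_neg (by omega), if_neg (by omega), if_pos (by omega)]
  · change cpCol (4 * p - 1 + 5) = 3
    rw [cpCol, if_pos (by omega)]

theorem exists_row_col (k : ℤ) : ∃ p j, k = 4 * p - 1 + cpExp j := by
  obtain h | h | h | h : k % 4 = 0 ∨ k % 4 = 1 ∨ k % 4 = 2 ∨ k % 4 = 3 := by omega
  · exact ⟨k / 4 - 1, 3, by change k = _ + 5; omega⟩
  · exact ⟨k / 4, 1, by change k = _ + 2; omega⟩
  · exact ⟨k / 4, 2, by change k = _ + 3; omega⟩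
  · exact ⟨k / 4 + 1, 0, by change k = _ + 0; omega⟩

theorem two_mul_cpExp (j : Fin 4) : 2 * cpExp j = bDeg j :=
  (by decide : ∀ j, 2 * cpExp j = bDeg j) j

theorem binom2_add_four_mul (r p : ℤ) {i : ℕ} (hi : i < 4) :
    binom2 (4 * p + r) i = binom2 r i := by
  unfold binom2
  obtain ⟨q, rfl | rfl⟩ := p.eq_nat_or_neg
  · rw [← choose_add_two_pow_mul r 2 q i hi]
    congr 2
    push_cast
    ring
  · rw [← choose_add_two_pow_mul (4 * -(q : ℤ) + r) 2 q i hi]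
    congr 2
    push_cast
    ring

theorem binom2_natCast (r i : ℕ) : binom2 (r : ℤ) i = ((r.choose i : ℕ) : ZMod 2) := by
  unfold binom2
  rw [Ring.choose_natCast]
  push_cast
  rfl

theorem binom2_row_col (p : ℤ) (j : Fin 4) {i : ℕ} (hi : i < 4) :
    binom2 (4 * p - 1 + cpExp j) i = (((3 + (cpExp j).toNat).choose i : ℕ) : ZMod 2) := by
  have h : 0 ≤ cpExp j := (by decide : ∀ j, 0 ≤ cpExp j) j
  have e : 4 * p - 1 + cpExp j = 4 * (p - 1) + ((3 + (cpExp j).toNat : ℕ) : ℤ) := by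
    push_cast
    rw [Int.toNat_of_nonneg h]
    ring
  rw [e, binom2_add_four_mul _ _ hi, binom2_natCast]

theorem gradeCP_cases {n : ℤ} {v : ℤ →₀ ZMod 2} (hv : v ∈ gradeCP n) :
    v = 0 ∨ ∃ k, 2 * k = n ∧ v = Finsupp.single k 1 := by
  induction hv using Submodule.span_induction with
  | mem v hv => exact Or.inr hv
  | zero => exact Or.inl rfl
  | add v w _ _ hv hw =>
    rcases hv with rfl | ⟨k, hk, rfl⟩
    · rwa [zero_add]
    · rcases hw with rfl | ⟨l, hl, rfl⟩
      · rw [add_zero]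
        exact Or.inr ⟨k, hk, rfl⟩
      · left
        obtain rfl : k = l := by omega
        rw [← Finsupp.single_add, show (1 + 1 : ZMod 2) = 0 from rfl, Finsupp.single_zero]
  | smul c v _ hv =>
    obtain rfl | rfl : c = 0 ∨ c = 1 := (by decide : ∀ c : ZMod 2, c = 0 ∨ c = 1) c
    · left
      rw [zero_smul]
    · rwa [one_smul]

theorem actCP_single {g : ℕ} (hg : Even g) (k : ℤ) :
    actCP (Sq g) (Finsupp.single k 1) = Finsupp.single (k + (g / 2 : ℕ)) (binom2 k (g / 2)) := by
  rw [actCP_Sq, sqCP_single, if_pos hg, one_mul]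

/-- A graded module mapping to `C^∞_{-∞}`, with values in the span of the rows in `I`. -/
structure CPVal (M : GrMod A2) (I : Set ℤ) where
  /-- the map -/
  val : ∀ n : ℤ, M.obj.obj ⟨n⟩ →ₗ[ZMod 2] (ℤ →₀ ZMod 2)
  val_mem : ∀ n x, val n x ∈ gradeCP n
  val_op : ∀ {i j : ℤ} {a : Steenrod}, a ∈ A2 → a ∈ homog (j - i) → ∀ x,
    val j (M.op i j a x) = actCP a (val i x)
  row_mem : ∀ n x k, val n x k ≠ 0 → cpRow k ∈ I

variable {Z : GrMod A2} {I : Set ℤ} {z : ∀ p, Z.obj.obj ⟨cpDeg p⟩}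

/-- The image of `x^k` under the morphism sending `x^{4p-1}` to `z_p`. -/
def cpImage (z : ∀ p, Z.obj.obj ⟨cpDeg p⟩) (n k : ℤ) : Z.obj.obj ⟨n⟩ :=
  Z.op (cpDeg (cpRow k)) n (bVec (cpCol k)) (z (cpRow k))

theorem cpImage_eq (n p : ℤ) (j : Fin 4) :
    cpImage z n (4 * p - 1 + cpExp j) = Z.op (cpDeg p) n (bVec j) (z p) := by
  have h : ∀ r c, r = p → c = j → Z.op (cpDeg r) n (bVec c) (z r)
      = Z.op (cpDeg p) n (bVec j) (z p) := by
    rintro _ _ rfl rfl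
    rfl
  exact h _ _ (cpRow_eq p j) (cpCol_eq p j)

theorem op_cpImage {g : ℕ} (hg : Sq g ∈ A2) {n k : ℤ} (hn : 2 * k = n) {p : ℤ} {j : Fin 4}
    (hk : k = 4 * p - 1 + cpExp j) :
    Z.op n (n + g) (Sq g) (cpImage z n k) = Z.op (cpDeg p) (n + g) (Sq g * bVec j) (z p) := by
  subst hk
  have := two_mul_cpExp j
  have e := cpDeg_eq p
  have hb : bVec j ∈ homog (n - cpDeg p) := by
    rw [show n - cpDeg p = bDeg j by omega]
    exact bVec_mem_homog j
  have hd : Sq g ∈ homog (n + g - n) := by simpa using Sq_mem_homog g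
  rw [cpImage_eq, Z.op_mul hg hd (bVec_mem_A2 j) hb]

theorem CPFamily.op_cpImage_one (h : CPFamily Z I z) {n k : ℤ} (hn : 2 * k = n)
    (hI : cpRow k ∈ I) : Z.op n (n + (1 : ℕ)) (Sq 1) (cpImage z n k) = 0 := by
  obtain ⟨p, j, hk⟩ := exists_row_col k
  have hp : p ∈ I := by rwa [hk, cpRow_eq] at hI
  rw [op_cpImage (D_le_A2 Sq_one_mem_D) hn hk]
  exact h.kills_one_mul hp j _

theorem CPFamily.op_cpImage_two (h : CPFamily Z I z) {n k : ℤ} (hn : 2 * k = n)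
    (hI : cpRow k ∈ I) : Z.op n (n + (2 : ℕ)) (Sq 2) (cpImage z n k)
      = binom2 k 1 • cpImage z (n + (2 : ℕ)) (k + 1) := by
  obtain ⟨p, j, hk⟩ := exists_row_col k
  have hp : p ∈ I := by rwa [hk, cpRow_eq] at hI
  rw [op_cpImage (D_le_A2 Sq_two_mem_D) hn hk, hk, binom2_row_col p j (by norm_num)]
  fin_cases j
  · change Z.op _ _ (Sq 2 * 1) _ = (1 : ZMod 2) • cpImage z _ (4 * p - 1 + 0 + 1)
    rw [mul_one, one_smul, h.two p hp,
      show 4 * p - 1 + 0 + 1 = 4 * (p - 1) - 1 + cpExp 3 by change _ = _ + 5; ring, cpImage_eq]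
  · change Z.op _ _ (bVec 2) _ = (1 : ZMod 2) • cpImage z _ (4 * p - 1 + 2 + 1)
    rw [one_smul, show 4 * p - 1 + 2 + 1 = 4 * p - 1 + cpExp 2 by change _ = _ + 3; ring,
      cpImage_eq]
  · change _ = (0 : ZMod 2) • _
    rw [zero_smul]
    exact h.two_mul_b_two_op hp _
  · change _ = (0 : ZMod 2) • _
    rw [zero_smul]
    exact h.two_mul_b_three_op hp _

theorem CPFamily.op_cpImage_four (h : CPFamily Z I z) {n k : ℤ} (hn : 2 * k = n)
    (hI : cpRow k ∈ I) : Z.op n (n + (4 : ℕ)) (Sq 4) (cpImage z n k)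
      = binom2 k 2 • cpImage z (n + (4 : ℕ)) (k + 2) := by
  obtain ⟨p, j, hk⟩ := exists_row_col k
  have hp : p ∈ I := by rwa [hk, cpRow_eq] at hI
  rw [op_cpImage Sq_four_mem_A2 hn hk, hk, binom2_row_col p j (by norm_num)]
  fin_cases j
  · change Z.op _ _ (Sq 4 * 1) _ = (1 : ZMod 2) • cpImage z _ (4 * p - 1 + 0 + 2)
    rw [mul_one, one_smul,
      show 4 * p - 1 + 0 + 2 = 4 * p - 1 + cpExp 1 by change _ = _ + 2; ring, cpImage_eq]
    rfl
  · change _ = (0 : ZMod 2) • _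
    rw [zero_smul]
    exact h.four_mul_b_one_op hp _
  · change Z.op _ _ (bVec 3) _ = (1 : ZMod 2) • cpImage z _ (4 * p - 1 + 3 + 2)
    rw [one_smul, show 4 * p - 1 + 3 + 2 = 4 * p - 1 + cpExp 3 by change _ = _ + 5; ring,
      cpImage_eq]
  · change _ = (0 : ZMod 2) • _
    rw [zero_smul]
    exact h.four_mul_b_three_op hp _

/-- The degree parts of the morphism sending `x^{4p-1}` to `z_p`. -/
def CPVal.descMap {M : GrMod A2} (c : CPVal M I) (z : ∀ p, Z.obj.obj ⟨cpDeg p⟩) (n : ℤ) :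
    M.obj.obj ⟨n⟩ →ₗ[ZMod 2] Z.obj.obj ⟨n⟩ :=
  (Finsupp.lapply (n / 2) ∘ₗ c.val n).smulRight (cpImage z n (n / 2))

theorem CPVal.descMap_apply {M : GrMod A2} (c : CPVal M I) {n k : ℤ} (hn : 2 * k = n) {r : ZMod 2}
    {x : M.obj.obj ⟨n⟩} (hx : c.val n x = Finsupp.single k r) :
    c.descMap z n x = r • cpImage z n k := by
  obtain rfl : k = n / 2 := by omega
  rw [descMap, LinearMap.smulRight_apply, LinearMap.comp_apply, hx, Finsupp.lapply_apply,
    Finsupp.single_eq_same]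

theorem CPVal.descMap_eq_zero {M : GrMod A2} (c : CPVal M I) {n : ℤ} {x : M.obj.obj ⟨n⟩}
    (hx : c.val n x = 0) : c.descMap z n x = 0 := by
  rw [descMap, LinearMap.smulRight_apply, LinearMap.comp_apply, hx, map_zero, zero_smul]

/-- The morphism sending `x^{4p-1}` to `z_p`. -/
def CPVal.desc {M : GrMod A2} (c : CPVal M I) (h : CPFamily Z I z) : M ⟶ Z :=
  GrMod.homOfOp (c.descMap z) (op_of_generators _ (by
    intro g hg n x
    have hgA : Sq g ∈ A2 := by
      rcases hg with rfl | rfl | rfl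
      exacts [D_le_A2 Sq_one_mem_D, D_le_A2 Sq_two_mem_D, Sq_four_mem_A2]
    have hv := c.val_op (j := n + g) hgA (by simpa using Sq_mem_homog g) x
    rcases gradeCP_cases (c.val_mem n x) with h0 | ⟨k, hk, h1⟩
    · rw [c.descMap_eq_zero h0, map_zero, c.descMap_eq_zero (by rw [hv, h0, map_zero])]
    · have hI : cpRow k ∈ I := c.row_mem n x k (by rw [h1, Finsupp.single_eq_same]; exact one_ne_zero)
      rw [c.descMap_apply hk h1, one_smul]
      rcases hg with rfl | rfl | rfl
      · rw [h.op_cpImage_one hk hI, c.descMap_eq_zero]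
        rw [hv, h1, actCP_Sq, sqCP_single, if_neg (by decide)]
      · rw [h.op_cpImage_two hk hI]
        refine c.descMap_apply (by push_cast; omega) ?_
        rw [hv, h1, actCP_single (by decide)]
        rfl
      · rw [h.op_cpImage_four hk hI]
        refine c.descMap_apply (by push_cast; omega) ?_
        rw [hv, h1, actCP_single (by decide)]
        rfl))

end SteenrodExt
end

noncomputable section
namespace SteenrodExt

/-! ### The Ext groups of `C^∞_{-∞}` -/

/-- The Laurent polynomial underlying an element. -/
def cpVal : CPVal (cohomCP A2) Set.univ where
  val n := Submodule.subtype (gradeCP n)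
  val_mem n x := x.2
  val_op {i j a} ha hd x := by
    rw [GrMod.op_eq _ ha hd]
    rfl
  row_mem _ _ _ _ := Set.mem_univ _

theorem cpVal_injective (n : ℤ) : Function.Injective (cpVal.val n) := Subtype.val_injective

theorem single_mem_gradeCP {n k : ℤ} (h : 2 * k = n) : Finsupp.single k 1 ∈ gradeCP n :=
  Submodule.subset_span ⟨k, h, rfl⟩

/-- The element `x^{4p-1}`. -/
def cpGen (p : ℤ) : (cohomCP A2).obj.obj ⟨cpDeg p⟩ :=
  ⟨Finsupp.single (4 * p - 1) 1, single_mem_gradeCP (by rw [cpDeg_eq]; ring)⟩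

theorem cpVal_cpGen (p : ℤ) : cpVal.val _ (cpGen p) = Finsupp.single (4 * p - 1) 1 := rfl

theorem actCP_bVec (p : ℤ) (j : Fin 4) :
    actCP (bVec j) (Finsupp.single (4 * p - 1) 1) = Finsupp.single (4 * p - 1 + cpExp j) 1 := by
  have h1 : actCP (bVec 1) (Finsupp.single (4 * p - 1) 1) = Finsupp.single (4 * p - 1 + 2) 1 := by
    have e := binom2_row_col p 0 (i := 2) (by norm_num)
    change binom2 (4 * p - 1 + 0) 2 = 1 at e
    rw [add_zero] at e
    refine (actCP_single (by decide) _).trans ?_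
    rw [show 4 / 2 = 2 from rfl, e]
    rfl
  have h2 : actCP (bVec 2) (Finsupp.single (4 * p - 1) 1) = Finsupp.single (4 * p - 1 + 3) 1 := by
    have e := binom2_row_col p 1 (i := 1) (by norm_num)
    change binom2 (4 * p - 1 + 2) 1 = 1 at e
    change actCP (Sq 2 * bVec 1) _ = _
    rw [map_mul, Module.End.mul_apply, h1, actCP_single (by decide), show 2 / 2 = 1 from rfl, e]
    congr 1
    push_cast
    ring
  fin_cases j
  · change actCP 1 _ = Finsupp.single (4 * p - 1 + 0) 1
    rw [map_one, add_zero]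
    rfl
  · exact h1
  · exact h2
  · have e := binom2_row_col p 2 (i := 2) (by norm_num)
    change binom2 (4 * p - 1 + 3) 2 = 1 at e
    change actCP (Sq 4 * bVec 2) _ = Finsupp.single (4 * p - 1 + 5) 1
    rw [map_mul, Module.End.mul_apply, h2, actCP_single (by decide), show 4 / 2 = 2 from rfl, e]
    congr 1
    push_cast
    ring

theorem cpVal_op_cpGen {n p : ℤ} {j : Fin 4} (h : n = cpDeg p + bDeg j) :
    cpVal.val n ((cohomCP A2).op (cpDeg p) n (bVec j) (cpGen p))
      = Finsupp.single (4 * p - 1 + cpExp j) 1 := by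
  rw [cpVal.val_op (bVec_mem_A2 j) (by rw [h, add_sub_cancel_left]; exact bVec_mem_homog j),
    cpVal_cpGen, actCP_bVec]

theorem cohomCP_subsingleton {n : ℤ} (h : Odd n) : Subsingleton ((cohomCP A2).obj.obj ⟨n⟩) := by
  have h0 : ∀ x, cpVal.val n x = 0 := fun x => by
    rcases gradeCP_cases (cpVal.val_mem n x) with h0 | ⟨k, hk, -⟩
    · exact h0
    · obtain ⟨m, hm⟩ := h
      omega
  exact ⟨fun x y => cpVal_injective n ((h0 x).trans (h0 y).symm)⟩

theorem cpGen_family : CPFamily (cohomCP A2) Set.univ cpGen where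
  lower _ _ := Set.mem_univ _
  one p _ := by
    have := cohomCP_subsingleton (n := cpDeg p + 1) ⟨4 * p - 1, by rw [cpDeg_eq]; ring⟩
    exact Kills.of_op (D_le_A2 Sq_one_mem_D) Sq_one_mem_homog (Subsingleton.elim _ _)
  milnor p _ := by
    have := cohomCP_subsingleton (n := cpDeg p + 7) ⟨4 * p + 2, by rw [cpDeg_eq]; ring⟩
    exact Kills.of_op Q2_mem_A2 Q2_mem_homog (Subsingleton.elim _ _)
  two p _ j := by
    have e := cpDeg_eq p
    have e' := cpDeg_eq (p - 1)
    have e3 : bDeg 3 = 10 := rfl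
    by_cases hj : j = cpDeg p + 2
    · apply cpVal_injective
      rw [cpVal_op_cpGen (by omega), cpVal.val_op (D_le_A2 Sq_two_mem_D) (by
        rw [hj, add_sub_cancel_left]; exact Sq_two_mem_homog), cpVal_cpGen,
        actCP_single (by decide), show 2 / 2 = 1 from rfl]
      have hb := binom2_row_col p 0 (i := 1) (by norm_num)
      change binom2 (4 * p - 1 + 0) 1 = 1 at hb
      rw [add_zero] at hb
      rw [hb]
      congr 1
      change 4 * p - 1 + 1 = 4 * (p - 1) - 1 + 5
      ring
    · rw [GrMod.op_of_ne _ Sq_two_mem_homog hj,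
        GrMod.op_of_ne _ (bVec_mem_homog 3) (by omega)]

theorem cohomCP_hom_ext {Z : GrMod A2} {f g : cohomCP A2 ⟶ Z}
    (h : ∀ p, GrMod.app f ⟨cpDeg p⟩ (cpGen p) = GrMod.app g ⟨cpDeg p⟩ (cpGen p)) : f = g := by
  refine GrMod.hom_ext fun n x => ?_
  obtain ⟨n⟩ := n
  rcases gradeCP_cases (cpVal.val_mem n x) with h0 | ⟨k, hk, h1⟩
  · have : x = 0 := cpVal_injective n (h0.trans (map_zero _).symm)
    rw [this, map_zero, map_zero]
  · obtain ⟨p, j, rfl⟩ := exists_row_col k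
    have e := cpDeg_eq p
    have e' := two_mul_cpExp j
    have : x = (cohomCP A2).op (cpDeg p) n (bVec j) (cpGen p) :=
      cpVal_injective n (h1.trans (cpVal_op_cpGen (by omega)).symm)
    rw [this, GrMod.app_op, GrMod.app_op, h]

theorem GrMod.add_self {B : Subalgebra (ZMod 2) Steenrod} {Z : GrMod B} {n : DegreeCat B}
    (x : Z.obj.obj n) : x + x = 0 := by
  have : (2 : ZMod 2) • x = 0 := by rw [show (2 : ZMod 2) = 0 from rfl, zero_smul]
  rwa [two_smul] at this

theorem GrMod.eq_of_add {B : Subalgebra (ZMod 2) Steenrod} {Z : GrMod B} {n : DegreeCat B}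
    {x y : Z.obj.obj n} (h : x + y = 0) : x = y := by
  rw [← GrMod.add_self y] at h
  exact add_right_cancel h

theorem CPFamily.kills_D {Z : GrMod A2} {z : ∀ p, Z.obj.obj ⟨cpDeg p⟩}
    (h : CPFamily Z Set.univ z) (j : ℤ) (a : Steenrod) (hj : j ≠ 0) (ha : a ∈ subD)
    (hd : a ∈ homog j) : (twistCP.obj Z).op 0 j a z = 0 := by
  refine D_kill (Z := twistCP.obj Z) le_rfl z ?_ ?_ ?_ j a (by simpa using hj) ha
    (by simpa using hd)
  · refine (twistCP.obj_op Z Sq_one_mem_D (by simpa using Sq_one_mem_homog) z).trans ?_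
    funext p
    exact (twistCP_rho_of_C Z 0 (0 + 1) Sq_one_mem_D defoMap_Sq_one z p).trans
      ((h.one p (Set.mem_univ p)).op _)
  · refine (twistCP.obj_op Z Sq_two_mem_D (by simpa using Sq_two_mem_homog) z).trans ?_
    funext p
    refine (twistCP_rho_two Z 0 (0 + 2) z p).trans ?_
    have e1 := h.two p (Set.mem_univ p) (0 + 2 + twistCP.shift p)
    have e2 := defo_op (h.one (p - 1) (Set.mem_univ _)) (h.milnor (p - 1) (Set.mem_univ _))
      (0 + 2 + twistCP.shift p)
    exact (congrArg₂ (· + ·) e1 e2).trans (GrMod.add_self _)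
  · refine (twistCP.obj_op Z Q2_mem_D (by simpa using Q2_mem_homog) z).trans ?_
    funext p
    exact (twistCP_rho_of_C Z 0 (0 + 7) Q2_mem_D defoMap_Q2 z p).trans
      ((h.milnor p (Set.mem_univ p)).op _)

theorem CPFamily.of_hom {Z : GrMod A2} (g : trivialMod subD ⟶ twistCP.obj Z)
    {z : ∀ p, Z.obj.obj ⟨cpDeg p⟩} (hz : GrMod.app g ⟨0⟩ (trivOne subD) = z) :
    CPFamily Z Set.univ z := by
  have key : ∀ (j : ℤ) (d : Steenrod), j ≠ 0 → d ∈ subD → d ∈ homog j → ∀ p,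
      twistCP.rho Z 0 j d z p = 0 := by
    intro j d hj hd hn p
    have h := trivialMod_hom_op g hj (a := d)
    rw [hz] at h
    exact congrFun ((twistCP.obj_op Z hd (by simpa using hn) z).symm.trans h) p
  have one : ∀ p, Kills Z (z p) 1 (Sq 1) := fun p => by
    refine Kills.of_op (D_le_A2 Sq_one_mem_D) Sq_one_mem_homog
      (Z.op_congr (j := 1 + twistCP.shift p) (by ring) ?_)
    exact (twistCP_rho_of_C Z 0 1 Sq_one_mem_D defoMap_Sq_one z p).symm.trans
      (key 1 _ one_ne_zero Sq_one_mem_D Sq_one_mem_homog p)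
  have milnor : ∀ p, Kills Z (z p) 7 Q2 := fun p => by
    refine Kills.of_op Q2_mem_A2 Q2_mem_homog
      (Z.op_congr (j := 7 + twistCP.shift p) (by ring) ?_)
    exact (twistCP_rho_of_C Z 0 7 Q2_mem_D defoMap_Q2 z p).symm.trans
      (key 7 _ (by norm_num) Q2_mem_D Q2_mem_homog p)
  refine ⟨fun _ _ => Set.mem_univ _, fun p _ => one p, fun p _ => milnor p, fun p _ j => ?_⟩
  have e := cpDeg_eq p
  have e' := cpDeg_eq (p - 1)
  have e3 : bDeg 3 = 10 := rfl
  by_cases hj : j = 2 + twistCP.shift p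
  · rw [hj, ← defo_op (one (p - 1)) (milnor (p - 1))]
    exact GrMod.eq_of_add ((twistCP_rho_two Z 0 2 z p).symm.trans
      (key 2 _ (by norm_num) Sq_two_mem_D Sq_two_mem_homog p))
  · have e0 := twistCP_shift p
    rw [GrMod.op_of_ne _ Sq_two_mem_homog (by omega),
      GrMod.op_of_ne _ (bVec_mem_homog 3) (by omega)]

/-- The unit at `C^∞_{-∞}`. -/
def unitCP : trivialMod subD ⟶ twistCP.obj (cohomCP A2) := trivHom cpGen cpGen_family.kills_D

theorem unitCP_bijective (Z : GrMod A2) :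
    Function.Bijective fun f : cohomCP A2 ⟶ Z => unitCP ≫ twistCP.functor.map f := by
  have hf : ∀ f : cohomCP A2 ⟶ Z, GrMod.app (unitCP ≫ twistCP.functor.map f) ⟨0⟩ (trivOne subD)
      = fun p => GrMod.app f ⟨cpDeg p⟩ (cpGen p) := fun f =>
    congrArg (fun z : (twistCP.obj (cohomCP A2)).obj.obj ⟨0⟩ =>
      GrMod.app (twistCP.functor.map f) ⟨0⟩ z) (trivHom_app _ _)
  constructor
  · intro f g h
    refine cohomCP_hom_ext fun p => ?_
    have := (hf f).symm.trans ((congrArg (fun k : trivialMod subD ⟶ twistCP.obj Z =>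
      GrMod.app k ⟨0⟩ (trivOne subD)) h).trans (hf g))
    exact congrFun this p
  · intro g
    refine ⟨cpVal.desc (CPFamily.of_hom g rfl), trivialMod_hom_ext ?_⟩
    refine (hf _).trans ?_
    funext p
    have h0 : 4 * p - 1 = 4 * p - 1 + cpExp 0 := (add_zero _).symm
    refine (cpVal.descMap_apply (k := 4 * p - 1 + cpExp 0) ?_ (cpVal_cpGen p |>.trans
      (by rw [← h0]))).trans ?_
    · rw [← h0, cpDeg_eq]
      ring
    · refine (one_smul _ _).trans ((cpImage_eq _ p 0).trans ?_)
      exact Z.op_one (cpDeg p) _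

theorem bo_subsingleton {s : ℕ} {t : ℤ} (h : t < 0 ∨ 6 * (s : ℤ) < t) : Subsingleton (bo s t) := by
  rcases h with h | h
  · exact ext_subsingleton_of_neg _ _ (fun n hn => triv_subsingleton n hn)
      (fun n hn => susp_subsingleton t n (by omega)) s
  · refine ext_subsingleton_of_lt _ _ 6 ?_ (fun n hn => triv_subsingleton n hn) s
      (fun n hn => susp_subsingleton t n ?_)
    · intro i j a hij
      exact Subtype.ext (A1_homog_eq_zero_of_lt (by exact_mod_cast hij) a.2.1 a.2.2)
    · have : n.deg ≤ 6 * (s : ℤ) := by exact_mod_cast hn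
      omega

theorem boV2_subsingleton {s : ℕ} {t : ℤ} (h : t < 0 ∨ 7 * (s : ℤ) < t) :
    Subsingleton (boV2 s t) := by
  have : ∀ i : Fin (s + 1), Subsingleton (bo (s - i) (t - 7 * (i : ℕ))) := fun i =>
    bo_subsingleton (by
      have := i.2
      push_cast [Nat.cast_sub (Nat.lt_succ_iff.1 this)]
      omega)
  exact ⟨fun x y => DFinsupp.ext fun i => Subsingleton.elim _ _⟩

/-- A product with finitely many nonzero factors is a direct sum. -/
theorem pi_addEquiv_directSum {ι : Type} [DecidableEq ι] (G : ι → Type*)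
    [∀ i, AddCommGroup (G i)] (S : Finset ι) (h : ∀ i ∉ S, Subsingleton (G i)) :
    Nonempty ((∀ i, G i) ≃+ ⨁ i, G i) := by
  refine ⟨(AddEquiv.ofBijective (DirectSum.coeFnAddMonoidHom G) ⟨?_, fun f => ?_⟩).symm⟩
  · exact DFunLike.coe_injective
  · refine ⟨DirectSum.mk G S fun i => f i, ?_⟩
    funext i
    by_cases hi : i ∈ S
    · exact DirectSum.mk_apply_of_mem (β := G) (f := fun i : (S : Set ι) => f i) hi
    · have := h i hi
      exact Subsingleton.elim _ _

/-- `Ext_{A_2}(C^∞_{-∞}, ℤ₂) = ⨁_p Σ^{8p-2} bo[v_2]`. -/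
theorem ext_cohomCP (s : ℕ) (t : ℤ) :
    Nonempty (ExtB (cohomCP A2) s t ≃+ ⨁ p : ℤ, boV2 s (t - (8 * p - 2))) := by
  obtain ⟨e⟩ := twistCP_unipotent.ext twistCP_augmentation unitCP unitCP_bijective s t
  obtain ⟨e'⟩ := pi_addEquiv_directSum (fun p : ℤ => boV2 s (t - (8 * p - 2)))
    (Finset.Icc ((t + 2 - 7 * s) / 8) ((t + 2) / 8)) (fun p hp => boV2_subsingleton (by
      rw [Finset.mem_Icc] at hp
      omega))
  exact ⟨e.trans e'⟩

end SteenrodExt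
end

noncomputable section
namespace SteenrodExt

/-! ### The filtration of `C^∞_{-∞}` -/

/-- The span of the `x^k` in the rows `≤ p`. -/
def rowLE (p : ℤ) : Submodule (ZMod 2) (ℤ →₀ ZMod 2) :=
  Finsupp.supported (ZMod 2) (ZMod 2) {k | cpRow k ≤ p}

theorem mem_rowLE {p : ℤ} {v : ℤ →₀ ZMod 2} : v ∈ rowLE p ↔ ∀ k, v k ≠ 0 → cpRow k ≤ p := by
  rw [rowLE, Finsupp.mem_supported]
  exact ⟨fun h k hk => h (by simpa using hk), fun h k hk => h k (by simpa using hk)⟩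

theorem single_mem_rowLE {p k : ℤ} (h : cpRow k ≤ p) (c : ZMod 2) :
    Finsupp.single k c ∈ rowLE p :=
  Finsupp.single_mem_supported _ _ h

theorem cpRow_add_one {k : ℤ} (h : binom2 k 1 ≠ 0) : cpRow (k + 1) ≤ cpRow k := by
  obtain ⟨p, j, rfl⟩ := exists_row_col k
  rw [binom2_row_col p j (by norm_num)] at h
  rw [cpRow_eq]
  fin_cases j
  · change cpRow (4 * p - 1 + 0 + 1) ≤ p
    unfold cpRow
    split_ifs <;> omega
  · change cpRow (4 * p - 1 + 2 + 1) ≤ p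
    unfold cpRow
    split_ifs <;> omega
  · exact absurd rfl h
  · exact absurd rfl h

theorem cpRow_add_two {k : ℤ} (h : binom2 k 2 ≠ 0) : cpRow (k + 2) ≤ cpRow k := by
  obtain ⟨p, j, rfl⟩ := exists_row_col k
  rw [binom2_row_col p j (by norm_num)] at h
  rw [cpRow_eq]
  fin_cases j
  · change cpRow (4 * p - 1 + 0 + 2) ≤ p
    unfold cpRow
    split_ifs <;> omega
  · exact absurd rfl h
  · change cpRow (4 * p - 1 + 3 + 2) ≤ p
    unfold cpRow
    split_ifs <;> omega
  · exact absurd rfl h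

theorem sqCP_mem_rowLE {g : ℕ} (hg : g = 1 ∨ g = 2 ∨ g = 4) {p : ℤ} {v : ℤ →₀ ZMod 2}
    (hv : v ∈ rowLE p) : sqCP g v ∈ rowLE p := by
  have : rowLE p ≤ (rowLE p).comap (sqCP g) := by
    rw [rowLE, Finsupp.supported_eq_span_single]
    refine Submodule.span_le.2 ?_
    rintro _ ⟨k, hk, rfl⟩
    rw [← Finsupp.supported_eq_span_single]
    change sqCP g (Finsupp.single k 1) ∈ rowLE p
    have hk : cpRow k ≤ p := hk
    have key : ∀ l i, (binom2 k i ≠ 0 → cpRow l ≤ cpRow k) →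
        Finsupp.single l (1 * binom2 k i) ∈ rowLE p := by
      intro l i h
      by_cases h0 : binom2 k i = 0
      · rw [h0, mul_zero, Finsupp.single_zero]
        exact zero_mem _
      · exact single_mem_rowLE ((h h0).trans hk) _
    rw [sqCP_single]
    rcases hg with rfl | rfl | rfl
    · rw [if_neg (by decide)]
      exact zero_mem _
    · rw [if_pos (by decide)]
      exact key _ _ cpRow_add_one
    · rw [if_pos (by decide)]
      exact key _ _ cpRow_add_two
  exact this hv

theorem actCP_mem_rowLE {p : ℤ} {a : Steenrod} (ha : a ∈ A2) {v : ℤ →₀ ZMod 2}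
    (hv : v ∈ rowLE p) : actCP a v ∈ rowLE p := by
  induction ha using Algebra.adjoin_induction generalizing v with
  | mem g hg =>
    rcases hg with rfl | rfl | rfl <;> rw [actCP_Sq] <;> exact sqCP_mem_rowLE (by simp) hv
  | algebraMap r =>
    rw [AlgHom.commutes]
    exact Submodule.smul_mem _ r hv
  | add a b _ _ ha hb =>
    rw [map_add]
    exact add_mem (ha hv) (hb hv)
  | mul a b _ _ ha hb =>
    rw [map_mul]
    exact ha (hb hv)

/-- The submodule of `C^∞_{-∞}` spanned by the rows `≤ p`. -/
def filCP (p : ℤ) : GrMod A2 :=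
  GrMod.ofInternal (actCP.comp A2.val) (fun n => gradeCP n ⊓ rowLE p)
    (fun d n b hb v hv => ⟨actCP_mem d n b hb v hv.1, actCP_mem_rowLE b.2 hv.2⟩)

/-- The Laurent polynomial underlying an element of the filtration. -/
def filVal (p : ℤ) : CPVal (filCP p) (Set.Iic p) where
  val n := Submodule.subtype (gradeCP n ⊓ rowLE p)
  val_mem n x := x.2.1
  val_op {i j a} ha hd x := by
    rw [GrMod.op_eq _ ha hd]
    rfl
  row_mem n x k hk := mem_rowLE.1 x.2.2 k hk

theorem filVal_injective (p n : ℤ) : Function.Injective ((filVal p).val n) :=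
  Subtype.val_injective

/-- An element of the filtration from its underlying Laurent polynomial. -/
def filElt {p n : ℤ} (v : ℤ →₀ ZMod 2) (h : v ∈ gradeCP n) (h' : v ∈ rowLE p) :
    (filCP p).obj.obj ⟨n⟩ := ⟨v, h, h'⟩

theorem filVal_filElt {p n : ℤ} (v : ℤ →₀ ZMod 2) (h : v ∈ gradeCP n) (h' : v ∈ rowLE p) :
    (filVal p).val n (filElt v h h') = v := rfl

/-- The inclusion of the filtration. -/
def filIncl (p : ℤ) : filCP p ⟶ cohomCP A2 :=
  GrMod.mkHom (fun n => Submodule.inclusion (inf_le_left : gradeCP n.deg ⊓ rowLE p ≤ gradeCP n.deg))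
    (fun _ _ => rfl)

theorem rowLE_mono {p q : ℤ} (h : p ≤ q) : rowLE p ≤ rowLE q := fun _ hv =>
  mem_rowLE.2 fun k hk => (mem_rowLE.1 hv k hk).trans h

/-- The inclusions between the steps of the filtration. -/
def filMap {p q : ℤ} (h : p ≤ q) : filCP p ⟶ filCP q :=
  GrMod.mkHom (fun n => Submodule.inclusion
    (inf_le_inf_left _ (rowLE_mono h) : gradeCP n.deg ⊓ rowLE p ≤ gradeCP n.deg ⊓ rowLE q))
    (fun _ _ => rfl)

theorem filMap_incl {p q : ℤ} (h : p ≤ q) : filMap h ≫ filIncl q = filIncl p := rfl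

theorem cpVal_filIncl (p n : ℤ) (x : (filCP p).obj.obj ⟨n⟩) :
    cpVal.val n (GrMod.app (filIncl p) ⟨n⟩ x) = (filVal p).val n x := rfl

instance (p : ℤ) : Mono (filIncl p) :=
  GrMod.mono_of_injective _ fun n x y h => filVal_injective p n.deg (by
    have := congrArg (cpVal.val n.deg) h
    exact this)

instance {p q : ℤ} (h : p ≤ q) : Mono (filMap h) :=
  GrMod.mono_of_injective _ fun n x y e => filVal_injective p n.deg (by
    have := congrArg ((filVal q).val n.deg) e
    exact this)

/-! ### The graded pieces -/

theorem susp_op {B : Subalgebra (ZMod 2) Steenrod} (k : ℤ) (M : GrMod B) (i j : ℤ) (a : Steenrod)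
    (x : M.obj.obj ⟨i - k⟩) : (susp k M).op i j a x = M.op (i - k) (j - k) a x := by
  by_cases h : a ∈ Subalgebra.toSubmodule B ⊓ homog (j - i)
  · have h' : a ∈ homog (j - k - (i - k)) := by
      rw [sub_sub_sub_cancel_right]
      exact h.2
    rw [GrMod.op_eq _ h.1 h.2, GrMod.op_eq _ h.1 h']
    rfl
  · have h' : a ∉ Subalgebra.toSubmodule B ⊓ homog (j - k - (i - k)) := by
      rwa [sub_sub_sub_cancel_right]
    rw [GrMod.op, dif_neg h, GrMod.op, dif_neg h']
    rfl

/-- The generator of `M_10`, extended by zero to the other degrees. -/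
def M10.unitAt (n : ℤ) : M10.obj.obj ⟨n⟩ :=
  if h : n = 0 then M10.elt n 1 (one_mem _) (h ▸ one_mem_homog) else 0

theorem M10.unitAt_of_ne {n : ℤ} (h : n ≠ 0) : M10.unitAt n = 0 := dif_neg h

theorem M10.op_unitAt_D {n j : ℤ} {d : Steenrod} (hj : j ≠ n) (hd : d ∈ subD)
    (hn : d ∈ homog (j - n)) : M10.op n j d (M10.unitAt n) = 0 := by
  by_cases h : n = 0
  · subst h
    exact M10.op_one_D hj hd hn
  · rw [M10.unitAt_of_ne h, map_zero]

theorem M10.val_op_unitAt {n j : ℤ} (h : n = 0) {a : Steenrod} (ha : a ∈ A2)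
    (hj : a ∈ homog (j - n)) : M10.val j (M10.op n j a (M10.unitAt n)) = M10.mk ⟨a, ha⟩ := by
  subst h
  have := congrArg (M10.val j) (M10.op_one_elt ha (by simpa using hj))
  exact this

/-- The family defining the projection to the graded piece. -/
def grFamily (p q : ℤ) : (susp (8 * p - 2) M10).obj.obj ⟨cpDeg q⟩ :=
  M10.unitAt (cpDeg q - (8 * p - 2))

theorem grFamily_of_ne {p q : ℤ} (h : q ≠ p) : grFamily p q = 0 :=
  M10.unitAt_of_ne (by rw [cpDeg_eq]; omega)

theorem grFamily_kills {p q c : ℤ} {d : Steenrod} (hc : c ≠ 0) (hd : d ∈ subD) (hn : d ∈ homog c) :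
    Kills (susp (8 * p - 2) M10) (grFamily p q) c d := by
  refine Kills.of_op (D_le_A2 hd) hn ?_
  refine (susp_op _ _ _ _ _ _).trans (M10.op_unitAt_D (by omega) hd ?_)
  rwa [show cpDeg q + c - (8 * p - 2) - (cpDeg q - (8 * p - 2)) = c by ring]

theorem grFamily_family (p : ℤ) : CPFamily (susp (8 * p - 2) M10) (Set.Iic p) (grFamily p) where
  lower q hq := by
    have : q ≤ p := hq
    change q - 1 ≤ p
    omega
  one q _ := grFamily_kills one_ne_zero Sq_one_mem_D Sq_one_mem_homog
  milnor q _ := grFamily_kills (by norm_num) Q2_mem_D Q2_mem_homog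
  two q hq j := by
    have hq : q ≤ p := hq
    rw [(grFamily_kills (by norm_num) Sq_two_mem_D Sq_two_mem_homog).op j,
      grFamily_of_ne (by omega), map_zero]

/-- The projection to the graded piece. -/
def grProj (p : ℤ) : filCP p ⟶ susp (8 * p - 2) M10 := (filVal p).desc (grFamily_family p)

theorem val_op_grFamily {n p : ℤ} {j : Fin 4} (h : n = cpDeg p + bDeg j) :
    M10.val (n - (8 * p - 2)) ((susp (8 * p - 2) M10).op (cpDeg p) n (bVec j) (grFamily p p))
      = M10.basisVec j := by
  have e := cpDeg_eq p
  rw [M10.basisVec_eq]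
  refine (congrArg (M10.val (n - (8 * p - 2))) (susp_op (8 * p - 2) M10 (cpDeg p) n (bVec j)
    (M10.unitAt (cpDeg p - (8 * p - 2))))).trans ?_
  refine M10.val_op_unitAt (by omega) (bVec_mem_A2 j) ?_
  rw [show n - (8 * p - 2) - (cpDeg p - (8 * p - 2)) = bDeg j by omega]
  exact bVec_mem_homog j

theorem grProj_app_single {p n : ℤ} {j : Fin 4} (hn : n = cpDeg p + bDeg j) {r : ZMod 2}
    {x : (filCP p).obj.obj ⟨n⟩} (hx : (filVal p).val n x = Finsupp.single (4 * p - 1 + cpExp j) r) :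
    M10.val (n - (8 * p - 2)) (GrMod.app (grProj p) ⟨n⟩ x) = r • M10.basisVec j := by
  have e := cpDeg_eq p
  have e' := two_mul_cpExp j
  have hk : 2 * (4 * p - 1 + cpExp j) = n := by omega
  have h1 : GrMod.app (grProj p) ⟨n⟩ x
      = r • cpImage (grFamily p) n (4 * p - 1 + cpExp j) :=
    (filVal p).descMap_apply hk hx
  rw [cpImage_eq] at h1
  refine (congrArg (M10.val (n - (8 * p - 2))) h1).trans ?_
  refine (map_smul (M10.val (n - (8 * p - 2))) r _).trans ?_
  exact congrArg (r • ·) (val_op_grFamily hn)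

theorem filMap_grProj (p : ℤ) (h : p - 1 ≤ p) : filMap h ≫ grProj p = 0 := by
  refine GrMod.hom_ext fun n x => ?_
  obtain ⟨n⟩ := n
  rw [GrMod.zero_app]
  change (filVal p).descMap (grFamily p) n (GrMod.app (filMap h) ⟨n⟩ x) = 0
  rcases gradeCP_cases ((filVal (p - 1)).val_mem n x) with h0 | ⟨k, hk, h1⟩
  · exact (filVal p).descMap_eq_zero h0
  · have hr := (filVal (p - 1)).row_mem n x k (by
      rw [h1, Finsupp.single_eq_same]; exact one_ne_zero)
    have hr : cpRow k ≤ p - 1 := hr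
    rw [(filVal p).descMap_apply hk h1, cpImage, grFamily_of_ne (by omega), map_zero, smul_zero]

theorem grProj_surjective (p n : ℤ) : Function.Surjective (GrMod.app (grProj p) ⟨n⟩) := by
  intro y
  obtain ⟨a, ha, hd, rfl⟩ := M10.exists_elt (n - (8 * p - 2)) y
  have hy : M10.val _ (M10.elt (n - (8 * p - 2)) a ha hd) = ∑ k, augK k a • M10.basisVec k :=
    (M10.sum_coord _).symm
  by_cases h : ∃ j, n - (8 * p - 2) = bDeg j
  · obtain ⟨j, hj⟩ := h
    have e := cpDeg_eq p
    have e' := two_mul_cpExp j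
    have hn : n = cpDeg p + bDeg j := by omega
    have hk : 2 * (4 * p - 1 + cpExp j) = n := by omega
    have hg : augK j a • Finsupp.single (4 * p - 1 + cpExp j) (1 : ZMod 2) ∈ gradeCP n :=
      Submodule.smul_mem _ _ (single_mem_gradeCP hk)
    have hr : augK j a • Finsupp.single (4 * p - 1 + cpExp j) (1 : ZMod 2) ∈ rowLE p :=
      Submodule.smul_mem _ _ (single_mem_rowLE (cpRow_eq p j).le _)
    refine ⟨filElt _ hg hr, M10.val_injective _ ?_⟩
    refine (grProj_app_single (n := n) (j := j) (r := augK j a) hn ?_).trans (Eq.trans ?_ hy.symm)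
    · rw [filVal_filElt, Finsupp.smul_single, smul_eq_mul, mul_one]
    · rw [Finset.sum_eq_single j]
      · intro k _ hk
        rw [augK_eq_zero k (fun e => hk ?_) ha hd, zero_smul]
        exact (by decide : ∀ k l, bDeg k = bDeg l → k = l) k j (e.symm.trans hj)
      · exact fun hj => absurd (Finset.mem_univ j) hj
  · refine ⟨0, M10.val_injective _ ?_⟩
    refine Eq.trans ?_ hy.symm
    rw [map_zero, Finset.sum_eq_zero fun k _ => ?_]
    · exact map_zero _
    · rw [augK_eq_zero k (fun e => h ⟨k, e⟩) ha hd, zero_smul]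

theorem grProj_exact (p n : ℤ) (h : p - 1 ≤ p) (x : (filCP p).obj.obj ⟨n⟩)
    (hx : GrMod.app (grProj p) ⟨n⟩ x = 0) : ∃ y, GrMod.app (filMap h) ⟨n⟩ y = x := by
  suffices hr : (filVal p).val n x ∈ rowLE (p - 1) from
    ⟨filElt _ ((filVal p).val_mem n x) hr, filVal_injective p n rfl⟩
  rcases gradeCP_cases ((filVal p).val_mem n x) with h0 | ⟨k, hk, h1⟩
  · rw [h0]
    exact zero_mem _
  · have hr := (filVal p).row_mem n x k (by
      rw [h1, Finsupp.single_eq_same]; exact one_ne_zero)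
    have hr : cpRow k ≤ p := hr
    rw [h1]
    refine single_mem_rowLE ?_ _
    by_contra hc
    obtain ⟨q, j, rfl⟩ := exists_row_col k
    rw [cpRow_eq] at hr hc
    obtain rfl : q = p := by omega
    have e := cpDeg_eq q
    have e' := two_mul_cpExp j
    have := grProj_app_single (j := j) (by omega) h1
    rw [hx, one_smul] at this
    exact M10.linearIndependent_basisVec.ne_zero j (this.symm.trans (map_zero _))

theorem gr_shortExact (p : ℤ) (h : p - 1 ≤ p) :
    (ShortComplex.mk (filMap h) (grProj p) (filMap_grProj p h)).ShortExact :=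
  GrMod.shortExact_of_eval _
    (fun n => GrMod.injective_app_of_mono (filMap h) n)
    (fun n => grProj_surjective p n.deg)
    (fun n x hx => grProj_exact p n.deg h x hx)

/-- The filtration as a family of subobjects. -/
abbrev filSub (p : ℤ) : Subobject (cohomCP A2) := Subobject.mk (filIncl p)

theorem filSub_mono : Monotone filSub := fun _ _ h =>
  Subobject.mk_le_mk_of_comm (filMap h) (filMap_incl h)

theorem mem_degreePart_filSub {p n : ℤ} {x : (cohomCP A2).obj.obj ⟨n⟩} :
    x ∈ degreePart (filSub p) n ↔ cpVal.val n x ∈ rowLE p := by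
  have e : (Subobject.underlyingIso (filIncl p)).hom ≫ filIncl p = (filSub p).arrow :=
    Subobject.underlyingIso_hom_comp_eq_mk _
  constructor
  · rintro ⟨y, rfl⟩
    change cpVal.val n (GrMod.app (filSub p).arrow ⟨n⟩ y) ∈ rowLE p
    rw [← e, GrMod.comp_app, cpVal_filIncl]
    exact (GrMod.app (Subobject.underlyingIso (filIncl p)).hom ⟨n⟩ y).2.2
  · intro h
    have e' : (Subobject.underlyingIso (filIncl p)).inv ≫ (filSub p).arrow = filIncl p :=
      Subobject.underlyingIso_arrow _
    refine ⟨GrMod.app (Subobject.underlyingIso (filIncl p)).inv ⟨n⟩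
      (filElt _ (cpVal.val_mem n x) h), ?_⟩
    change GrMod.app (filSub p).arrow ⟨n⟩ _ = x
    rw [← GrMod.comp_app, e']
    exact cpVal_injective n rfl

theorem filSub_cokernel (p : ℤ) (h : filSub (p - 1) ≤ filSub p) :
    Nonempty (cokernel (Subobject.ofLE (filSub (p - 1)) (filSub p) h) ≅ susp (8 * p - 2) M10) := by
  have hp : p - 1 ≤ p := sub_le_self p zero_le_one
  have hS := gr_shortExact p hp
  have := hS.epi_g
  let i1 : cokernel (Subobject.ofLE (filSub (p - 1)) (filSub p) h) ≅ cokernel (filMap hp) :=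
    cokernel.mapIso _ _ (Subobject.underlyingIso (filIncl (p - 1)))
      (Subobject.underlyingIso (filIncl p)) (by
        rw [← cancel_mono (filIncl p), Category.assoc, Category.assoc, filMap_incl]
        rw [Subobject.underlyingIso_hom_comp_eq_mk, Subobject.underlyingIso_hom_comp_eq_mk]
        exact Subobject.ofLE_arrow h)
  exact ⟨i1.trans ((cokernelIsCokernel (filMap hp)).coconePointUniqueUpToIso hS.gIsCokernel)⟩

theorem filSub_exhaustive (n : ℤ) (x : (cohomCP A2).obj.obj ⟨n⟩) :
    ∃ p, x ∈ degreePart (filSub p) n := by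
  rcases gradeCP_cases (cpVal.val_mem n x) with h0 | ⟨k, -, h1⟩
  · exact ⟨0, mem_degreePart_filSub.2 (by rw [h0]; exact zero_mem _)⟩
  · exact ⟨cpRow k, mem_degreePart_filSub.2 (by rw [h1]; exact single_mem_rowLE le_rfl _)⟩

theorem filSub_separated (n : ℤ) (x : (cohomCP A2).obj.obj ⟨n⟩)
    (h : ∀ p, x ∈ degreePart (filSub p) n) : x = 0 := by
  refine cpVal_injective n (Eq.trans ?_ (map_zero _).symm)
  ext k
  by_contra hk
  have := mem_rowLE.1 (mem_degreePart_filSub.1 (h (cpRow k - 1))) k hk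
  omega

end SteenrodExt
end

theorem theorem5p2 :
    (∀ (s : ℕ) (t : ℤ), Nonempty
      (ExtB (cohomCP A2) s t ≃+ ⨁ p : ℤ, boV2 s (t - (8 * p - 2)))) ∧
    (∃ (F : ℤ → Subobject (cohomCP A2)) (hF : Monotone F),
      (∀ (n : ℤ) (x : (cohomCP A2).obj.obj ⟨n⟩), ∃ p, x ∈ degreePart (F p) n) ∧
      (∀ (n : ℤ) (x : (cohomCP A2).obj.obj ⟨n⟩), (∀ p, x ∈ degreePart (F p) n) → x = 0) ∧
      ∀ p : ℤ, Nonempty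
        (cokernel (Subobject.ofLE (F (p - 1)) (F p) (hF (sub_le_self p zero_le_one))) ≅
          susp (8 * p - 2) M10)) ∧
    (LinearIndependent (ZMod 2) M10.basisVec ∧
      Submodule.span (ZMod 2) (Set.range M10.basisVec) = ⊤) ∧
    (∀ (s : ℕ) (t : ℤ), Nonempty (ExtB M10 s t ≃+ boV2 s t)) := by
  exact ⟨ext_cohomCP, ⟨filSub, filSub_mono, filSub_exhaustive, filSub_separated,
    fun p => filSub_cokernel p _⟩,
    ⟨M10.linearIndependent_basisVec, M10.span_basisVec⟩, ext_M10⟩
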